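/- All graphs are finite and simple. An induced cycle of a graph $G$ is an induced subgraph of $G$ that is isomorphic to a cycle $C_k$ for some $k\ge 3$ (so triangles are included), and $m(n)$ denotes the maximum number of induced cycles contained in a graph on $n$ vertices. There exists $n_0$ such that, for all $n\ge n_0$, $$m(n)=\begin{cases}3^{n/3}+12n & \text{if } n\equiv 0 \pmod 3,\\ 4\cdot 3^{(n-4)/3}+12n+51 & \text{if } n\equiv 1 \pmod 3,\\ 2\cdot 3^{(n-2)/3}+12n-36 & \text{if } n\equiv 2 \pmod 3.\end{cases}$$ In particular, $m(n)=\Theta(3^{n/3})$ as $n\to\infty$. -/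

import Mathlib

namespace SimpleGraph

/-- The vertex set `S` spans an induced cycle of `G`: the subgraph of `G` induced on `S` is
isomorphic to a cycle `C_k` with `k ≥ 3`. Triangles count as induced cycles. -/
def IsInducedCycle {V : Type*} (G : SimpleGraph V) (S : Set V) : Prop :=
  ∃ k : ℕ, 3 ≤ k ∧ Nonempty (G.induce S ≃g cycleGraph k)

/-- The number of induced cycles of `G`. An induced subgraph is determined by its vertex set, so
the induced cycles are counted by their vertex sets. -/
noncomputable def numInducedCycles {V : Type*} (G : SimpleGraph V) : ℕ :=
  {S : Set V | G.IsInducedCycle S}.ncard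

/-- `m(n)`: the maximum number of induced cycles in a graph on `n` vertices. -/
noncomputable def maxInducedCycles (n : ℕ) : ℕ :=
  sSup (Set.range fun G : SimpleGraph (Fin n) => G.numInducedCycles)

/-- The supremum defining `m(n)` is an attained maximum. -/
theorem isGreatest_maxInducedCycles (n : ℕ) :
    IsGreatest (Set.range fun G : SimpleGraph (Fin n) => G.numInducedCycles)
      (maxInducedCycles n) := by
  have hb : BddAbove (Set.range fun G : SimpleGraph (Fin n) => G.numInducedCycles) :=
    (Set.finite_range _).bddAbove
  exact ⟨Nat.sSup_mem ⟨_, ⊥, rfl⟩ hb, fun _ h => le_csSup hb h⟩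

end SimpleGraph

/-! The basic estimate: when an induced path is extended from its last vertex by one of the `d`
available neighbours, all `d` of them become unavailable afterwards. Since `d * maxProd m ≤ maxProd
(m + d)`, a set `R` admits at most `maxProd R.card ≤ 3 ^ (R.card / 3)` continuations
(`pathCount_le_maxProd`). A cycle through `v` is such a path between two neighbours of `v`, so m(n)
is 3^(n/3) up to polynomial factors. The exact value comes from stability.

Let `G` have at least 0.9 · 3^(n/3) induced cycles. A vertex subset maximising (number of cycles) ·
(4/5)^(size) has degrees at most 30, and if it is proper it carries too many cycles for its size, so
bounded degree may be assumed (`exists_dense_subset`, `exists_bound`). Then some branching process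
has a path count within a polynomial factor of the maximum. By an entropy argument, an average path
discards only O(log n) vertices at nodes that do not have exactly three balanced continuations
(`totalDefect_good_le`). Bounded degree turns this into rigidity: at most nodes the three
continuations see the same next triple (`totalDefect_clean_le`). A pigeonhole argument along one
good path then yields a strip, a long run of triples that are consecutively completely joined and
otherwise isolated (`exists_strip`).

The classes of a strip are modules, so an induced cycle of length at least 5 either avoids the inner
classes or traverses the strip. The cycles that avoid them are negligible. The traversing ones are
counted by paths in the complement of two adjacent classes, and there a gap holds: a path count is
either at most 31/32 of `maxProd`, or it is maximal and the set is layered (`pathCount_gap`). Hence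
`G` has at most `maxProd n` cycles, or it is a blow-up of a cycle whose class sizes have maximal
product (`IsStrip.dichotomy`).

In such a blow-up an induced cycle is a transversal of the classes or has two vertices in one class.
The former number at most the product of the sizes. The latter are confined to at most three
consecutive classes and are most numerous if the classes are independent, which gives `localBound`.
The blow-up with independent classes attains the sum. -/

namespace InducedCycles

open Finset

set_option linter.unusedSectionVars false

/-! ### Maximal products with given sum and the growth function -/

/-- The largest product of positive integers with sum `n`. -/
def maxProd : ℕ → ℕ
  | 0 => 1
  | 1 => 1
  | 2 => 2
  | 3 => 3
  | 4 => 4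
  | n + 5 => 3 * maxProd (n + 2)

theorem maxProd_add_three {n : ℕ} (hn : 2 ≤ n) : maxProd (n + 3) = 3 * maxProd n := by
  obtain ⟨k, rfl⟩ := Nat.exists_eq_add_of_le' hn
  rw [show k + 2 + 3 = k + 5 by ring, maxProd]

theorem maxProd_pos : ∀ n, 0 < maxProd n
  | 0 | 1 | 2 | 3 | 4 => by decide
  | n + 5 => by rw [maxProd]; have := maxProd_pos (n + 2); omega

theorem le_maxProd : ∀ n, 1 ≤ n → n ≤ maxProd n
  | 0 | 1 | 2 | 3 | 4 => by decide
  | n + 5 => by rw [maxProd]; have := le_maxProd (n + 2); omega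

/-- A factor 3 can be split off any argument that is at least 5, which leaves a finite table. -/
theorem maxProd_mul_le (a b : ℕ) : maxProd a * maxProd b ≤ maxProd (a + b) := by
  induction hN : a + b using Nat.strong_induction_on generalizing a b with
  | _ N ih =>
    subst hN
    rcases Nat.lt_or_ge a 5 with ha | ha
    · rcases Nat.lt_or_ge b 5 with hb | hb
      · interval_cases a <;> interval_cases b <;> decide
      · obtain ⟨k, rfl⟩ := Nat.exists_eq_add_of_le' hb
        have := ih (a + (k + 2)) (by omega) a (k + 2) rfl
        rw [show a + (k + 5) = (a + (k + 2)) + 3 by ring, maxProd_add_three (by omega),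
          maxProd_add_three (by omega)]
        nlinarith
    · obtain ⟨k, rfl⟩ := Nat.exists_eq_add_of_le' ha
      have := ih (k + 2 + b) (by omega) (k + 2) b rfl
      rw [show k + 5 + b = (k + 2 + b) + 3 by ring, maxProd_add_three (by omega),
        maxProd_add_three (by omega)]
      nlinarith

/-- This is the step of the branching bound: `d` choices consume `d` vertices. -/
theorem mul_maxProd_le (d m : ℕ) : d * maxProd m ≤ maxProd (m + d) := by
  rcases Nat.eq_zero_or_pos d with rfl | hd
  · simp
  · calc d * maxProd m ≤ maxProd d * maxProd m := Nat.mul_le_mul_right _ (le_maxProd d hd)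
      _ ≤ maxProd (d + m) := maxProd_mul_le d m
      _ = _ := by rw [add_comm]

theorem maxProd_pow_three_le : ∀ n, maxProd n ^ 3 ≤ 3 ^ n
  | 0 | 1 | 2 | 3 | 4 => by decide
  | n + 5 => by
    have := maxProd_pow_three_le (n + 2)
    rw [maxProd, mul_pow, show n + 5 = (n + 2) + 3 by ring, pow_add]
    omega

/-- The worst residue is 1 mod 3, where the cubed ratio to `3 ^ n` is 64/81 from `n = 4` on. At `n =
1` the bound fails. -/
theorem le_maxProd_pow_three : ∀ n, 2 ≤ n → 729 * 3 ^ n ≤ 1000 * maxProd n ^ 3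
  | 0 | 1 | 2 | 3 | 4 => by decide
  | n + 5 => fun _ => by
    have := le_maxProd_pow_three (n + 2) (by omega)
    rw [maxProd, mul_pow, show n + 5 = (n + 2) + 3 by ring, pow_add]
    omega

/-- The growth function `3 ^ (n / 3)`. -/
noncomputable def growth (n : ℕ) : ℝ := (3 : ℝ) ^ ((n : ℝ) / 3)

theorem growth_pos (n : ℕ) : 0 < growth n := by unfold growth; positivity

theorem growth_pow_three (n : ℕ) : growth n ^ 3 = 3 ^ n := by
  unfold growth
  rw [← Real.rpow_natCast, ← Real.rpow_mul (by norm_num)]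
  norm_num

theorem growth_add (m n : ℕ) : growth (m + n) = growth m * growth n := by
  unfold growth
  rw [← Real.rpow_add (by norm_num)]
  push_cast
  ring_nf

theorem growth_three_mul (k : ℕ) : growth (3 * k) = 3 ^ k := by
  unfold growth
  rw [← Real.rpow_natCast]
  push_cast
  congr 1
  ring

theorem log_growth (n : ℕ) : Real.log (growth n) = n * (Real.log 3 / 3) := by
  unfold growth
  rw [Real.log_rpow (by norm_num)]
  ring

theorem growth_mono {m n : ℕ} (h : m ≤ n) : growth m ≤ growth n := by
  unfold growth
  apply Real.rpow_le_rpow_of_exponent_le (by norm_num)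
  have : (m : ℝ) ≤ n := by exact_mod_cast h
  linarith

theorem one_le_growth (n : ℕ) : 1 ≤ growth n := by
  have := growth_mono (Nat.zero_le n)
  simpa [growth] using this

theorem maxProd_le_growth (n : ℕ) : (maxProd n : ℝ) ≤ growth n := by
  apply le_of_pow_le_pow_left₀ (n := 3) (by norm_num) (growth_pos n).le
  rw [growth_pow_three]
  exact_mod_cast maxProd_pow_three_le n

theorem growth_le_maxProd {n : ℕ} (hn : 2 ≤ n) : 9 / 10 * growth n ≤ maxProd n := by
  apply le_of_pow_le_pow_left₀ (n := 3) (by norm_num) (by positivity)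
  rw [mul_pow, growth_pow_three]
  have : (729 * 3 ^ n : ℝ) ≤ 1000 * maxProd n ^ 3 := by exact_mod_cast le_maxProd_pow_three n hn
  linarith

/-! ### Induced paths as a branching process -/

section Paths

open scoped Classical

variable {V : Type*} [DecidableEq V] (G : SimpleGraph V) (E : Finset V)

/-- The neighbours of `s` in `R`. -/
noncomputable def nb (R : Finset V) (s : V) : Finset V := R.filter (G.Adj s)

variable {G} in
theorem mem_nb {R : Finset V} {s a : V} : a ∈ nb G R s ↔ a ∈ R ∧ G.Adj s a := by
  simp [nb]

theorem nb_subset (R : Finset V) (s : V) : nb G R s ⊆ R := filter_subset _ _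

variable {G} in
theorem card_sdiff_nb_lt {R : Finset V} {s a : V} (h : a ∈ nb G R s) :
    (R \ nb G R s).card < R.card :=
  card_lt_card (sdiff_ssubset (nb_subset G R s) ⟨a, h⟩)

theorem card_sdiff_nb (R : Finset V) (s : V) :
    (R \ nb G R s).card + (nb G R s).card = R.card :=
  card_sdiff_add_card_eq_card (nb_subset G R s)

/-- Induction along the branching process that extends an induced path. -/
theorem node_induction {P : Finset V → V → Prop}
    (h : ∀ R s, (∀ a ∈ nb G R s, P (R \ nb G R s) a) → P R s) (R : Finset V) (s : V) : P R s := by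
  induction hN : R.card using Nat.strong_induction_on generalizing R s with
  | _ N ih =>
    subst hN
    exact h R s fun a ha => ih _ (card_sdiff_nb_lt ha) _ _ rfl

/-- The number of induced paths that start in `s`, continue in `R`, and stop as soon as they
reach `E`. -/
noncomputable def pathCount (R : Finset V) (s : V) : ℕ :=
  if s ∈ E then 1 else ∑ a ∈ (nb G R s).attach, pathCount (R \ nb G R s) a
termination_by R.card
decreasing_by exact card_sdiff_nb_lt a.2

/-- The sets of inner vertices, together with the last one, of the paths counted by
`pathCount`. -/
noncomputable def pathSets (R : Finset V) (s : V) : Finset (Finset V) :=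
  if s ∈ E then {∅} else
    (nb G R s).attach.biUnion fun a => (pathSets (R \ nb G R s) a).image (insert a.1)
termination_by R.card
decreasing_by exact card_sdiff_nb_lt a.2

variable {G E}

theorem pathCount_of_mem {R : Finset V} {s : V} (h : s ∈ E) : pathCount G E R s = 1 := by
  rw [pathCount, if_pos h]

theorem pathCount_of_notMem {R : Finset V} {s : V} (h : s ∉ E) :
    pathCount G E R s = ∑ a ∈ nb G R s, pathCount G E (R \ nb G R s) a := by
  rw [pathCount, if_neg h]
  exact sum_attach (nb G R s) fun a => pathCount G E (R \ nb G R s) a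

theorem pathSets_of_mem {R : Finset V} {s : V} (h : s ∈ E) : pathSets G E R s = {∅} := by
  rw [pathSets, if_pos h]

theorem mem_pathSets_of_notMem {R : Finset V} {s : V} (h : s ∉ E) {S : Finset V} :
    S ∈ pathSets G E R s ↔
      ∃ a ∈ nb G R s, ∃ S' ∈ pathSets G E (R \ nb G R s) a, insert a S' = S := by
  rw [pathSets, if_neg h]
  simp

variable (G E)

theorem card_pathSets_le (R : Finset V) (s : V) :
    (pathSets G E R s).card ≤ pathCount G E R s := by
  induction R, s using node_induction G with
  | h R s ih =>
    by_cases hs : s ∈ E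
    · rw [pathSets_of_mem hs, pathCount_of_mem hs, card_singleton]
    · rw [pathSets, if_neg hs, pathCount, if_neg hs]
      exact card_biUnion_le.trans (sum_le_sum fun a _ => card_image_le.trans (ih a.1 a.2))

theorem pathCount_le_maxProd (R : Finset V) (s : V) : pathCount G E R s ≤ maxProd R.card := by
  induction R, s using node_induction G with
  | h R s ih =>
    by_cases hs : s ∈ E
    · rw [pathCount_of_mem hs]; exact maxProd_pos _
    · rw [pathCount_of_notMem hs]
      refine (sum_le_card_nsmul _ _ _ ih).trans ?_
      rw [smul_eq_mul, ← card_sdiff_nb G R s]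
      exact mul_maxProd_le _ _

theorem pathCount_le_growth (R : Finset V) (s : V) :
    (pathCount G E R s : ℝ) ≤ growth R.card :=
  (Nat.cast_le.2 (pathCount_le_maxProd G E R s)).trans (maxProd_le_growth _)

variable {G E}

/-- A vertex further along an induced path is not adjacent to the current end, so it survives the
discarding and is still available when its turn comes. -/
theorem image_mem_pathSets (l : ℕ) (p : ℕ → V) (R : Finset V) (hR : ∀ i, 1 ≤ i → i ≤ l → p i ∈ R)
    (hadj : ∀ i, i < l → G.Adj (p i) (p (i + 1)))
    (hnadj : ∀ i j, i + 1 < j → j ≤ l → ¬ G.Adj (p i) (p j))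
    (hE : p l ∈ E) (hnE : ∀ i, i < l → p i ∉ E) :
    (Icc 1 l).image p ∈ pathSets G E R (p 0) := by
  induction l generalizing p R with
  | zero => rw [pathSets_of_mem hE]; simp
  | succ l ih =>
    rw [mem_pathSets_of_notMem (hnE 0 (by omega))]
    refine ⟨p 1, mem_nb.2 ⟨hR 1 le_rfl (by omega), hadj 0 (by omega)⟩,
      (Icc 1 l).image fun i => p (i + 1), ?_, ?_⟩
    · apply ih (fun i => p (i + 1))
      · intro i h1 h2
        rw [mem_sdiff, mem_nb, not_and]
        exact ⟨hR _ (by omega) (by omega), fun _ => hnadj 0 (i + 1) (by omega) (by omega)⟩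
      · exact fun i hi => hadj (i + 1) (by omega)
      · exact fun i j h1 h2 => hnadj (i + 1) (j + 1) (by omega) (by omega)
      · exact hE
      · exact fun i hi => hnE (i + 1) (by omega)
    · ext x
      simp only [mem_insert, mem_image, mem_Icc]
      constructor
      · rintro (rfl | ⟨i, hi, rfl⟩)
        · exact ⟨1, by omega, rfl⟩
        · exact ⟨i + 1, by omega, rfl⟩
      · rintro ⟨i, hi, rfl⟩
        rcases Nat.eq_or_lt_of_le hi.1 with rfl | h
        · exact Or.inl rfl
        · exact Or.inr ⟨i - 1, by omega, by congr 1; omega⟩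

end Paths

/-! ### Induced cycles parametrised by residues -/

section Cycles

variable {V : Type*} (G : SimpleGraph V)

/-- `f` runs once around an induced cycle of `G` of length `k`. -/
structure IsCycleMap (k : ℕ) (f : ZMod k → V) : Prop where
  three_le : 3 ≤ k
  inj : Function.Injective f
  adj_iff : ∀ i j, G.Adj (f i) (f j) ↔ j = i + 1 ∨ i = j + 1

theorem cycleGraph_adj_iff {m : ℕ} (i j : ZMod (m + 2)) :
    (show SimpleGraph (ZMod (m + 2)) from SimpleGraph.cycleGraph (m + 2)).Adj i j ↔
      j = i + 1 ∨ i = j + 1 := by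
  change (i - j = 1 ∨ j - i = 1) ↔ _
  rw [or_comm, sub_eq_iff_eq_add', sub_eq_iff_eq_add']

theorem isInducedCycle_iff (S : Set V) :
    G.IsInducedCycle S ↔ ∃ k, ∃ f : ZMod k → V, IsCycleMap G k f ∧ Set.range f = S := by
  constructor
  · rintro ⟨k, hk, ⟨e⟩⟩
    obtain ⟨m, rfl⟩ : ∃ m, k = m + 2 := ⟨k - 2, by omega⟩
    refine ⟨m + 2, fun i => (e.symm i : S), ⟨hk, ?_, ?_⟩, ?_⟩
    · exact Subtype.val_injective.comp e.symm.injective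
    · intro i j
      have h := e.symm.map_rel_iff (a := i) (b := j)
      rw [SimpleGraph.comap_adj] at h
      exact h.trans (cycleGraph_adj_iff i j)
    · ext x
      constructor
      · rintro ⟨i, rfl⟩
        exact (e.symm i).2
      · exact fun hx => ⟨e ⟨x, hx⟩, by simp⟩
  · rintro ⟨k, f, hf, rfl⟩
    obtain ⟨m, rfl⟩ : ∃ m, k = m + 2 := ⟨k - 2, by have := hf.three_le; omega⟩
    refine ⟨m + 2, hf.three_le, ⟨RelIso.symm ⟨Equiv.ofInjective f hf.inj, ?_⟩⟩⟩
    intro i j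
    rw [SimpleGraph.comap_adj]
    exact (hf.adj_iff i j).trans (cycleGraph_adj_iff i j).symm

variable {G} {k : ℕ} {f : ZMod k → V}

theorem IsCycleMap.shift (hf : IsCycleMap G k f) (r : ZMod k) :
    IsCycleMap G k fun i => f (r + i) where
  three_le := hf.three_le
  inj := hf.inj.comp (add_right_injective r)
  adj_iff i j := by
    rw [hf.adj_iff, add_assoc, add_assoc, add_right_inj, add_right_inj]

theorem IsCycleMap.reflect (hf : IsCycleMap G k f) : IsCycleMap G k fun i => f (-i) where
  three_le := hf.three_le
  inj := hf.inj.comp neg_injective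
  adj_iff i j := by
    rw [hf.adj_iff]
    constructor <;> rintro (h | h) <;> [right; left; right; left] <;> linear_combination h

theorem range_shift (f : ZMod k → V) (r : ZMod k) :
    Set.range (fun i => f (r + i)) = Set.range f :=
  (Equiv.addLeft r).surjective.range_comp f

theorem range_reflect (f : ZMod k → V) : Set.range (fun i => f (-i)) = Set.range f :=
  (Equiv.neg (ZMod k)).surjective.range_comp f

theorem IsCycleMap.natCast_inj (hf : IsCycleMap G k f) {i j : ℕ} (hi : i < k) (hj : j < k) :
    f i = f j ↔ i = j := by
  rw [hf.inj.eq_iff, ZMod.natCast_eq_natCast_iff, Nat.ModEq, Nat.mod_eq_of_lt hi,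
    Nat.mod_eq_of_lt hj]

theorem IsCycleMap.natCast_adj (hf : IsCycleMap G k f) {i j : ℕ} (hij : i < j) (hj : j < k) :
    G.Adj (f i) (f j) ↔ j = i + 1 ∨ (i = 0 ∧ j + 1 = k) := by
  rw [hf.adj_iff]
  have h1 : ((j : ZMod k) = i + 1) ↔ j = i + 1 := by
    rw [← Nat.cast_succ, ZMod.natCast_eq_natCast_iff, Nat.ModEq, Nat.mod_eq_of_lt hj,
      Nat.mod_eq_of_lt (by omega)]
  have h2 : ((i : ZMod k) = j + 1) ↔ i = 0 ∧ j + 1 = k := by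
    rw [← Nat.cast_succ, ZMod.natCast_eq_natCast_iff, Nat.ModEq, Nat.mod_eq_of_lt (a := i) (by omega)]
    rcases Nat.eq_or_lt_of_le (Nat.succ_le_of_lt hj) with h | h
    · rw [Nat.succ_eq_add_one] at h ⊢
      rw [h, Nat.mod_self]; simp
    · rw [Nat.mod_eq_of_lt h]; omega
  rw [h1, h2]

theorem IsCycleMap.exists_natCast (hf : IsCycleMap G k f) (i : ZMod k) :
    ∃ j : ℕ, j < k ∧ (j : ZMod k) = i := by
  have : NeZero k := ⟨by have := hf.three_le; omega⟩
  exact ⟨i.val, ZMod.val_lt i, ZMod.natCast_zmod_val i⟩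

end Cycles

end InducedCycles

namespace InducedCycles

open Finset

set_option linter.unusedSectionVars false

/-! ### Entropy inequalities and numerical logarithms -/

section Entropy

open Real

/-- This is `log y ≤ y - 1` at `y = q * N / x`, multiplied by `x`. -/
theorem negMulLog_le_of_pos {x q N : ℝ} (hx : 0 ≤ x) (hq : 0 < q) (hN : 0 < N) :
    negMulLog x ≤ x * (-log q) - x * log N + (q * N - x) := by
  rcases hx.eq_or_lt with rfl | hx
  · simp [negMulLog]; positivity
  · have h := log_le_sub_one_of_pos (show 0 < q * N / x by positivity)
    rw [log_div (by positivity) hx.ne', log_mul hq.ne' hN.ne'] at h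
    have h2 := mul_le_mul_of_nonneg_left h hx.le
    have h3 : x * (q * N / x - 1) = q * N - x := by field_simp
    rw [h3] at h2
    unfold negMulLog
    linarith

/-- Gibbs' inequality in unnormalised form: the weights `x a / N` are encoded with a guessed
subprobability `q`. -/
theorem sum_negMulLog_le {ι : Type*} (A : Finset ι) (x q : ι → ℝ) (hx : ∀ a ∈ A, 0 ≤ x a)
    (hq : ∀ a ∈ A, 0 < q a) (hN : 0 < ∑ a ∈ A, x a) (hq1 : ∑ a ∈ A, q a ≤ 1) :
    ∑ a ∈ A, negMulLog (x a) ≤ ∑ a ∈ A, x a * (-log (q a)) + negMulLog (∑ a ∈ A, x a) := by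
  have h := sum_le_sum fun a ha => negMulLog_le_of_pos (hx a ha) (hq a ha) hN
  rw [sum_add_distrib, sum_sub_distrib, ← sum_mul, sum_sub_distrib, ← sum_mul] at h
  have : negMulLog (∑ a ∈ A, x a) = -((∑ a ∈ A, x a) * log (∑ a ∈ A, x a)) := by
    simp [negMulLog]
  nlinarith

theorem log_three_gt : 1.097 < log 3 := by
  have h : log ((2 : ℝ) ^ 19) < log (3 ^ 12) := log_lt_log (by norm_num) (by norm_num)
  rw [log_pow, log_pow] at h
  have := log_two_gt_d9
  norm_num at h ⊢
  linarith

theorem log_five_lt : log 5 < 1.618 := by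
  have h : log ((5 : ℝ) ^ 3) < log (2 ^ 7) := log_lt_log (by norm_num) (by norm_num)
  rw [log_pow, log_pow] at h
  have := log_two_lt_d9
  norm_num at h ⊢
  linarith

theorem log_ten_lt : log 10 < 2.312 := by
  rw [show (10 : ℝ) = 2 * 5 by norm_num, log_mul (by norm_num) (by norm_num)]
  have := log_two_lt_d9
  have := log_five_lt
  norm_num at *
  linarith

theorem log_twenty_ninths_lt : log (20 / 9) < 0.812 := by
  rw [show (20 / 9 : ℝ) = 2 ^ 2 * 5 / 3 ^ 2 by norm_num, log_div (by norm_num) (by norm_num),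
    log_mul (by norm_num) (by norm_num), log_pow, log_pow]
  have := log_two_lt_d9
  have := log_five_lt
  have := log_three_gt
  norm_num at *
  linarith

theorem log_nine_eighths_gt : 1 / 9 ≤ log (9 / 8) := by
  have := one_sub_inv_le_log_of_pos (show (0 : ℝ) < 9 / 8 by norm_num)
  norm_num at this ⊢
  linarith

/-- The difference `d * (log 3 / 3) - log d` vanishes only at 3 among positive integers. The
critical cases are `d = 2` and `d = 4`, where it equals `d / 6 * log (9 / 8)`. From 5 on, `log`
grows by at most 1/5 per step. -/
theorem le_mul_sub_log {d : ℕ} (hd : 1 ≤ d) (h3 : d ≠ 3) :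
    (d : ℝ) ≤ 60 * (d * (log 3 / 3) - log d) := by
  have l3 := log_three_gt
  have l98 := log_nine_eighths_gt
  have e98 : log (9 / 8) = 2 * log 3 - 3 * log 2 := by
    rw [show (9 / 8 : ℝ) = 3 ^ 2 / 2 ^ 3 by norm_num, log_div (by norm_num) (by norm_num), log_pow,
      log_pow]
    norm_num
  rcases Nat.lt_or_ge d 5 with h | h
  · interval_cases d
    · norm_num at *; linarith
    · norm_num at *; linarith
    · omega
    · rw [show ((4 : ℕ) : ℝ) = 2 ^ 2 by norm_num, log_pow]
      norm_num at *; linarith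
  · clear h3 hd
    induction d, h using Nat.le_induction with
    | base => have := log_five_lt; norm_num at *; linarith
    | succ d hd ih =>
      have hd' : (5 : ℝ) ≤ d := by exact_mod_cast hd
      have h := log_le_sub_one_of_pos (show (0 : ℝ) < (d + 1) / d by positivity)
      rw [log_div (by positivity) (by positivity)] at h
      have h2 : ((d : ℝ) + 1) / d - 1 ≤ 1 / 5 := by
        rw [div_sub_one (by positivity), add_sub_cancel_left]
        gcongr
      push_cast
      norm_num at *
      linarith

end Entropy

/-! ### Costs along paths and the entropy deficit -/

section Costs

open scoped Classical

variable {V : Type*} [DecidableEq V] (G : SimpleGraph V) (E : Finset V)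

/-- The sum, over the paths counted by `pathCount`, of the costs `φ` of the nodes at which the path
is extended and of the cost `ψ` of its final node. -/
noncomputable def pathCost (φ ψ : Finset V → V → ℝ) (R : Finset V) (s : V) : ℝ :=
  if s ∈ E then ψ R s else
    φ R s * pathCount G E R s + ∑ a ∈ (nb G R s).attach, pathCost φ ψ (R \ nb G R s) a
termination_by R.card
decreasing_by exact card_sdiff_nb_lt a.2

variable {G E} in
theorem pathCost_of_mem {φ ψ : Finset V → V → ℝ} {R : Finset V} {s : V} (h : s ∈ E) :
    pathCost G E φ ψ R s = ψ R s := by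
  rw [pathCost, if_pos h]

variable {G E} in
theorem pathCost_of_notMem {φ ψ : Finset V → V → ℝ} {R : Finset V} {s : V} (h : s ∉ E) :
    pathCost G E φ ψ R s =
      φ R s * pathCount G E R s + ∑ a ∈ nb G R s, pathCost G E φ ψ (R \ nb G R s) a := by
  rw [pathCost, if_neg h]
  congr 1
  exact sum_attach (nb G R s) fun a => pathCost G E φ ψ (R \ nb G R s) a

theorem pathCost_nonneg {φ ψ : Finset V → V → ℝ} (hφ : ∀ R s, 0 ≤ φ R s) (hψ : ∀ R s, 0 ≤ ψ R s)
    (R : Finset V) (s : V) : 0 ≤ pathCost G E φ ψ R s := by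
  induction R, s using node_induction G with
  | h R s ih =>
    by_cases hs : s ∈ E
    · rw [pathCost_of_mem hs]; exact hψ _ _
    · rw [pathCost_of_notMem hs]
      have := sum_nonneg ih
      have := hφ R s
      positivity

/-- There are exactly three ways to go on, none of them too rare among the completed paths. -/
def Good (R : Finset V) (s : V) : Prop :=
  (nb G R s).card = 3 ∧
    ∀ a ∈ nb G R s, pathCount G E R s ≤ 10 * pathCount G E (R \ nb G R s) a

/-- The node is good and all its children are inner nodes with the property `p`. -/
def Up (p : Finset V → V → Prop) (R : Finset V) (s : V) : Prop :=
  Good G E R s ∧ ∀ a ∈ nb G R s, a ∉ E ∧ p (R \ nb G R s) a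

/-- The number of vertices discarded at a node without the property `p`. -/
noncomputable def defect (p : Finset V → V → Prop) (R : Finset V) (s : V) : ℝ :=
  if p R s then 0 else (nb G R s).card

/-- The cost of the vertices that remain unused at the end of a path. -/
noncomputable def leafCost (R : Finset V) (_ : V) : ℝ := R.card + 1

/-- The total defect of all the paths with respect to `p`. -/
noncomputable def totalDefect (p : Finset V → V → Prop) (R : Finset V) (s : V) : ℝ :=
  pathCost G E (defect G p) leafCost R s

theorem defect_nonneg (p : Finset V → V → Prop) (R : Finset V) (s : V) : 0 ≤ defect G p R s := by
  unfold defect; split_ifs <;> positivity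

theorem leafCost_nonneg (R : Finset V) (s : V) : 0 ≤ leafCost R s := by
  unfold leafCost; positivity

theorem totalDefect_nonneg (p : Finset V → V → Prop) (R : Finset V) (s : V) :
    0 ≤ totalDefect G E p R s :=
  pathCost_nonneg G E (defect_nonneg G p) leafCost_nonneg R s

/-- Divided by the number `N` of paths, the bracket is the gap between `log (3 ^ (R.card / 3))` and
the entropy `log N` of a uniformly random path. The chain rule distributes this gap over the nodes,
and a node that is not good contributes at least 1/60 for each vertex it discards. -/
theorem totalDefect_good_le (R : Finset V) (s : V) :
    totalDefect G E (Good G E) R s ≤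
      60 * (pathCount G E R s * (R.card * (Real.log 3 / 3)) +
        Real.negMulLog (pathCount G E R s)) + pathCount G E R s := by
  have l3 := log_three_gt
  unfold totalDefect
  induction R, s using node_induction G with
  | h R s ih =>
    by_cases hs : s ∈ E
    · rw [pathCost_of_mem hs, pathCount_of_mem hs, leafCost]
      have : (0 : ℝ) ≤ R.card := by positivity
      norm_num at *
      nlinarith
    · rw [pathCost_of_notMem hs]
      have h1 := sum_le_sum ih
      set A := nb G R s with hA
      set x : V → ℝ := fun a => (pathCount G E (R \ A) a : ℝ) with hx
      have hx0 : ∀ a ∈ A, 0 ≤ x a := fun a _ => Nat.cast_nonneg _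
      have hN : (pathCount G E R s : ℝ) = ∑ a ∈ A, x a := by
        rw [pathCount_of_notMem hs]; push_cast; rfl
      set N : ℝ := (pathCount G E R s : ℝ) with hNdef
      have hcard : ((R \ A).card : ℝ) = R.card - A.card := by
        rw [eq_sub_iff_add_eq]; exact_mod_cast card_sdiff_nb G R s
      rw [sum_add_distrib, ← mul_sum, sum_add_distrib, ← sum_mul, ← hN, hcard] at h1
      suffices h : defect G (Good G E) R s * N + 60 * ∑ a ∈ A, Real.negMulLog (x a) ≤
          60 * (N * (A.card * (Real.log 3 / 3)) + Real.negMulLog N) by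
        nlinarith
      have hN0 : 0 ≤ N := Nat.cast_nonneg _
      rcases hN0.eq_or_lt with h0 | hpos
      · have : ∀ a ∈ A, x a = 0 := by
          rw [← sum_eq_zero_iff_of_nonneg hx0, ← hN, ← h0]
        rw [sum_congr rfl fun a ha => by rw [this a ha], ← h0]
        simp
      have hAne : A.Nonempty := by
        rw [nonempty_iff_ne_empty]; rintro h; rw [h] at hN; simp at hN; linarith
      have hApos : 1 ≤ A.card := hAne.card_pos
      have hAposR : (0 : ℝ) < A.card := by exact_mod_cast hApos
      have hunif := sum_negMulLog_le A x (fun _ => (A.card : ℝ)⁻¹) hx0 (fun _ _ => by positivity)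
        (by rw [← hN]; exact hpos) (by rw [sum_const, nsmul_eq_mul, mul_inv_cancel₀ hAposR.ne'])
      rw [← sum_mul, ← hN, Real.log_inv, neg_neg] at hunif
      unfold defect
      split_ifs with hg
      · have : A.card = 3 := hg.1
        rw [this] at hunif ⊢
        norm_num at hunif ⊢
        nlinarith
      by_cases h3 : A.card = 3
      · have : ∃ a ∈ A, 10 * x a < N := by
          by_contra hcon
          push Not at hcon
          refine hg ⟨h3, fun a ha => ?_⟩
          have := hcon a ha
          simp only [hNdef, hx] at this
          exact_mod_cast this
        obtain ⟨b, hb, hbN⟩ := this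
        -- If the child `b` has less than a tenth of the paths, coding with 1/10, 9/20, 9/20 costs
        -- at most 0.962 per path. The value of three free choices is `log 3 > 1.097`, and the
        -- difference exceeds 3/60.
        have hq := sum_negMulLog_le A x (fun a => if a = b then 1 / 10 else 9 / 20) hx0
          (fun a _ => by positivity) (by rw [← hN]; exact hpos) (by
            rw [← add_sum_erase A _ hb, sum_congr rfl fun a ha => if_neg (ne_of_mem_erase ha),
              sum_const, card_erase_of_mem hb, h3]
            norm_num)
        have hrhs : ∑ a ∈ A, x a * -Real.log (if a = b then 1 / 10 else 9 / 20) =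
            x b * -Real.log (1 / 10) + (∑ a ∈ A.erase b, x a) * -Real.log (9 / 20) := by
          rw [← add_sum_erase A _ hb, if_pos rfl, sum_mul]
          congr 1
          exact sum_congr rfl fun a ha => by rw [if_neg (ne_of_mem_erase ha)]
        rw [hrhs, ← hN] at hq
        have hrest : ∑ a ∈ A.erase b, x a = N - x b := by
          rw [hN, ← add_sum_erase A _ hb]; ring
        have e1 : -Real.log (1 / 10) = Real.log 10 := by
          rw [one_div, Real.log_inv, neg_neg]
        have e2 : -Real.log (9 / 20) = Real.log (20 / 9) := by
          rw [← Real.log_inv]; norm_num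
        rw [hrest, e1, e2] at hq
        have l10 := log_ten_lt
        have l209 := log_twenty_ninths_lt
        rw [h3]
        have hxb := hx0 b hb
        have b1 : x b * Real.log 10 ≤ x b * 2.312 := by gcongr
        have b2 : (N - x b) * Real.log (20 / 9) ≤ (N - x b) * 0.812 := by
          apply mul_le_mul_of_nonneg_left l209.le; linarith
        have b3 : N * 1.097 ≤ N * Real.log 3 := by gcongr
        push_cast
        norm_num at *
        nlinarith
      · have := mul_le_mul_of_nonneg_left (le_mul_sub_log hApos h3) hN0
        nlinarith

/-- A node that satisfies `p` but not `Up` has a child that is an end or violates `p`, and this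
child carries at least a tenth of its paths. The cost 3 per path of the parent is therefore at most
30 times the own cost of the child. Each node is charged only by its parent; the summand with factor
30 reserves this charge for the induction. -/
theorem totalDefect_up_le {p : Finset V → V → Prop} (hp : ∀ R s, p R s → Good G E R s)
    (R : Finset V) (s : V) :
    totalDefect G E (Up G E p) R s +
      30 * (if s ∈ E then leafCost R s else defect G p R s * pathCount G E R s) ≤
      31 * totalDefect G E p R s := by
  unfold totalDefect
  induction R, s using node_induction G with
  | h R s ih =>
    by_cases hs : s ∈ E
    · rw [pathCost_of_mem hs, pathCost_of_mem hs, if_pos hs]; linarith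
    rw [pathCost_of_notMem hs, pathCost_of_notMem hs, if_neg hs]
    have h1 := sum_le_sum ih
    rw [sum_add_distrib, ← mul_sum, ← mul_sum] at h1
    set A := nb G R s with hA
    set own : V → ℝ := fun a => if a ∈ E then leafCost (R \ A) a else
      defect G p (R \ A) a * pathCount G E (R \ A) a with hown
    have hown0 : ∀ a ∈ A, 0 ≤ own a := by
      intro a _
      simp only [hown]
      split_ifs
      · exact leafCost_nonneg _ _
      · exact mul_nonneg (defect_nonneg _ _ _ _) (Nat.cast_nonneg _)
    have hsum0 := sum_nonneg hown0
    have hd0 := defect_nonneg G p R s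
    have hN0 : (0 : ℝ) ≤ pathCount G E R s := Nat.cast_nonneg _
    suffices h : defect G (Up G E p) R s * pathCount G E R s ≤
        defect G p R s * pathCount G E R s + 30 * ∑ a ∈ A, own a by
      change _ + 30 * ∑ a ∈ A, own a ≤ _ at h1
      nlinarith [mul_nonneg hd0 hN0]
    by_cases hup : Up G E p R s
    · rw [defect, if_pos hup]
      nlinarith [mul_nonneg hd0 hN0]
    by_cases hpR : p R s
    · have hg := hp _ _ hpR
      rw [defect, defect, if_neg hup, if_pos hpR, ← hA, hg.1]
      have : ∃ a ∈ A, a ∈ E ∨ ¬ p (R \ A) a := by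
        by_contra hcon
        push Not at hcon
        exact hup ⟨hg, hcon⟩
      obtain ⟨a, ha, hor⟩ := this
      have h10 : (pathCount G E R s : ℝ) ≤ 10 * pathCount G E (R \ A) a := by
        exact_mod_cast hg.2 a ha
      have hle : (pathCount G E (R \ A) a : ℝ) ≤ own a := by
        simp only [hown]
        -- The summand 1 in `leafCost` pays here for an end at which no vertex is left over.
        split_ifs with haE
        · rw [pathCount_of_mem haE, leafCost]
          simp
        · have hnp : ¬ p (R \ A) a := hor.resolve_left haE
          rw [defect, if_neg hnp]
          rcases Nat.eq_zero_or_pos (nb G (R \ A) a).card with h0 | h0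
          · rw [pathCount_of_notMem haE, card_eq_zero.1 h0]; simp
          · have : (1 : ℝ) ≤ (nb G (R \ A) a).card := by exact_mod_cast h0
            have h2 : (0 : ℝ) ≤ pathCount G E (R \ A) a := Nat.cast_nonneg _
            nlinarith
      have hsingle := single_le_sum hown0 ha
      push_cast
      linarith
    · rw [defect, defect, if_neg hup, if_neg hpR]
      linarith

theorem totalDefect_up_le' {p : Finset V → V → Prop} (hp : ∀ R s, p R s → Good G E R s)
    (R : Finset V) (s : V) :
    totalDefect G E (Up G E p) R s ≤ 31 * totalDefect G E p R s := by
  have h := totalDefect_up_le G E hp R s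
  have : 0 ≤ (if s ∈ E then leafCost R s else defect G p R s * (pathCount G E R s : ℝ)) := by
    split_ifs
    · exact leafCost_nonneg _ _
    · exact mul_nonneg (defect_nonneg _ _ _ _) (Nat.cast_nonneg _)
  linarith

end Costs

end InducedCycles

namespace InducedCycles

open Finset

set_option linter.unusedSectionVars false

/-! ### Rigidity: the children of a typical node see the same triple -/

section Rigidity

open scoped Classical

variable {V : Type*} [DecidableEq V] (G : SimpleGraph V) (E : Finset V)

/-- All children of the node see the same three new vertices. -/
def Clean (R : Finset V) (s : V) : Prop :=
  (nb G R s).card = 3 ∧ ∀ a ∈ nb G R s, (nb G (R \ nb G R s) a).card = 3 ∧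
    ∀ b ∈ nb G R s, nb G (R \ nb G R s) a = nb G (R \ nb G R s) b

/-- The number of paths that discard `x` at a node that is not twofold good, or never. -/
noncomputable def wasted (x : V) (R : Finset V) (s : V) : ℝ :=
  pathCost G E (fun R s => if x ∈ nb G R s ∧ ¬ Up G E (Good G E) R s then 1 else 0)
    (fun R _ => if x ∈ R then 1 else 0) R s

theorem wasted_nonneg (x : V) (R : Finset V) (s : V) : 0 ≤ wasted G E x R s := by
  apply pathCost_nonneg <;> intros <;> split_ifs <;> norm_num

variable {G E}

theorem wasted_of_mem {x : V} {R : Finset V} {s : V} (h : s ∈ E) :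
    wasted G E x R s = if x ∈ R then 1 else 0 := pathCost_of_mem h

theorem wasted_of_notMem {x : V} {R : Finset V} {s : V} (h : s ∉ E) :
    wasted G E x R s = (if x ∈ nb G R s ∧ ¬ Up G E (Good G E) R s then 1 else 0) *
      pathCount G E R s + ∑ a ∈ nb G R s, wasted G E x (R \ nb G R s) a := pathCost_of_notMem h

theorem sum_wasted_le_wasted {x : V} {R : Finset V} {s : V} (h : s ∉ E) :
    ∑ a ∈ nb G R s, wasted G E x (R \ nb G R s) a ≤ wasted G E x R s := by
  rw [wasted_of_notMem h]
  have : (0 : ℝ) ≤ (if x ∈ nb G R s ∧ ¬ Up G E (Good G E) R s then 1 else 0) *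
      pathCount G E R s := by positivity
  linarith

theorem wasted_child_le {x : V} {R : Finset V} {s a : V} (h : s ∉ E) (ha : a ∈ nb G R s) :
    wasted G E x (R \ nb G R s) a ≤ wasted G E x R s :=
  (single_le_sum (f := fun a => wasted G E x (R \ nb G R s) a)
    (fun _ _ => wasted_nonneg G E _ _ _) ha).trans (sum_wasted_le_wasted h)

theorem pathCount_cast {R : Finset V} {s : V} (h : s ∉ E) :
    (pathCount G E R s : ℝ) = ∑ a ∈ nb G R s, (pathCount G E (R \ nb G R s) a : ℝ) := by
  rw [pathCount_of_notMem h]; push_cast; rfl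

/-- Exchange of summation: a node that is not twofold good is charged once for each vertex it
discards. -/
theorem sum_wasted_le_totalDefect (X R : Finset V) (s : V) :
    ∑ x ∈ X, wasted G E x R s ≤ totalDefect G E (Up G E (Good G E)) R s := by
  unfold totalDefect
  induction R, s using node_induction G with
  | h R s ih =>
    by_cases hs : s ∈ E
    · rw [pathCost_of_mem hs, sum_congr rfl fun x _ => wasted_of_mem hs, ← sum_filter, sum_const,
        leafCost, nsmul_eq_mul, mul_one]
      have : ((X.filter (· ∈ R)).card : ℝ) ≤ R.card := by
        exact_mod_cast card_le_card fun x hx => (mem_filter.1 hx).2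
      linarith
    · rw [pathCost_of_notMem hs, sum_congr rfl fun x _ => wasted_of_notMem hs, sum_add_distrib,
        sum_comm, ← sum_mul]
      refine add_le_add ?_ (sum_le_sum ih)
      gcongr
      unfold defect
      split_ifs with h
      · simp [h]
      · rw [← sum_filter, sum_const, nsmul_eq_mul, mul_one]
        refine Nat.cast_le.2 (card_le_card fun x hx => ?_)
        rw [mem_filter] at hx
        exact hx.2.1

/-- Otherwise a vertex `w` of `T ∩ Q` becomes a child of `x` with three further neighbours in `Q`.
All of them avoid `T`, since the rest of `T` has just been discarded. Together with `x` this makes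
four neighbours of `w` outside `T`. -/
theorem not_discard_rest {R T Q : Finset V} {x : V} (hT : ∀ w ∈ T, (nb G (R \ T) w).card = 3)
    (hxR : x ∈ R) (hxT : x ∉ T) (hxQ : x ∉ Q) (hQ : Q ⊆ R) (hup : Up G E (Good G E) Q x)
    (hne : (T ∩ Q).Nonempty) : ¬ T ∩ Q ⊆ nb G Q x := by
  intro hsub
  obtain ⟨w, hw⟩ := hne
  have hwT := (mem_inter.1 hw).1
  have hwK := hsub hw
  have h3 := (hup.2 w hwK).2.1
  have hlt : nb G (Q \ nb G Q x) w ⊂ nb G (R \ T) w := by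
    rw [ssubset_iff_of_subset]
    · refine ⟨x, mem_nb.2 ⟨mem_sdiff.2 ⟨hxR, hxT⟩, (mem_nb.1 hwK).2.symm⟩, fun h => hxQ ?_⟩
      exact (mem_sdiff.1 (mem_nb.1 h).1).1
    · intro y hy
      obtain ⟨hy1, hy2⟩ := mem_nb.1 hy
      obtain ⟨hyQ, hyK⟩ := mem_sdiff.1 hy1
      exact mem_nb.2 ⟨mem_sdiff.2 ⟨hQ hyQ, fun hyT => hyK (hsub (mem_inter.2 ⟨hyT, hyQ⟩))⟩, hy2⟩
  have := card_lt_card hlt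
  rw [h3, hT w hwT] at this
  exact lt_irrefl _ this

/-- As long as no vertex of `T` is discarded, the bound passes from the children to the node. A node
that discards part of `T` and is not twofold good wastes all its paths. A twofold good one leaves
part of `T` behind by `not_discard_rest`, and it has a child outside `T` with at least a tenth of
the paths, for which fewer vertices of `T` remain. -/
theorem pathCount_le_wasted {R T : Finset V} (hT : ∀ w ∈ T, (nb G (R \ T) w).card = 3)
    (hT3 : T.card = 3) (Q : Finset V) (x : V) (hxR : x ∈ R) (hxT : x ∉ T) (hxQ : x ∉ Q)
    (hQ : Q ⊆ R) (hne : (T ∩ Q).Nonempty) :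
    (pathCount G E Q x : ℝ) ≤ 10 ^ (T ∩ Q).card * ∑ w ∈ T, wasted G E w Q x := by
  induction Q, x using node_induction G with
  | h Q x ih =>
    have hsum0 : ∀ Q x, 0 ≤ ∑ w ∈ T, wasted G E w Q x := fun Q x =>
      sum_nonneg fun w _ => wasted_nonneg G E w Q x
    have hpow : (1 : ℝ) ≤ 10 ^ (T ∩ Q).card := one_le_pow₀ (by norm_num)
    by_cases hx : x ∈ E
    · obtain ⟨w, hw⟩ := hne
      rw [mem_inter] at hw
      have h1 := single_le_sum (f := fun w => wasted G E w Q x)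
        (fun w _ => wasted_nonneg G E w Q x) hw.1
      rw [wasted_of_mem hx, if_pos hw.2] at h1
      rw [pathCount_of_mem hx]
      push_cast
      nlinarith
    set K := nb G Q x with hK
    have hKQ : K ⊆ Q := nb_subset G Q x
    by_cases hKT : Disjoint K T
    · have hTQ : T ∩ (Q \ K) = T ∩ Q := by
        ext y
        simp only [mem_inter, mem_sdiff]
        constructor
        · tauto
        · exact fun h => ⟨h.1, h.2, fun h' => disjoint_left.1 hKT h' h.1⟩
      rw [pathCount_cast hx]
      calc ∑ a ∈ K, (pathCount G E (Q \ K) a : ℝ)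
          ≤ ∑ a ∈ K, 10 ^ (T ∩ Q).card * ∑ w ∈ T, wasted G E w (Q \ K) a := by
            refine sum_le_sum fun a ha => ?_
            have := ih a ha (hQ (hKQ ha)) (disjoint_left.1 hKT ha)
              (fun h => (mem_sdiff.1 h).2 ha) (sdiff_subset.trans hQ) (by rwa [hTQ])
            rwa [hTQ] at this
        _ = 10 ^ (T ∩ Q).card * ∑ w ∈ T, ∑ a ∈ K, wasted G E w (Q \ K) a := by
            rw [← mul_sum, sum_comm]
        _ ≤ _ := by
            gcongr with w hw
            exact sum_wasted_le_wasted hx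
    rw [not_disjoint_iff] at hKT
    obtain ⟨y, hyK, hyT⟩ := hKT
    by_cases hup : Up G E (Good G E) Q x
    · have hns := not_discard_rest hT hxR hxT hxQ hQ hup hne
      have hKT' : ¬ K ⊆ T := by
        intro h
        have : K = T := eq_of_subset_of_card_le h (by rw [hT3, hup.1.1])
        exact hns (by rw [← hK, this]; exact inter_subset_left)
      obtain ⟨c, hcK, hcT⟩ := not_subset.1 hKT'
      obtain ⟨z, hz, hzK⟩ := not_subset.1 hns
      rw [mem_inter] at hz
      have hlt : (T ∩ (Q \ K)).card < (T ∩ Q).card := by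
        apply card_lt_card
        rw [ssubset_iff_of_subset (inter_subset_inter_left sdiff_subset)]
        exact ⟨y, mem_inter.2 ⟨hyT, hKQ hyK⟩, fun h => (mem_sdiff.1 (mem_inter.1 h).2).2 hyK⟩
      have h1 := ih c hcK (hQ (hKQ hcK)) hcT (fun h => (mem_sdiff.1 h).2 hcK)
        (sdiff_subset.trans hQ) ⟨z, mem_inter.2 ⟨hz.1, mem_sdiff.2 ⟨hz.2, hzK⟩⟩⟩
      have h2 : (pathCount G E Q x : ℝ) ≤ 10 * pathCount G E (Q \ K) c := by
        exact_mod_cast hup.1.2 c hcK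
      calc (pathCount G E Q x : ℝ) ≤ 10 * pathCount G E (Q \ K) c := h2
        _ ≤ 10 * (10 ^ (T ∩ (Q \ K)).card * ∑ w ∈ T, wasted G E w (Q \ K) c) := by gcongr
        _ = 10 ^ ((T ∩ (Q \ K)).card + 1) * ∑ w ∈ T, wasted G E w (Q \ K) c := by ring
        _ ≤ 10 ^ (T ∩ Q).card * ∑ w ∈ T, wasted G E w Q x := by
          gcongr with w hw
          · exact hsum0 _ _
          · norm_num
          · omega
          · exact wasted_child_le hx hcK
    · have h1 := single_le_sum (f := fun w => wasted G E w Q x)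
        (fun w _ => wasted_nonneg G E w Q x) hyT
      have h2 : (pathCount G E Q x : ℝ) ≤ wasted G E y Q x := by
        rw [wasted_of_notMem hx, if_pos ⟨hyK, hup⟩, one_mul]
        have := sum_nonneg fun a (_ : a ∈ nb G Q x) => wasted_nonneg G E y (Q \ nb G Q x) a
        linarith
      nlinarith [hsum0 Q x]

/-- The neighbourhood of `a` and `T` are different sets of size three. Hence some vertex of `T`
survives and some child lies outside `T`, where `pathCount_le_wasted` applies. The constant is `10 ^
3` if no vertex of `T` is discarded, and `10 * 10 ^ 2` otherwise. -/
theorem pathCount_le_wasted_of_ne {R T : Finset V} (hTR : T ⊆ R)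
    (hT : ∀ w ∈ T, (nb G (R \ T) w).card = 3) (hT3 : T.card = 3) {a : V} (haE : a ∉ E)
    (hgood : Good G E R a) (hne : nb G R a ≠ T) :
    (pathCount G E R a : ℝ) ≤ 1000 * ∑ w ∈ T, wasted G E w R a := by
  set K := nb G R a with hK
  have hKR : K ⊆ R := nb_subset G R a
  have hKT : ¬ K ⊆ T := fun h => hne (eq_of_subset_of_card_le h (by rw [hT3, hgood.1]))
  have hTK : ¬ T ⊆ K := fun h => hne (eq_of_subset_of_card_le h (by rw [hT3, hgood.1])).symm
  obtain ⟨z, hzT, hzK⟩ := not_subset.1 hTK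
  have hchild : ∀ c ∈ K, c ∉ T → (pathCount G E (R \ K) c : ℝ) ≤
      10 ^ (T ∩ (R \ K)).card * ∑ w ∈ T, wasted G E w (R \ K) c := fun c hcK hcT =>
    pathCount_le_wasted hT hT3 _ c (hKR hcK) hcT (fun h => (mem_sdiff.1 h).2 hcK) sdiff_subset
      ⟨z, mem_inter.2 ⟨hzT, mem_sdiff.2 ⟨hTR hzT, hzK⟩⟩⟩
  by_cases hdis : Disjoint K T
  · rw [pathCount_cast haE]
    have hcard : (T ∩ (R \ K)).card ≤ 3 := hT3 ▸ card_le_card inter_subset_left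
    calc ∑ c ∈ K, (pathCount G E (R \ K) c : ℝ)
        ≤ ∑ c ∈ K, 10 ^ 3 * ∑ w ∈ T, wasted G E w (R \ K) c := by
          refine sum_le_sum fun c hc => (hchild c hc (disjoint_left.1 hdis hc)).trans ?_
          gcongr
          · exact sum_nonneg fun w _ => wasted_nonneg G E w _ _
          · norm_num
      _ = 1000 * ∑ w ∈ T, ∑ c ∈ K, wasted G E w (R \ K) c := by
          rw [← mul_sum, sum_comm]; norm_num
      _ ≤ _ := by
          gcongr with w hw
          exact sum_wasted_le_wasted haE
  · rw [not_disjoint_iff] at hdis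
    obtain ⟨y, hyK, hyT⟩ := hdis
    obtain ⟨c, hcK, hcT⟩ := not_subset.1 hKT
    have hcard : (T ∩ (R \ K)).card ≤ 2 := by
      have : (T ∩ (R \ K)).card < T.card := card_lt_card
        ((ssubset_iff_of_subset inter_subset_left).2
          ⟨y, hyT, fun h => (mem_sdiff.1 (mem_inter.1 h).2).2 hyK⟩)
      omega
    have h2 : (pathCount G E R a : ℝ) ≤ 10 * pathCount G E (R \ K) c := by
      exact_mod_cast hgood.2 c hcK
    calc (pathCount G E R a : ℝ) ≤ 10 * pathCount G E (R \ K) c := h2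
      _ ≤ 10 * (10 ^ 2 * ∑ w ∈ T, wasted G E w (R \ K) c) := by
        gcongr
        refine (hchild c hcK hcT).trans ?_
        gcongr
        · exact sum_nonneg fun w _ => wasted_nonneg G E w _ _
        · norm_num
      _ = 1000 * ∑ w ∈ T, wasted G E w (R \ K) c := by ring
      _ ≤ _ := by
        gcongr with w hw
        exact wasted_child_le haE hcK

theorem card_nb_sdiff_add {A R : Finset V} (h : A ⊆ R) (x : V) :
    (nb G (R \ A) x).card + (nb G A x).card = (nb G R x).card := by
  rw [← card_union_of_disjoint]
  · congr 1
    ext y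
    simp only [mem_union, mem_nb, mem_sdiff]
    constructor
    · rintro (⟨⟨h1, _⟩, h2⟩ | ⟨h1, h2⟩)
      · exact ⟨h1, h2⟩
      · exact ⟨h h1, h2⟩
    · rintro ⟨h1, h2⟩
      by_cases hA : y ∈ A
      · exact Or.inr ⟨hA, h2⟩
      · exact Or.inl ⟨⟨h1, hA⟩, h2⟩
  · rw [disjoint_left]
    intro y h1 h2
    exact (mem_sdiff.1 (mem_nb.1 h1).1).2 (mem_nb.1 h2).1

theorem exists_ne_of_not_clean {R : Finset V} {s : V} (hg : Up G E (Up G E (Good G E)) R s)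
    (hc : ¬ Clean G R s) : ∃ a ∈ nb G R s, ∃ u ∈ nb G R s,
      nb G (R \ nb G R s) a ≠ nb G (R \ nb G R s) u := by
  by_contra hcon
  push Not at hcon
  exact hc ⟨hg.1.1, fun a ha => ⟨(hg.2 a ha).2.1.1, hcon a ha⟩⟩

/-- The degrees within `R` serve as a potential. If the children `a` and `u` see different triples,
a fixed share of the paths through `a` wastes vertices of the triple of `u`. Each vertex of that
triple is adjacent to the discarded `u`, so its degree drops at this node and a charge proportional
to its waste can be paid. A vertex is thus charged at most as often as its degree permits. -/
theorem totalDefect_clean_le (R : Finset V) (s : V) :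
    totalDefect G E (Clean G) R s ≤ totalDefect G E (Up G E (Up G E (Good G E))) R s +
      30000 * ∑ x ∈ R, (nb G R x).card * wasted G E x R s := by
  unfold totalDefect
  induction R, s using node_induction G with
  | h R s ih =>
    have hpos : ∀ R s, 0 ≤ ∑ x ∈ R, ((nb G R x).card : ℝ) * wasted G E x R s := fun R s =>
      sum_nonneg fun x _ => mul_nonneg (Nat.cast_nonneg _) (wasted_nonneg G E x R s)
    by_cases hs : s ∈ E
    · rw [pathCost_of_mem hs, pathCost_of_mem hs]
      linarith [hpos R s]
    rw [pathCost_of_notMem hs, pathCost_of_notMem hs]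
    have h1 := sum_le_sum ih
    rw [sum_add_distrib, ← mul_sum] at h1
    set A := nb G R s with hA
    have hAR : A ⊆ R := nb_subset G R s
    set c : V → ℝ := fun x => ∑ a ∈ A, wasted G E x (R \ A) a with hc
    have hc0 : ∀ x, 0 ≤ c x := fun x => sum_nonneg fun a _ => wasted_nonneg G E x _ a
    have h2 : ∑ a ∈ A, ∑ x ∈ R \ A, ((nb G (R \ A) x).card : ℝ) * wasted G E x (R \ A) a =
        ∑ x ∈ R \ A, ((nb G (R \ A) x).card : ℝ) * c x := by
      rw [sum_comm]
      exact sum_congr rfl fun x _ => (mul_sum _ _ _).symm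
    -- The potential splits into the degree that remains after discarding `A` and the degree lost to
    -- `A`; the second part is free for this node.
    have h3 : ∑ x ∈ R \ A, ((nb G (R \ A) x).card : ℝ) * c x +
        ∑ x ∈ R \ A, ((nb G A x).card : ℝ) * c x ≤
        ∑ x ∈ R, ((nb G R x).card : ℝ) * wasted G E x R s := by
      rw [← sum_add_distrib]
      refine (sum_le_sum fun x _ => ?_).trans (sum_le_sum_of_subset_of_nonneg
        (sdiff_subset : R \ A ⊆ R)
        fun x _ _ => mul_nonneg (Nat.cast_nonneg _) (wasted_nonneg G E x R s))
      rw [← add_mul, ← Nat.cast_add, card_nb_sdiff_add hAR]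
      gcongr
      exact sum_wasted_le_wasted hs
    have hd0 := defect_nonneg G (Up G E (Up G E (Good G E))) R s
    have hN0 : (0 : ℝ) ≤ pathCount G E R s := Nat.cast_nonneg _
    have hX0 : 0 ≤ ∑ x ∈ R \ A, ((nb G A x).card : ℝ) * c x :=
      sum_nonneg fun x _ => mul_nonneg (Nat.cast_nonneg _) (hc0 x)
    suffices h : defect G (Clean G) R s * pathCount G E R s ≤
        defect G (Up G E (Up G E (Good G E))) R s * pathCount G E R s +
        30000 * ∑ x ∈ R \ A, ((nb G A x).card : ℝ) * c x by
      rw [h2] at h1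
      nlinarith
    by_cases hcl : Clean G R s
    · rw [defect, if_pos hcl]
      nlinarith [mul_nonneg hd0 hN0]
    by_cases hg : Up G E (Up G E (Good G E)) R s
    -- The factor 30000 is the defect 3, times 10 for passing to the child `a`, times 1000 for its
    -- waste.
    · obtain ⟨a, ha, u, hu, hne⟩ := exists_ne_of_not_clean hg hcl
      rw [← hA] at ha hu hne
      rw [defect, defect, if_neg hcl, if_pos hg, hg.1.1]
      set T := nb G (R \ A) u with hT
      have hu2 := (hg.2 u hu).2
      have ha2 := (hg.2 a ha)
      have h10 : (pathCount G E R s : ℝ) ≤ 10 * pathCount G E (R \ A) a := by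
        exact_mod_cast hg.1.2 a ha
      have h1000 := pathCount_le_wasted_of_ne (E := E) (nb_subset G (R \ A) u)
        (fun w hw => (hu2.2 w hw).2.1) hu2.1.1 ha2.1 ha2.2.1 hne
      have hle : ∑ w ∈ T, wasted G E w (R \ A) a ≤ ∑ x ∈ R \ A, ((nb G A x).card : ℝ) * c x := by
        refine (sum_le_sum fun w hw => ?_).trans (sum_le_sum_of_subset_of_nonneg
          (nb_subset G (R \ A) u) fun x _ _ => mul_nonneg (Nat.cast_nonneg _) (hc0 x))
        have hcard : (1 : ℝ) ≤ (nb G A w).card := by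
          have : 0 < (nb G A w).card :=
            card_pos.2 ⟨u, mem_nb.2 ⟨hu, (mem_nb.1 hw).2.symm⟩⟩
          exact_mod_cast this
        have : wasted G E w (R \ A) a ≤ c w :=
          single_le_sum (f := fun a => wasted G E w (R \ A) a)
            (fun a _ => wasted_nonneg G E w _ a) ha
        nlinarith [hc0 w]
      push_cast
      linarith
    · rw [defect, defect, if_neg hcl, if_neg hg]
      linarith

/-- Each use of `Up` costs a factor 31, so the total factor is `31 * 31 + 30000 * 31 * D`, below the
stated constant. -/
theorem totalDefect_clean_le_of_card_nb_le {R : Finset V} {D : ℕ}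
    (hD : ∀ x ∈ R, (nb G R x).card ≤ D) (s : V) :
    totalDefect G E (Clean G) R s ≤ 1000000 * (D + 1) * (60 * (pathCount G E R s *
      (R.card * (Real.log 3 / 3)) + Real.negMulLog (pathCount G E R s)) + pathCount G E R s) := by
  have h1 := totalDefect_clean_le (G := G) (E := E) R s
  have h2 := totalDefect_up_le' G E (p := Good G E) (fun _ _ h => h) R s
  have h3 := totalDefect_up_le' G E (p := Up G E (Good G E)) (fun _ _ h => h.1) R s
  have h4 := totalDefect_good_le G E R s
  have h5 : ∑ x ∈ R, ((nb G R x).card : ℝ) * wasted G E x R s ≤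
      D * ∑ x ∈ R, wasted G E x R s := by
    rw [mul_sum]
    refine sum_le_sum fun x hx => ?_
    have := wasted_nonneg G E x R s
    have : ((nb G R x).card : ℝ) ≤ D := by exact_mod_cast hD x hx
    gcongr
  have h6 := sum_wasted_le_totalDefect (G := G) (E := E) R R s
  have h7 := totalDefect_nonneg G E (Good G E) R s
  have hD0 : (0 : ℝ) ≤ D := Nat.cast_nonneg _
  set t := totalDefect G E (Good G E) R s
  have h8 : (D : ℝ) * ∑ x ∈ R, wasted G E x R s ≤ D * (31 * t) := by
    gcongr; linarith
  calc totalDefect G E (Clean G) R s ≤ 31 * (31 * t) + 30000 * (D * (31 * t)) := by linarith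
    _ ≤ 1000000 * (D + 1) * t := by nlinarith [mul_nonneg hD0 h7]
    _ ≤ _ := by gcongr

/-- Averaging: at every node some child with a positive path count has mean cost at most the mean
over all paths through the children. -/
theorem exists_path_of_pathCost {φ ψ : Finset V → V → ℝ} (hφ : ∀ R s, 0 ≤ φ R s)
    (hψ : ∀ R s, 0 ≤ ψ R s) (R : Finset V) (s : V) (hN : 0 < pathCount G E R s) :
    ∃ (k : ℕ) (v : ℕ → V) (Q : ℕ → Finset V), v 0 = s ∧ Q 0 = R ∧
      (∀ i < k, v (i + 1) ∈ nb G (Q i) (v i) ∧ Q (i + 1) = Q i \ nb G (Q i) (v i)) ∧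
      (∑ i ∈ range k, φ (Q i) (v i) + ψ (Q k) (v k)) * pathCount G E R s ≤
        pathCost G E φ ψ R s := by
  induction R, s using node_induction G with
  | h R s ih =>
    by_cases hs : s ∈ E
    · refine ⟨0, fun _ => s, fun _ => R, rfl, rfl, fun i hi => absurd hi (by omega), ?_⟩
      rw [pathCost_of_mem hs, pathCount_of_mem hs]
      simp
    · set A := nb G R s with hA
      have key : ∃ a ∈ A, 0 < pathCount G E (R \ A) a ∧
          pathCost G E φ ψ (R \ A) a * pathCount G E R s ≤
            (∑ b ∈ A, pathCost G E φ ψ (R \ A) b) * pathCount G E (R \ A) a := by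
        by_contra hcon
        push Not at hcon
        obtain ⟨a, ha, ha0⟩ : ∃ a ∈ A, 0 < pathCount G E (R \ A) a := by
          rw [pathCount_of_notMem hs] at hN
          obtain ⟨a, ha, hne⟩ := exists_ne_zero_of_sum_ne_zero hN.ne'
          exact ⟨a, ha, Nat.pos_of_ne_zero hne⟩
        have : ∑ b ∈ A, (∑ b ∈ A, pathCost G E φ ψ (R \ A) b) * (pathCount G E (R \ A) b : ℝ) <
            ∑ b ∈ A, pathCost G E φ ψ (R \ A) b * pathCount G E R s := by
          refine sum_lt_sum (fun b hb => ?_) ⟨a, ha, hcon a ha ha0⟩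
          rcases Nat.eq_zero_or_pos (pathCount G E (R \ A) b) with h0 | h0
          · rw [h0, Nat.cast_zero, mul_zero]
            exact mul_nonneg (pathCost_nonneg G E hφ hψ _ _) (Nat.cast_nonneg _)
          · exact (hcon b hb h0).le
        rw [← mul_sum, ← sum_mul, ← pathCount_cast hs] at this
        exact lt_irrefl _ this
      obtain ⟨a, ha, ha0, hle⟩ := key
      obtain ⟨k, v, Q, hv0, hQ0, hstep, hcost⟩ := ih a ha ha0
      refine ⟨k + 1, fun i => Nat.casesOn i s v, fun i => Nat.casesOn i R Q, rfl, rfl, ?_, ?_⟩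
      · rintro (_ | i) hi
        · exact ⟨by simpa [hv0] using ha, hQ0⟩
        · exact hstep i (by omega)
      · rw [sum_range_succ', pathCost_of_notMem hs]
        have ha0' : (0 : ℝ) < pathCount G E (R \ A) a := by exact_mod_cast ha0
        have hN' : (0 : ℝ) < pathCount G E R s := by exact_mod_cast hN
        have : (∑ i ∈ range k, φ (Q i) (v i) + ψ (Q k) (v k)) * pathCount G E R s ≤
            ∑ b ∈ A, pathCost G E φ ψ (R \ A) b := by
          refine le_of_mul_le_mul_right ?_ ha0'
          nlinarith
        change (∑ i ∈ range k, φ (Q i) (v i) + φ R s + ψ (Q k) (v k)) * (pathCount G E R s : ℝ) ≤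
          φ R s * pathCount G E R s + ∑ b ∈ A, pathCost G E φ ψ (R \ A) b
        linarith

end Rigidity

end InducedCycles

namespace InducedCycles

open Finset

set_option linter.unusedSectionVars false

/-! ### Extraction of a strip from a cheap path -/

section Strips

open scoped Classical

/-- There are `q + 1` disjoint windows of length `L`, and `X` meets at most `q` of them. -/
theorem exists_run {k L q : ℕ} (X : Finset ℕ) (hX : X.card ≤ q) (hk : L * (q + 1) ≤ k) :
    ∃ i, i + L ≤ k ∧ ∀ j < L, i + j ∉ X := by
  rcases Nat.eq_zero_or_pos L with rfl | hL
  · exact ⟨0, by omega, fun j hj => absurd hj (by omega)⟩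
  by_contra hcon
  push Not at hcon
  have hsub : range (q + 1) ⊆ X.image (· / L) := by
    intro t ht
    rw [mem_range] at ht
    obtain ⟨j, hj, hjX⟩ := hcon (L * t) (by nlinarith)
    rw [mem_image]
    refine ⟨_, hjX, ?_⟩
    rw [Nat.mul_add_div hL, Nat.div_eq_of_lt hj, add_zero]
  have := (card_le_card hsub).trans card_image_le
  rw [card_range] at this
  omega

variable {V : Type*} [Fintype V] [DecidableEq V] (G : SimpleGraph V) {E : Finset V}

/-- `L` consecutive classes of size three; inside the strip, neighbouring classes are completely
joined, and there are no other edges between different classes or to the rest of the graph. -/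
structure IsStrip (L : ℕ) (B : ℕ → Finset V) : Prop where
  card_eq : ∀ j < L, (B j).card = 3
  disjoint : ∀ i < L, ∀ j < L, i ≠ j → Disjoint (B i) (B j)
  adj_iff : ∀ j, j + 2 < L → ∀ u ∈ B (j + 1), ∀ w ∉ B (j + 1),
    (G.Adj u w ↔ w ∈ B j ∨ w ∈ B (j + 2))

variable {G}

/-- A path of average cost discards all but `c` vertices of `R` at clean nodes, in triples. With
bounded degree the exceptional vertices and their neighbours spoil few of these triples, so a long
run of consecutive unspoiled triples remains. -/
theorem exists_strip {D L c : ℕ} {R : Finset V} {s : V} (hD : ∀ x, (nb G univ x).card ≤ D)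
    (hN : 0 < pathCount G E R s) (hc : totalDefect G E (Clean G) R s ≤ c * pathCount G E R s)
    (hR : 3 * (L * ((D + 1) * ((univ \ R).card + c) + 1)) + c ≤ R.card) :
    ∃ B, IsStrip G L B := by
  obtain ⟨k, v, Q, hv0, hQ0, hstep, hcost⟩ := exists_path_of_pathCost (G := G) (E := E)
    (defect_nonneg G (Clean G)) leafCost_nonneg R s hN
  have hcost' := le_of_mul_le_mul_right (hcost.trans hc) (by exact_mod_cast hN)
  set K : ℕ → Finset V := fun i => nb G (Q i) (v i) with hK
  have hKQ : ∀ i, K i ⊆ Q i := fun i => nb_subset _ _ _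
  have hQsucc : ∀ i < k, Q (i + 1) = Q i \ K i := fun i hi => (hstep i hi).2
  have hQanti : ∀ i j, i ≤ j → j ≤ k → Q j ⊆ Q i := by
    intro i j hij
    induction j, hij using Nat.le_induction with
    | base => exact fun _ => Subset.rfl
    | succ j hj ih =>
      intro hjk
      rw [hQsucc j (by omega)]
      exact sdiff_subset.trans (ih (by omega))
  have hKQ' : ∀ i j, i < j → j < k → K j ⊆ Q (i + 1) := fun i j hij hj =>
    (hKQ j).trans (hQanti _ _ hij hj.le)
  have hdisj : ∀ i j, i < j → j < k → Disjoint (K i) (K j) := by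
    intro i j hij hj
    rw [disjoint_right]
    intro x hx hxi
    have := hKQ' i j hij hj hx
    rw [hQsucc i (by omega), mem_sdiff] at this
    exact this.2 hxi
  have hcover : ∀ l ≤ k, ∀ x ∈ R, x ∈ Q l ∨ ∃ i < l, x ∈ K i := by
    intro l
    induction l with
    | zero => intro _ x hx; left; rwa [hQ0]
    | succ l ih =>
      intro hl x hx
      rcases ih (by omega) x hx with h | ⟨i, hi, h⟩
      · by_cases hxl : x ∈ K l
        · exact Or.inr ⟨l, by omega, hxl⟩
        · left; rw [hQsucc l (by omega)]; exact mem_sdiff.2 ⟨h, hxl⟩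
      · exact Or.inr ⟨i, by omega, h⟩
  have hcostN : ∑ i ∈ range k with ¬ Clean G (Q i) (v i), (K i).card + (Q k).card + 1 ≤ c := by
    have : ((∑ i ∈ range k with ¬ Clean G (Q i) (v i), (K i).card + (Q k).card + 1 : ℕ) : ℝ) ≤
        c := by
      refine le_trans (le_of_eq ?_) hcost'
      rw [sum_filter]
      push_cast
      rw [add_assoc, leafCost]
      congr 1
      refine sum_congr rfl fun i _ => ?_
      rw [defect]
      split_ifs <;> simp_all
    exact_mod_cast this
  -- The exceptional vertices: outside `R`, left over at the end, or discarded at a node that is not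
  -- clean.
  set Y : Finset V := (univ \ R) ∪ (Q k ∪
    ((range k).filter fun i => ¬ Clean G (Q i) (v i)).biUnion K) with hY
  have hYcard : Y.card ≤ (univ \ R).card + c := by
    refine (card_union_le _ _).trans (Nat.add_le_add_left ((card_union_le _ _).trans ?_) _)
    have := card_biUnion_le (s := (range k).filter fun i => ¬ Clean G (Q i) (v i)) (t := K)
    omega
  -- A class disjoint from `Z` has all its neighbours in classes discarded at clean nodes.
  set Z : Finset V := Y ∪ Y.biUnion (nb G univ) with hZ
  have hZcard : Z.card ≤ (D + 1) * ((univ \ R).card + c) := by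
    calc Z.card ≤ Y.card + ∑ y ∈ Y, (nb G univ y).card :=
          (card_union_le _ _).trans (Nat.add_le_add_left card_biUnion_le _)
      _ ≤ Y.card + Y.card * D := by
          refine Nat.add_le_add_left ?_ _
          simpa using sum_le_card_nsmul Y _ D fun y _ => hD y
      _ = (D + 1) * Y.card := by ring
      _ ≤ _ := Nat.mul_le_mul_left _ hYcard
  set X : Finset ℕ := (range k).filter fun i => ¬ Disjoint (K i) Z with hX
  have hXcard : X.card ≤ Z.card := by
    have h1 : ∑ i ∈ X, 1 ≤ ∑ i ∈ X, (K i ∩ Z).card := by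
      refine sum_le_sum fun i hi => ?_
      have := (mem_filter.1 hi).2
      rw [disjoint_iff_inter_eq_empty, ← Ne, ← nonempty_iff_ne_empty] at this
      exact this.card_pos
    rw [← card_biUnion] at h1
    · have h2 : (X.biUnion fun i => K i ∩ Z).card ≤ Z.card :=
        card_le_card (biUnion_subset.2 fun i _ => inter_subset_right)
      rw [sum_const, smul_eq_mul, mul_one] at h1
      omega
    · intro i hi j hj hij
      have hi' := mem_range.1 (mem_filter.1 hi).1
      have hj' := mem_range.1 (mem_filter.1 hj).1
      refine Disjoint.mono inter_subset_left inter_subset_left ?_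
      rcases lt_or_gt_of_ne hij with h | h
      · exact hdisj i j h hj'
      · exact (hdisj j i h hi').symm
  have hcleanX : ∀ i < k, i ∉ X → Clean G (Q i) (v i) := by
    intro i hi hiX
    by_contra hncl
    apply hiX
    rw [hX, mem_filter]
    refine ⟨mem_range.2 hi, not_disjoint_iff.2 ⟨v (i + 1), (hstep i hi).1, ?_⟩⟩
    refine mem_union_left _ (mem_union_right _ (mem_union_right _ (mem_biUnion.2 ⟨i, ?_, ?_⟩)))
    · exact mem_filter.2 ⟨mem_range.2 hi, hncl⟩
    · exact (hstep i hi).1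
  have hRk : R.card ≤ 3 * k + c := by
    have h1 : R ⊆ Q k ∪ (range k).biUnion K := by
      intro x hx
      rcases hcover k le_rfl x hx with h | ⟨i, hi, h⟩
      · exact mem_union_left _ h
      · exact mem_union_right _ (mem_biUnion.2 ⟨i, mem_range.2 hi, h⟩)
    have h2 := (card_le_card h1).trans (card_union_le _ _)
    have h3 := card_biUnion_le (s := range k) (t := K)
    rw [← sum_filter_add_sum_filter_not (range k) fun i => Clean G (Q i) (v i)] at h3
    have h4 : ∑ i ∈ range k with Clean G (Q i) (v i), (K i).card ≤ k * 3 := by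
      refine (sum_le_card_nsmul _ _ 3 fun i hi => ((mem_filter.1 hi).2.1).le).trans ?_
      rw [smul_eq_mul]
      refine Nat.mul_le_mul_right _ ?_
      simpa using card_filter_le (range k) fun i => Clean G (Q i) (v i)
    omega
  obtain ⟨i₀, hi₀, hrun⟩ := exists_run (k := k) (L := L) X (hXcard.trans hZcard) (by omega)
  -- By cleanness every vertex of the class `K i`, not only the chosen `v (i + 1)`, has exactly `K
  -- (i + 1)` as its neighbourhood in `Q (i + 1)`.
  have hclean : ∀ i < k, Clean G (Q i) (v i) → ∀ a ∈ K i, nb G (Q (i + 1)) a = K (i + 1) := by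
    intro i hi hcl a ha
    have := (hcl.2 a ha).2 (v (i + 1)) (hstep i hi).1
    rwa [← hQsucc i hi] at this
  refine ⟨fun j => K (i₀ + j), fun j hj => (hcleanX _ (by omega) (hrun j hj)).1, ?_, ?_⟩
  · intro i hi j hj hij
    rcases lt_or_gt_of_ne hij with h | h
    · exact hdisj _ _ (by omega) (by omega)
    · exact (hdisj _ _ (by omega) (by omega)).symm
  · intro j hj u hu w hw
    have hj0 := hcleanX (i₀ + j) (by omega) (hrun j (by omega))
    have hj1 := hcleanX (i₀ + j + 1) (by omega) (hrun (j + 1) (by omega))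
    change u ∈ K (i₀ + j + 1) at hu
    change w ∉ K (i₀ + j + 1) at hw
    change _ ↔ w ∈ K (i₀ + j) ∨ w ∈ K (i₀ + j + 1 + 1)
    have hfwd := hclean _ (by omega) hj1 u hu
    constructor
    · intro hadj
      have huZ : u ∉ Z := by
        have := hrun (j + 1) (by omega)
        rw [hX, mem_filter, not_and, not_not] at this
        exact disjoint_left.1 (this (mem_range.2 (by omega))) hu
      have hwY : w ∉ Y := fun h => huZ (mem_union_right _ (mem_biUnion.2
        ⟨w, h, mem_nb.2 ⟨mem_univ _, hadj.symm⟩⟩))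
      simp only [hY, mem_union, mem_sdiff, mem_univ, true_and, mem_biUnion, mem_filter,
        mem_range, not_or, not_not, not_exists, not_and] at hwY
      obtain ⟨hwR, hwQ, hwK⟩ := hwY
      obtain ⟨l, hl, hwl⟩ := (hcover k le_rfl w hwR).resolve_left hwQ
      have hcl : Clean G (Q l) (v l) := by
        by_contra h
        exact hwK l ⟨hl, h⟩ hwl
      -- Of the classes of `u` and `w`, the earlier one is clean and forces the other to be its
      -- immediate successor.
      rcases lt_trichotomy l (i₀ + j + 1) with h | h | h
      · have h1 : u ∈ K (l + 1) := by
          rw [← hclean l hl hcl w hwl]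
          exact mem_nb.2 ⟨hKQ' l _ h (by omega) hu, hadj.symm⟩
        have : l + 1 = i₀ + j + 1 := by
          by_contra hne
          rcases lt_or_gt_of_ne hne with h' | h'
          · exact disjoint_left.1 (hdisj _ _ h' (by omega)) h1 hu
          · omega
        left
        rwa [show i₀ + j = l by omega]
      · subst h; exact absurd hwl hw
      · right
        rw [← hfwd]
        exact mem_nb.2 ⟨hKQ' _ l h hl hwl, hadj⟩
    · rintro (h | h)
      · have := hclean _ (by omega) hj0 w h
        rw [← this] at hu
        exact (mem_nb.1 hu).2.symm
      · rw [← hfwd] at h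
        exact (mem_nb.1 h).2

end Strips

end InducedCycles

namespace InducedCycles

open Finset

set_option linter.unusedSectionVars false

/-! ### Counting induced cycles by path counts -/

section Counting

open scoped Classical

variable {V : Type*} [Fintype V] [DecidableEq V] (G : SimpleGraph V)

/-- The vertex sets of the induced cycles inside `W`. -/
noncomputable def cyclesIn (W : Finset V) : Finset (Finset V) :=
  W.powerset.filter fun S => G.IsInducedCycle (S : Set V)

variable {G}

theorem mem_cyclesIn {W S : Finset V} :
    S ∈ cyclesIn G W ↔ S ⊆ W ∧ G.IsInducedCycle (S : Set V) := by
  simp [cyclesIn]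

theorem numInducedCycles_eq : G.numInducedCycles = (cyclesIn G univ).card := by
  unfold SimpleGraph.numInducedCycles
  rw [← Set.ncard_coe_finset, ← Set.ncard_image_of_injective _ (coe_injective (α := V))]
  congr 1
  ext S
  simp only [Set.mem_ofPred_eq, Set.mem_image, mem_coe, mem_cyclesIn, subset_univ, true_and]
  constructor
  · exact fun h => ⟨S.toFinset, by simpa using h, by simp⟩
  · rintro ⟨T, hT, rfl⟩
    exact hT

theorem exists_cycleMap_of_mem {S : Finset V} (hS : G.IsInducedCycle (S : Set V)) {v : V}
    (hv : v ∈ S) : ∃ k, ∃ f : ZMod k → V, IsCycleMap G k f ∧ f 0 = v ∧ Set.range f = S := by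
  obtain ⟨k, f, hf, hr⟩ := (isInducedCycle_iff G S).1 hS
  obtain ⟨r, rfl⟩ : v ∈ Set.range f := by rw [hr]; exact hv
  exact ⟨k, _, hf.shift r, by simp, by rw [range_shift, hr]⟩

theorem mem_iff_of_range_eq {k : ℕ} {f : ZMod k → V} (hf : IsCycleMap G k f) {S : Finset V}
    (hr : Set.range f = S) (x : V) : x ∈ S ↔ ∃ i : ℕ, i < k ∧ f i = x := by
  rw [← mem_coe, ← hr]
  constructor
  · rintro ⟨j, rfl⟩
    obtain ⟨i, hi, rfl⟩ := hf.exists_natCast j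
    exact ⟨i, hi, rfl⟩
  · rintro ⟨i, _, rfl⟩
    exact ⟨i, rfl⟩

/-- The vertices `a` and `b` are the two neighbours of `v` on the cycle; the path runs from `a`
until it first meets a neighbour of `b`. For a triangle `a` is already such a neighbour, and `P` is
empty. -/
theorem exists_pathSet_of_cycle {W S : Finset V} (hW : S ⊆ W) (hS : G.IsInducedCycle (S : Set V))
    {v : V} (hv : v ∈ S) : ∃ a ∈ nb G W v, ∃ b ∈ nb G W v,
      ∃ P ∈ pathSets G (nb G univ b) (W \ insert v (nb G W v)) a,
        insert v (insert a (insert b P)) = S := by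
  obtain ⟨k, f, hf, rfl, hr⟩ := exists_cycleMap_of_mem hS hv
  have hk := hf.three_le
  have hmem := mem_iff_of_range_eq hf hr
  have hfS : ∀ i < k, f (i : ℕ) ∈ S := fun i hi => (hmem _).2 ⟨i, hi, rfl⟩
  have hadj : ∀ i j, i < j → j < k → (G.Adj (f (i : ℕ)) (f (j : ℕ)) ↔ j = i + 1 ∨ (i = 0 ∧ j + 1 = k)) :=
    fun i j hij hj => hf.natCast_adj hij hj
  have h0 : f 0 = f ((0 : ℕ) : ZMod k) := by simp
  rw [h0]
  refine ⟨f (1 : ℕ), mem_nb.2 ⟨hW (hfS _ (by omega)), ?_⟩, f ((k - 1 : ℕ) : ZMod k),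
    mem_nb.2 ⟨hW (hfS _ (by omega)), ?_⟩, (Icc 1 (k - 3)).image fun i => f ((i + 1 : ℕ) : ZMod k),
    ?_, ?_⟩
  · rw [hadj _ _ (by omega) (by omega)]; omega
  · rw [hadj _ _ (by omega) (by omega)]; omega
  · have := image_mem_pathSets (G := G) (E := nb G univ (f ((k - 1 : ℕ) : ZMod k))) (k - 3)
      (fun i => f ((i + 1 : ℕ) : ZMod k)) (W \ insert (f ((0 : ℕ) : ZMod k))
        (nb G W (f ((0 : ℕ) : ZMod k)))) ?_ ?_ ?_ ?_ ?_
    · exact this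
    · intro i h1 h2
      simp only [mem_sdiff, mem_insert, mem_nb, not_or, not_and]
      refine ⟨hW (hfS _ (by omega)), ?_, fun _ => ?_⟩
      · rw [hf.natCast_inj (by omega) (by omega)]; omega
      · rw [hadj _ _ (by omega) (by omega)]; omega
    · intro i hi
      rw [hadj _ _ (by omega) (by omega)]; omega
    · intro i j h1 h2
      rw [hadj _ _ (by omega) (by omega)]; omega
    · refine mem_nb.2 ⟨mem_univ _, SimpleGraph.Adj.symm ?_⟩
      rw [hadj _ _ (by omega) (by omega)]; omega
    · intro i hi h
      have := (mem_nb.1 h).2.symm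
      rw [hadj _ _ (by omega) (by omega)] at this
      omega
  · ext x
    rw [hmem]
    simp only [mem_insert, mem_image, mem_Icc]
    constructor
    · rintro (rfl | rfl | rfl | ⟨i, hi, rfl⟩)
      · exact ⟨0, by omega, rfl⟩
      · exact ⟨1, by omega, rfl⟩
      · exact ⟨k - 1, by omega, rfl⟩
      · exact ⟨i + 1, by omega, rfl⟩
    · rintro ⟨i, hi, rfl⟩
      by_cases hi0 : i = 0
      · left; rw [hi0]
      by_cases hi1 : i = 1
      · right; left; rw [hi1]
      by_cases hik : i = k - 1
      · right; right; left; rw [hik]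
      · exact Or.inr (Or.inr (Or.inr ⟨i - 1, by omega, by congr 2; omega⟩))

theorem card_cyclesIn_through_le (W : Finset V) (v : V) :
    ((cyclesIn G W).filter (v ∈ ·)).card ≤ ∑ a ∈ nb G W v, ∑ b ∈ nb G W v,
      pathCount G (nb G univ b) (W \ insert v (nb G W v)) a := by
  have hsub : (cyclesIn G W).filter (v ∈ ·) ⊆ (nb G W v).biUnion fun a => (nb G W v).biUnion fun b =>
      (pathSets G (nb G univ b) (W \ insert v (nb G W v)) a).image
        fun P => insert v (insert a (insert b P)) := by
    intro S hS
    rw [mem_filter, mem_cyclesIn] at hS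
    obtain ⟨a, ha, b, hb, P, hP, h⟩ := exists_pathSet_of_cycle hS.1.1 hS.1.2 hS.2
    simp only [mem_biUnion, mem_image]
    exact ⟨a, ha, b, hb, P, hP, h⟩
  refine (card_le_card hsub).trans (card_biUnion_le.trans (sum_le_sum fun a _ =>
    card_biUnion_le.trans (sum_le_sum fun b _ => card_image_le.trans ?_)))
  exact card_pathSets_le _ _ _ _

theorem card_sdiff_insert_nb {W : Finset V} {v : V} (hv : v ∈ W) :
    (W \ insert v (nb G W v)).card + ((nb G W v).card + 1) = W.card := by
  have h : v ∉ nb G W v := fun h => G.loopless.irrefl v (mem_nb.1 h).2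
  rw [← card_insert_of_notMem h]
  exact card_sdiff_add_card_eq_card (insert_subset hv (nb_subset G W v))

/-- The closed neighbourhood of `v` is lost to the path, while only `a` and `b` are free. A vertex
of large degree therefore lies on a small share of the cycles. -/
theorem card_cyclesIn_through_mul_le {W : Finset V} {v : V} (hv : v ∈ W) :
    (((cyclesIn G W).filter (v ∈ ·)).card : ℝ) * growth ((nb G W v).card + 1) ≤
      (nb G W v).card ^ 2 * growth W.card := by
  have h1 : (((cyclesIn G W).filter (v ∈ ·)).card : ℝ) ≤
      (nb G W v).card ^ 2 * growth (W \ insert v (nb G W v)).card := by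
    calc (((cyclesIn G W).filter (v ∈ ·)).card : ℝ) ≤ ∑ a ∈ nb G W v, ∑ b ∈ nb G W v,
          (pathCount G (nb G univ b) (W \ insert v (nb G W v)) a : ℝ) := by
          exact_mod_cast card_cyclesIn_through_le W v
      _ ≤ ∑ a ∈ nb G W v, ∑ b ∈ nb G W v, growth (W \ insert v (nb G W v)).card :=
          sum_le_sum fun a _ => sum_le_sum fun b _ => pathCount_le_growth _ _ _ _
      _ = _ := by simp only [sum_const, nsmul_eq_mul]; ring
  rw [← card_sdiff_insert_nb (G := G) hv, growth_add (W \ insert v (nb G W v)).card, ← mul_assoc]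
  have := growth_pos ((nb G W v).card + 1)
  gcongr

theorem card_cyclesIn_le_sum (W : Finset V) :
    (cyclesIn G W).card ≤ ∑ v ∈ W, ((cyclesIn G W).filter (v ∈ ·)).card := by
  have : cyclesIn G W ⊆ W.biUnion fun v => (cyclesIn G W).filter (v ∈ ·) := by
    intro S hS
    have hS' := mem_cyclesIn.1 hS
    obtain ⟨k, f, hf, hr⟩ := (isInducedCycle_iff G S).1 hS'.2
    have h0 : f 0 ∈ S := by rw [← mem_coe, ← hr]; exact ⟨0, rfl⟩
    exact mem_biUnion.2 ⟨f 0, hS'.1 h0, mem_filter.2 ⟨hS, h0⟩⟩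
  exact (card_le_card this).trans card_biUnion_le

theorem card_cyclesIn_le (W : Finset V) :
    ((cyclesIn G W).card : ℝ) ≤ W.card ^ 3 * growth W.card := by
  have h : ∀ v ∈ W, (((cyclesIn G W).filter (v ∈ ·)).card : ℝ) ≤ W.card ^ 2 * growth W.card := by
    intro v hv
    have h1 := card_cyclesIn_through_mul_le (G := G) hv
    have h2 := one_le_growth ((nb G W v).card + 1)
    have h3 : ((nb G W v).card : ℝ) ≤ W.card := by exact_mod_cast card_le_card (nb_subset G W v)
    have h4 := growth_pos W.card
    calc (((cyclesIn G W).filter (v ∈ ·)).card : ℝ)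
        ≤ (((cyclesIn G W).filter (v ∈ ·)).card : ℝ) * growth ((nb G W v).card + 1) :=
          le_mul_of_one_le_right (Nat.cast_nonneg _) h2
      _ ≤ _ := h1
      _ ≤ _ := by gcongr
  calc ((cyclesIn G W).card : ℝ) ≤ ∑ v ∈ W, (((cyclesIn G W).filter (v ∈ ·)).card : ℝ) := by
        exact_mod_cast card_cyclesIn_le_sum W
    _ ≤ ∑ v ∈ W, (W.card ^ 2 * growth W.card : ℝ) := sum_le_sum h
    _ = _ := by rw [sum_const, nsmul_eq_mul]; ring

theorem card_cyclesIn_le_two_pow (W : Finset V) : (cyclesIn G W).card ≤ 2 ^ W.card := by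
  rw [← card_powerset]
  exact card_filter_le _ _

/-- Pigeonhole over the choices of `v` and two of its neighbours `a` and `b`. -/
theorem exists_large_pathCount {D : ℕ} (hD : ∀ v, (nb G univ v).card ≤ D)
    {N : ℝ} (hN0 : 0 < N) (hN : N ≤ (cyclesIn G univ).card) :
    ∃ v a b, N ≤ Fintype.card V * D ^ 2 *
      pathCount G (nb G univ b) (univ \ insert v (nb G univ v)) a := by
  by_contra hcon
  push Not at hcon
  have h1 : ((cyclesIn G univ).card : ℝ) ≤ ∑ v : V, ∑ a ∈ nb G univ v, ∑ b ∈ nb G univ v,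
      (pathCount G (nb G univ b) (univ \ insert v (nb G univ v)) a : ℝ) := by
    exact_mod_cast (card_cyclesIn_le_sum univ).trans
      (sum_le_sum fun v _ => card_cyclesIn_through_le univ v)
  by_cases hV : IsEmpty V
  · rw [univ_eq_empty, sum_empty] at h1
    rw [univ_eq_empty] at hN
    linarith
  rw [not_isEmpty_iff] at hV
  obtain ⟨v₀⟩ := hV
  have hDpos : (0 : ℝ) < Fintype.card V := by
    have := Fintype.card_pos_iff.2 ⟨v₀⟩
    exact_mod_cast this
  rcases Nat.eq_zero_or_pos D with rfl | hD0
  · have : ∀ v, nb G univ v = ∅ := fun v => card_eq_zero.1 (by have := hD v; omega)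
    simp only [this, sum_empty, sum_const_zero] at h1
    linarith
  have hD0' : (0 : ℝ) < D := by exact_mod_cast hD0
  set c : ℝ := N / (Fintype.card V * D ^ 2) with hc
  have hcpos : 0 < c := by positivity
  have h2 : ∀ v a b, (pathCount G (nb G univ b) (univ \ insert v (nb G univ v)) a : ℝ) < c := by
    intro v a b
    rw [hc, lt_div_iff₀ (by positivity), mul_comm]
    exact hcon v a b
  have h3 : ∀ v ∈ (univ : Finset V), ∑ a ∈ nb G univ v, ∑ b ∈ nb G univ v,
      (pathCount G (nb G univ b) (univ \ insert v (nb G univ v)) a : ℝ) ≤ D ^ 2 * c := by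
    intro v _
    calc _ ≤ ∑ a ∈ nb G univ v, ∑ b ∈ nb G univ v, c :=
          sum_le_sum fun a _ => sum_le_sum fun b _ => (h2 v a b).le
      _ = (nb G univ v).card ^ 2 * c := by simp only [sum_const, nsmul_eq_mul]; ring
      _ ≤ _ := by
        have : ((nb G univ v).card : ℝ) ≤ D := by exact_mod_cast hD v
        gcongr
  by_cases hall : ∀ v, nb G univ v = ∅
  · simp only [hall, sum_empty, sum_const_zero] at h1
    linarith
  push Not at hall
  obtain ⟨v₁, a₁, ha₁⟩ := hall
  have h5 : ∑ v : V, ∑ a ∈ nb G univ v, ∑ b ∈ nb G univ v,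
      (pathCount G (nb G univ b) (univ \ insert v (nb G univ v)) a : ℝ) < ∑ v : V, (D ^ 2 * c) := by
    refine sum_lt_sum h3 ⟨v₁, mem_univ _, ?_⟩
    have hne : (nb G univ v₁).Nonempty := ⟨a₁, ha₁⟩
    calc _ < ∑ a ∈ nb G univ v₁, ∑ b ∈ nb G univ v₁, c :=
          sum_lt_sum_of_nonempty hne fun a _ => sum_lt_sum_of_nonempty hne fun b _ => h2 v₁ a b
      _ = (nb G univ v₁).card ^ 2 * c := by simp only [sum_const, nsmul_eq_mul]; ring
      _ ≤ _ := by
        have : ((nb G univ v₁).card : ℝ) ≤ D := by exact_mod_cast hD v₁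
        gcongr
  rw [sum_const, card_univ, nsmul_eq_mul, hc] at h5
  have : (Fintype.card V : ℝ) * (D ^ 2 * (N / (Fintype.card V * D ^ 2))) = N := by
    field_simp
  linarith

end Counting

end InducedCycles

namespace InducedCycles

open Finset

set_option linter.unusedSectionVars false

/-! ### Factorisations with maximal product -/

section Sizes

theorem prod_le_maxProd_sum {ι : Type*} (I : Finset ι) (s : ι → ℕ) (hs : ∀ i ∈ I, 1 ≤ s i) :
    ∏ i ∈ I, s i ≤ maxProd (∑ i ∈ I, s i) := by
  classical
  induction I using Finset.induction_on with
  | empty => simp [maxProd]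
  | insert a I ha ih =>
    rw [prod_insert ha, sum_insert ha]
    calc s a * ∏ i ∈ I, s i ≤ maxProd (s a) * maxProd (∑ i ∈ I, s i) :=
          Nat.mul_le_mul (le_maxProd _ (hs a (mem_insert_self _ _)))
            (ih fun i hi => hs i (mem_insert_of_mem hi))
      _ ≤ _ := maxProd_mul_le _ _

/-- A better product on `J` could be combined with the sizes outside `J` to beat `maxProd` of the
full sum. -/
theorem maxProd_sum_le_prod_of_subset {ι : Type*} {I J : Finset ι} {s : ι → ℕ}
    (hs : ∀ i ∈ I, 1 ≤ s i) (h : maxProd (∑ i ∈ I, s i) ≤ ∏ i ∈ I, s i) (hJ : J ⊆ I) :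
    maxProd (∑ i ∈ J, s i) ≤ ∏ i ∈ J, s i := by
  classical
  by_contra! hlt
  have h1 := prod_le_maxProd_sum (I \ J) s fun i hi => hs i (mem_sdiff.1 hi).1
  have h2 : 0 < ∏ i ∈ I \ J, s i := prod_pos fun i hi => hs i (mem_sdiff.1 hi).1
  have h3 := maxProd_mul_le (∑ i ∈ I \ J, s i) (∑ i ∈ J, s i)
  rw [sum_sdiff hJ] at h3
  rw [← prod_sdiff hJ] at h
  have h4 : (∏ i ∈ I \ J, s i) * ∏ i ∈ J, s i < (∏ i ∈ I \ J, s i) * maxProd (∑ i ∈ J, s i) :=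
    Nat.mul_lt_mul_of_pos_left hlt h2
  have h5 := Nat.mul_le_mul_right (maxProd (∑ i ∈ J, s i)) h1
  omega

theorem lt_maxProd : ∀ n, 5 ≤ n → n < maxProd n ∧ 6 * n ≤ 5 * maxProd n
  | 0 | 1 | 2 | 3 | 4 => by decide
  | 5 | 6 | 7 => by decide
  | n + 8 => fun _ => by
    have := lt_maxProd (n + 5) (by omega)
    rw [show n + 8 = (n + 5) + 3 by ring, maxProd_add_three (by omega)]
    omega

section Optimal

variable {ι : Type*} {I : Finset ι} {s : ι → ℕ}

theorem size_le_four (hs : ∀ i ∈ I, 1 ≤ s i)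
    (h : maxProd (∑ i ∈ I, s i) ≤ ∏ i ∈ I, s i) {i : ι} (hi : i ∈ I) : s i ≤ 4 := by
  have := maxProd_sum_le_prod_of_subset hs h (singleton_subset_iff.2 hi)
  rw [sum_singleton, prod_singleton] at this
  by_contra! h5
  have := (lt_maxProd (s i) h5).1
  omega

theorem size_pair (hs : ∀ i ∈ I, 1 ≤ s i)
    (h : maxProd (∑ i ∈ I, s i) ≤ ∏ i ∈ I, s i) {i j : ι} (hi : i ∈ I) (hj : j ∈ I) (hij : i ≠ j) :
    maxProd (s i + s j) ≤ s i * s j := by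
  classical
  have := maxProd_sum_le_prod_of_subset hs h (J := {i, j})
    (by intro x hx; rw [mem_insert, mem_singleton] at hx; rcases hx with rfl | rfl <;> assumption)
  rwa [sum_pair hij, prod_pair hij] at this

theorem two_le_size (hs : ∀ i ∈ I, 1 ≤ s i)
    (h : maxProd (∑ i ∈ I, s i) ≤ ∏ i ∈ I, s i) (hsum : ∑ i ∈ I, s i ≠ 1) {i : ι} (hi : i ∈ I) : 2 ≤ s i := by
  classical
  by_contra! hlt
  have h1 : s i = 1 := by have := hs i hi; omega
  have : ∃ j ∈ I, j ≠ i := by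
    by_contra! hcon
    have : I = {i} := eq_singleton_iff_unique_mem.2 ⟨hi, hcon⟩
    rw [this, sum_singleton] at hsum
    exact hsum h1
  obtain ⟨j, hj, hji⟩ := this
  have h2 := size_pair hs h hi hj hji.symm
  have h3 := size_le_four hs h hj
  have h4 := hs j hj
  rw [h1] at h2
  generalize s j = t at *
  interval_cases t <;> simp [maxProd] at h2

theorem not_four_of_ne_three (hs : ∀ i ∈ I, 1 ≤ s i)
    (h : maxProd (∑ i ∈ I, s i) ≤ ∏ i ∈ I, s i) {i j : ι} (hi : i ∈ I) (hj : j ∈ I) (hij : i ≠ j)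
    (hi4 : s i = 4) : s j = 3 := by
  have h2 := size_pair hs h hi hj hij
  have h3 := size_le_four hs h hj
  have h4 := hs j hj
  rw [hi4] at h2
  generalize s j = t at *
  interval_cases t <;> simp [maxProd] at h2 ⊢

theorem eq_of_three_twos (hs : ∀ i ∈ I, 1 ≤ s i)
    (h : maxProd (∑ i ∈ I, s i) ≤ ∏ i ∈ I, s i) {i j l : ι} (hi : i ∈ I) (hj : j ∈ I) (hl : l ∈ I) (hij : i ≠ j)
    (hil : i ≠ l) (hjl : j ≠ l) (hi2 : s i = 2) (hj2 : s j = 2) : s l ≠ 2 := by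
  classical
  intro hl2
  have := maxProd_sum_le_prod_of_subset hs h (J := {i, j, l})
    (by intro x hx; simp only [mem_insert, mem_singleton] at hx
        rcases hx with rfl | rfl | rfl <;> assumption)
  rw [sum_insert (by simp [hij, hil]), prod_insert (by simp [hij, hil]), sum_pair hjl,
    prod_pair hjl, hi2, hj2, hl2] at this
  simp [maxProd] at this

end Optimal

/-- Period 3 in `m` reduces the claim to a table. The excluded case is `d = 1`, `m = 0`: it is
lossless although `d` is 1, because `maxProd 0 = maxProd 1`. -/
theorem step_dichotomy_aux (d : ℕ) (hd : 1 ≤ d) (hd4 : d ≤ 4) : ∀ m : ℕ, m + d ≠ 1 →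
    32 * (d * maxProd m) ≤ 31 * maxProd (m + d) ∨
      (2 ≤ d ∧ m ≠ 1 ∧ d * maxProd m = maxProd (m + d))
  | 0 | 1 | 2 | 3 | 4 => by interval_cases d <;> decide
  | m + 5 => fun _ => by
    have := step_dichotomy_aux d hd hd4 (m + 2) (by omega)
    rw [show m + 5 + d = (m + 2 + d) + 3 by ring, maxProd_add_three (by omega),
      maxProd_add_three (by omega)]
    rcases this with h | ⟨h1, -, h2⟩
    · left; nlinarith
    · right; exact ⟨h1, by omega, by rw [← h2]; ring⟩

theorem step_dichotomy {d m : ℕ} (hd : 1 ≤ d) (hm : m + d ≠ 1) :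
    32 * (d * maxProd m) ≤ 31 * maxProd (m + d) ∨
      (2 ≤ d ∧ d ≤ 4 ∧ m ≠ 1 ∧ d * maxProd m = maxProd (m + d)) := by
  rcases Nat.lt_or_ge 4 d with h | h
  · left
    have h1 := (lt_maxProd d h).2
    have h2 := maxProd_mul_le m d
    nlinarith [maxProd_pos m]
  · rcases step_dichotomy_aux d hd h m hm with h' | h'
    · exact Or.inl h'
    · exact Or.inr ⟨h'.1, h, h'.2⟩

end Sizes

/-! ### Loss caused by a vertex that does not sit on top of the levels -/

section Deficit

variable (s f : ℕ → ℕ)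

/-- With level sizes `s` and `f i` seen vertices on level `i`, the sum bounds the continuations of a
vertex whose seen vertices are discarded. The additional product, of the unseen parts, carries the
induction. -/
theorem sum_mul_prod_add_le (n : ℕ) (hs : ∀ i < n, 1 ≤ s i) (hf : ∀ i < n, f i ≤ s i) :
    ∑ j ∈ range n, f j * ∏ i ∈ range j, (s i - f i) + ∏ i ∈ range n, (s i - f i) ≤
      ∏ i ∈ range n, s i := by
  induction n with
  | zero => simp
  | succ n ih =>
    rw [sum_range_succ, prod_range_succ, prod_range_succ]
    have h := ih (fun i hi => hs i (by omega)) fun i hi => hf i (by omega)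
    have h1 := hs n (by omega)
    obtain ⟨e, he⟩ := Nat.exists_eq_add_of_le (hf n (by omega))
    rw [he, Nat.add_sub_cancel_left]
    set W := ∑ j ∈ range n, f j * ∏ i ∈ range j, (s i - f i)
    set Q := ∏ i ∈ range n, (s i - f i)
    have h2 := Nat.mul_le_mul_right (f n + e) h
    have h3 : W ≤ W * (f n + e) := Nat.le_mul_of_pos_right _ (by omega)
    nlinarith

theorem four_mul_prod_le {n j : ℕ} (hj : j < n) (hs4 : ∀ i < n, s i ≤ 4) (hfj : 1 ≤ f j) :
    4 * ∏ i ∈ range n, (s i - f i) ≤ 3 * ∏ i ∈ range n, s i := by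
  rw [← mul_prod_erase _ _ (mem_range.2 hj), ← mul_prod_erase _ s (mem_range.2 hj), ← mul_assoc,
    ← mul_assoc]
  refine Nat.mul_le_mul ?_ (prod_le_prod' fun i _ => Nat.sub_le _ _)
  have := hs4 j hj
  omega

/-- Let `P` be the product of the lower sizes and `Q` that of their unseen parts. If the top level
is not fully seen, the sum is at most `(s k - 1) * P`, which loses a quarter or more. Otherwise `Q ≤
3/4 * P` bounds it by `P + (s k - 1) * (3/4) * P`; the factor 7/8 is reached by this estimate at `s
k = 2`. -/
theorem eight_mul_sum_le {k : ℕ} (hs2 : ∀ i < k + 1, 2 ≤ s i) (hs4 : ∀ i < k + 1, s i ≤ 4)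
    (hf : ∀ i < k + 1, f i ≤ s i) (h : f k < s k ∨ ∃ j < k, 1 ≤ f j) :
    8 * ∑ j ∈ range (k + 1), f j * ∏ i ∈ range j, (s i - f i) ≤
      7 * ∏ i ∈ range (k + 1), s i := by
  have h0 := sum_mul_prod_add_le s f k (fun i hi => (by norm_num : 1 ≤ 2).trans (hs2 i (by omega)))
    fun i hi => hf i (by omega)
  rw [sum_range_succ, prod_range_succ]
  have h2 := hs2 k (by omega)
  have h4 := hs4 k (by omega)
  have hfk := hf k (by omega)
  set W := ∑ j ∈ range k, f j * ∏ i ∈ range j, (s i - f i)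
  set P := ∏ i ∈ range k, s i
  by_cases hlt : f k < s k
  · set Q := ∏ i ∈ range k, (s i - f i)
    generalize f k = a at *
    generalize s k = b at *
    interval_cases b <;> interval_cases a <;> omega
  · obtain ⟨j, hj, hfj⟩ := h.resolve_left hlt
    have h1 := four_mul_prod_le s f hj (fun i hi => hs4 i (by omega)) hfj
    have hfk' : f k = s k := by omega
    rw [hfk']
    generalize (∏ i ∈ range k, (s i - f i)) = Q at *
    change 4 * Q ≤ 3 * P at h1
    generalize s k = b at *
    interval_cases b <;> omega

end Deficit

/-! ### Layered sets and the gap for path counts -/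

section Braids

open scoped Classical

variable {V : Type*} [DecidableEq V] (G : SimpleGraph V) (E : Finset V)

/-- `R` splits into `k` levels, such that consecutive levels are completely joined, other pairs of
different levels are not joined at all, and `E` meets `R` in the lowest level. -/
structure IsLayered (R : Finset V) (k : ℕ) (lev : V → ℕ) : Prop where
  lt : ∀ x ∈ R, lev x < k
  nonempty : ∀ i < k, ∃ x ∈ R, lev x = i
  end_iff : ∀ x ∈ R, x ∈ E ↔ lev x = 0
  adj : ∀ x ∈ R, ∀ y ∈ R, lev y = lev x + 1 → G.Adj x y
  not_adj : ∀ x ∈ R, ∀ y ∈ R, lev x + 2 ≤ lev y → ¬ G.Adj x y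

/-- `s` may be put on top of the levels. -/
def IsTop (R : Finset V) (k : ℕ) (lev : V → ℕ) (s : V) : Prop :=
  (s ∈ E ↔ k = 0) ∧ ∀ x ∈ R, G.Adj s x ↔ lev x + 1 = k

/-- The vertices of `R` on the level `i`. -/
def level (R : Finset V) (lev : V → ℕ) (i : ℕ) : Finset V := R.filter fun x => lev x = i

variable {G E} {R : Finset V} {k : ℕ} {lev : V → ℕ}

theorem mem_level {i : ℕ} {x : V} : x ∈ level R lev i ↔ x ∈ R ∧ lev x = i := by simp [level]

theorem level_mono {Q : Finset V} (h : Q ⊆ R) (i : ℕ) : level Q lev i ⊆ level R lev i :=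
  filter_subset_filter _ h

/-- The end is on level 0 and a path descends at most one level at a time, so it cannot cross an
exhausted level. -/
theorem IsLayered.pathCount_eq_zero (hL : IsLayered G E R k lev) (Q : Finset V) (x : V)
    (hQ : Q ⊆ R) (hx : x ∈ R) (i : ℕ) (hi : i < lev x) (hQi : ∀ y ∈ Q, lev y ≠ i) :
    pathCount G E Q x = 0 := by
  induction Q, x using node_induction G with
  | h Q x ih =>
    have hxE : x ∉ E := fun h => by have := (hL.end_iff x hx).1 h; omega
    rw [pathCount_of_notMem hxE]
    refine sum_eq_zero fun y hy => ?_
    obtain ⟨hyQ, hadj⟩ := mem_nb.1 hy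
    refine ih y hy (sdiff_subset.trans hQ) (hQ hyQ) ?_ fun z hz => hQi z (mem_sdiff.1 hz).1
    by_contra! hle
    have := hQi y hyQ
    exact hL.not_adj y (hQ hyQ) x hx (by omega) hadj.symm

/-- At `x` the whole next lower level is discarded. Choosing a neighbour on any other level leaves
this exhausted level to be crossed, so such a choice contributes nothing. -/
theorem IsLayered.pathCount_le (hL : IsLayered G E R k lev) (Q : Finset V) (x : V) (hQ : Q ⊆ R)
    (hx : x ∈ R) : pathCount G E Q x ≤ ∏ i ∈ range (lev x), (level Q lev i).card := by
  induction Q, x using node_induction G with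
  | h Q x ih =>
    by_cases hxE : x ∈ E
    · rw [pathCount_of_mem hxE, (hL.end_iff x hx).1 hxE]; simp
    rw [pathCount_of_notMem hxE]
    obtain ⟨j, hj⟩ : ∃ j, lev x = j + 1 := Nat.exists_eq_succ_of_ne_zero fun h =>
      hxE ((hL.end_iff x hx).2 h)
    have hlow : level Q lev j ⊆ nb G Q x := fun y hy => mem_nb.2 ⟨(mem_level.1 hy).1,
      (hL.adj y (hQ (mem_level.1 hy).1) x hx (by rw [hj, (mem_level.1 hy).2])).symm⟩
    rw [← sum_subset hlow, hj, prod_range_succ, mul_comm]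
    · refine (sum_le_card_nsmul _ _ (∏ i ∈ range j, (level Q lev i).card) fun y hy => ?_)
      have := ih y (hlow hy) (sdiff_subset.trans hQ) (hQ (mem_level.1 hy).1)
      rw [(mem_level.1 hy).2] at this
      exact this.trans (prod_le_prod' fun i _ => card_le_card (level_mono sdiff_subset i))
    · intro y hy hyj
      obtain ⟨hyQ, hadj⟩ := mem_nb.1 hy
      have hyj' : lev y ≠ j := fun h => hyj (mem_level.2 ⟨hyQ, h⟩)
      refine hL.pathCount_eq_zero _ y (sdiff_subset.trans hQ) (hQ hyQ) j ?_ ?_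
      · by_contra! hle
        exact hL.not_adj y (hQ hyQ) x hx (by omega) hadj.symm
      · intro z hz hzj
        obtain ⟨hzQ, hzn⟩ := mem_sdiff.1 hz
        exact hzn (hlow (mem_level.2 ⟨hzQ, hzj⟩))

theorem IsLayered.sum_card (hL : IsLayered G E R k lev) :
    ∑ i ∈ range k, (level R lev i).card = R.card :=
  (card_eq_sum_card_fiberwise fun x hx => mem_range.2 (hL.lt x hx)).symm

theorem IsLayered.one_le_card (hL : IsLayered G E R k lev) {i : ℕ} (hi : i ∈ range k) :
    1 ≤ (level R lev i).card := by
  obtain ⟨x, hx, h⟩ := hL.nonempty i (mem_range.1 hi)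
  exact card_pos.2 ⟨x, mem_level.2 ⟨hx, h⟩⟩

theorem IsLayered.sum_nb_le (hL : IsLayered G E R k lev) (a : V) (ha : a ∉ E) :
    pathCount G E R a ≤ ∑ j ∈ range k, (level (nb G R a) lev j).card *
      ∏ i ∈ range j, ((level R lev i).card - (level (nb G R a) lev i).card) := by
  rw [pathCount_of_notMem ha]
  set F := nb G R a with hF
  have hFR : F ⊆ R := nb_subset G R a
  have hmaps : ∀ x ∈ F, lev x ∈ range k := fun x hx => mem_range.2 (hL.lt x (hFR hx))
  rw [← sum_fiberwise_of_maps_to hmaps]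
  refine sum_le_sum fun j _ => ?_
  rw [← smul_eq_mul]
  refine sum_le_card_nsmul _ _ _ fun x hx => ?_
  rw [mem_filter] at hx
  have := hL.pathCount_le (R \ F) x sdiff_subset (hFR hx.1)
  rw [hx.2] at this
  refine this.trans (le_of_eq (prod_congr rfl fun i _ => ?_))
  rw [← card_sdiff_of_subset (level_mono hFR i)]
  congr 1
  ext y
  simp only [mem_level, mem_sdiff]
  tauto

theorem IsLayered.pathCount_top_le (hL : IsLayered G E R k lev) {s : V}
    (hs : IsTop G E R k lev s) : pathCount G E R s ≤ ∏ i ∈ range k, (level R lev i).card := by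
  by_cases hsE : s ∈ E
  · rw [pathCount_of_mem hsE, hs.1.1 hsE]; simp
  have h1 := hL.sum_nb_le s hsE
  have h2 := sum_mul_prod_add_le (fun i => (level R lev i).card)
    (fun i => (level (nb G R s) lev i).card) k (fun i hi => hL.one_le_card (mem_range.2 hi))
    fun i _ => card_le_card (level_mono (nb_subset G R s) i)
  omega

theorem IsLayered.eight_mul_le (hL : IsLayered G E R k lev)
    (hs2 : ∀ i < k, 2 ≤ (level R lev i).card) (hs4 : ∀ i < k, (level R lev i).card ≤ 4) {a : V}
    (ha : ¬ IsTop G E R k lev a) :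
    8 * pathCount G E R a ≤ 7 * ∏ i ∈ range k, (level R lev i).card := by
  rcases Nat.eq_zero_or_pos k with rfl | hk
  · have hR : R = ∅ := eq_empty_of_forall_notMem fun x hx => absurd (hL.lt x hx) (by omega)
    subst hR
    have haE : a ∉ E := fun h => ha ⟨by simp [h], by simp⟩
    rw [pathCount_of_notMem haE]
    simp [nb]
  obtain ⟨k, rfl⟩ := Nat.exists_eq_succ_of_ne_zero hk.ne'
  by_cases haE : a ∈ E
  · rw [pathCount_of_mem haE, Nat.succ_eq_add_one, prod_range_succ]
    have h1 := hs2 k (by omega)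
    have h2 : 0 < ∏ i ∈ range k, (level R lev i).card :=
      prod_pos fun i hi => hL.one_le_card (by simp at hi ⊢; omega)
    nlinarith
  have hF := nb_subset G R a
  refine (Nat.mul_le_mul_left 8 (hL.sum_nb_le a haE)).trans
    (eight_mul_sum_le _ _ hs2 hs4 (fun i _ => card_le_card (level_mono hF i)) ?_)
  by_contra! hcon
  refine ha ⟨by simp [haE], fun x hx => ?_⟩
  have hk := hL.lt x hx
  constructor
  · intro hadj
    by_contra hne
    have := hcon.2 (lev x) (by omega)
    have h0 : (level (nb G R a) lev (lev x)).card = 0 := by omega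
    rw [card_eq_zero] at h0
    exact notMem_empty x (h0 ▸ mem_level.2 ⟨mem_nb.2 ⟨hx, hadj⟩, rfl⟩)
  · intro hxk
    have heq := eq_of_subset_of_card_le (level_mono hF k) hcon.1
    have : x ∈ level R lev k := mem_level.2 ⟨hx, by omega⟩
    rw [← heq] at this
    exact (mem_nb.1 (mem_level.1 this).1).2

variable (G E) in
-- By induction, a step either loses 1/32 numerically, or all children lose it, or some child is
-- extremal and the set that remains is layered with sizes from 2 to 4. In the last case either all
-- children sit on top of these levels and form a new one, or some child loses an eighth. Size 1 is
-- excluded because an end with one unused vertex attains `maxProd 1` without being layered.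
theorem pathCount_gap (R : Finset V) (s : V) (hR : R.card ≠ 1) :
    ((∃ k lev, IsLayered G E R k lev ∧ IsTop G E R k lev s) ∧
      pathCount G E R s = maxProd R.card) ∨
      32 * pathCount G E R s ≤ 31 * maxProd R.card := by
  induction R, s using node_induction G with
  | h R s ih =>
    by_cases hs : s ∈ E
    · rw [pathCount_of_mem hs]
      rcases R.eq_empty_or_nonempty with rfl | hne
      · left
        refine ⟨⟨0, fun _ => 0, ⟨by simp, by simp, by simp, by simp, by simp⟩, by simp [hs],
          by simp⟩, by simp [maxProd]⟩
      · right
        have h1 := hne.card_pos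
        have h2 := le_maxProd R.card (by omega)
        omega
    set A := nb G R s with hA
    have hcard := card_sdiff_nb G R s
    rw [← hA] at hcard
    have hsum : pathCount G E R s = ∑ a ∈ A, pathCount G E (R \ A) a := pathCount_of_notMem hs
    rcases Nat.eq_zero_or_pos A.card with h0 | hpos
    · right
      rw [hsum, card_eq_zero.1 h0]
      simp
    rcases step_dichotomy (d := A.card) (m := (R \ A).card) hpos (by omega) with hlossy | hless
    · right
      rw [hcard] at hlossy
      refine le_trans (Nat.mul_le_mul_left _ ?_) hlossy
      rw [hsum]
      exact sum_le_card_nsmul _ _ _ fun a _ => pathCount_le_maxProd _ _ _ _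
    obtain ⟨hd2, hd4, hm1, hprod⟩ := hless
    rw [hcard] at hprod
    by_cases hall : ∀ a ∈ A, 32 * pathCount G E (R \ A) a ≤ 31 * maxProd (R \ A).card
    · right
      rw [hsum, ← hprod, mul_sum, mul_left_comm]
      exact sum_le_card_nsmul _ _ _ hall
    push Not at hall
    obtain ⟨a, ha, hlt⟩ := hall
    obtain ⟨⟨k, lev, hL, hTop⟩, hmax⟩ := (ih a ha hm1).resolve_right (by omega)
    have hle := hL.pathCount_top_le hTop
    have hone : ∀ i ∈ range k, 1 ≤ (level (R \ A) lev i).card := fun i hi => hL.one_le_card hi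
    have hge := prod_le_maxProd_sum (range k) (fun i => (level (R \ A) lev i).card) hone
    rw [hL.sum_card] at hge
    have hopt : maxProd (∑ i ∈ range k, (level (R \ A) lev i).card) ≤
        ∏ i ∈ range k, (level (R \ A) lev i).card := by rw [hL.sum_card]; omega
    have hs2 : ∀ i < k, 2 ≤ (level (R \ A) lev i).card := fun i hi =>
      two_le_size (s := fun i => (level (R \ A) lev i).card) hone hopt (by rwa [hL.sum_card])
        (mem_range.2 hi)
    have hs4 : ∀ i < k, (level (R \ A) lev i).card ≤ 4 := fun i hi =>
      size_le_four (s := fun i => (level (R \ A) lev i).card) hone hopt (mem_range.2 hi)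
    by_cases htop : ∀ b ∈ A, IsTop G E (R \ A) k lev b
    · left
      have hAR : A ⊆ R := nb_subset G R s
      have hAk : ∀ x ∈ R, x ∉ A → lev x < k := fun x hx hxA => hL.lt x (mem_sdiff.2 ⟨hx, hxA⟩)
      refine ⟨⟨k + 1, fun x => if x ∈ A then k else lev x, ?_, ?_⟩, ?_⟩
      · constructor
        · intro x hx
          by_cases hxA : x ∈ A
          · simp [hxA]
          · simp only [hxA, if_false]
            have := hAk x hx hxA
            omega
        · intro i hi
          rcases Nat.lt_succ_iff_lt_or_eq.1 hi with h | rfl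
          · obtain ⟨x, hx, hxi⟩ := hL.nonempty i h
            rw [mem_sdiff] at hx
            exact ⟨x, hx.1, by simp [hx.2, hxi]⟩
          · exact ⟨a, hAR ha, by simp [ha]⟩
        · intro x hx
          by_cases hxA : x ∈ A
          · simpa [hxA] using (htop x hxA).1
          · simpa [hxA] using hL.end_iff x (mem_sdiff.2 ⟨hx, hxA⟩)
        · intro x hx y hy hxy
          by_cases hxA : x ∈ A
          · by_cases hyA : y ∈ A
            · simp [hxA, hyA] at hxy
            · simp only [hxA, hyA, if_true, if_false] at hxy
              have := hAk y hy hyA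
              omega
          · by_cases hyA : y ∈ A
            · simp only [hxA, hyA, if_true, if_false] at hxy
              exact (((htop y hyA).2 x (mem_sdiff.2 ⟨hx, hxA⟩)).2 hxy.symm).symm
            · simp only [hxA, hyA, if_false] at hxy
              exact hL.adj x (mem_sdiff.2 ⟨hx, hxA⟩) y (mem_sdiff.2 ⟨hy, hyA⟩) hxy
        · intro x hx y hy hxy hadj
          by_cases hxA : x ∈ A
          · by_cases hyA : y ∈ A
            · simp [hxA, hyA] at hxy
            · simp only [hxA, hyA, if_true, if_false] at hxy
              have := hAk y hy hyA
              omega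
          · by_cases hyA : y ∈ A
            · simp only [hxA, hyA, if_true, if_false] at hxy
              have := ((htop y hyA).2 x (mem_sdiff.2 ⟨hx, hxA⟩)).1 hadj.symm
              omega
            · simp only [hxA, hyA, if_false] at hxy
              exact hL.not_adj x (mem_sdiff.2 ⟨hx, hxA⟩) y (mem_sdiff.2 ⟨hy, hyA⟩) hxy hadj
      · refine ⟨by simp [hs], fun x hx => ?_⟩
        by_cases hxA : x ∈ A
        · simp [hxA, (mem_nb.1 hxA).2]
        · have h1 := hAk x hx hxA
          have h2 : ¬ G.Adj s x := fun h => hxA (mem_nb.2 ⟨hx, h⟩)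
          simp only [hxA, h2, if_false, false_iff]
          omega
      · rw [hsum, ← hprod, ← smul_eq_mul]
        rw [sum_congr rfl, sum_const]
        intro b hb
        rw [← hmax]
        have hb' := htop b hb
        by_cases hk : k = 0
        · rw [pathCount_of_mem (hb'.1.2 hk), pathCount_of_mem (hTop.1.2 hk)]
        · have hnb : nb G (R \ A) b = nb G (R \ A) a := by
            ext x
            simp only [mem_nb]
            exact and_congr_right fun hx => (hb'.2 x hx).trans (hTop.2 x hx).symm
          rw [pathCount_of_notMem fun h => hk (hb'.1.1 h),
            pathCount_of_notMem fun h => hk (hTop.1.1 h), hnb]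
    · right
      push Not at htop
      obtain ⟨b, hb, hbt⟩ := htop
      -- There are at most four children and `b` loses an eighth of its share, hence 1/32 of the
      -- total.
      have h8 := hL.eight_mul_le hs2 hs4 hbt
      have h9 : ∑ c ∈ A.erase b, pathCount G E (R \ A) c ≤
          (A.card - 1) * maxProd (R \ A).card := by
        rw [← card_erase_of_mem hb]
        exact sum_le_card_nsmul _ _ _ fun c _ => pathCount_le_maxProd _ _ _ _
      rw [hsum, ← hprod, ← add_sum_erase A _ hb]
      generalize (∑ c ∈ A.erase b, pathCount G E (R \ A) c) = y at *
      generalize pathCount G E (R \ A) b = z at *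
      generalize A.card = d at *
      generalize maxProd (R \ A).card = g at *
      have : d = 2 ∨ d = 3 ∨ d = 4 := by omega
      rcases this with rfl | rfl | rfl <;> omega

end Braids

end InducedCycles

namespace InducedCycles

open Finset

set_option linter.unusedSectionVars false

/-! ### Modules and induced cycles -/

section Modules

variable {V : Type*} {G : SimpleGraph V} {k : ℕ} {f : ZMod k → V}

theorem natCast_ne_zero_of_lt {k a : ℕ} (ha : 0 < a) (hak : a < k) :
    (a : ZMod k) ≠ 0 := by
  rw [Ne, ZMod.natCast_eq_zero_iff]
  exact fun h => absurd (Nat.le_of_dvd ha h) (by omega)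

theorem IsCycleMap.two_ne_zero (hf : IsCycleMap G k f) : (2 : ZMod k) ≠ 0 := by
  exact_mod_cast natCast_ne_zero_of_lt (a := 2) (by norm_num) hf.three_le

theorem IsCycleMap.eq_three (hf : IsCycleMap G k f) (h : (3 : ZMod k) = 0) : k = 3 := by
  by_contra hne
  have := hf.three_le
  exact natCast_ne_zero_of_lt (k := k) (a := 3) (by norm_num) (by omega) (by exact_mod_cast h)

theorem IsCycleMap.eq_four (hf : IsCycleMap G k f) (h : (4 : ZMod k) = 0) : k = 4 := by
  by_contra hne
  rcases Nat.lt_or_ge k 4 with h4 | h4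
  · have h3 : k = 3 := by have := hf.three_le; omega
    subst h3
    revert h
    decide
  · exact natCast_ne_zero_of_lt (k := k) (a := 4) (by norm_num) (by omega) (by exact_mod_cast h)

theorem IsCycleMap.one_ne_zero (hf : IsCycleMap G k f) : (1 : ZMod k) ≠ 0 := by
  have := hf.three_le
  exact_mod_cast natCast_ne_zero_of_lt (a := 1) (by norm_num) (by omega)

theorem IsCycleMap.adj_succ (hf : IsCycleMap G k f) (i : ZMod k) : G.Adj (f i) (f (i + 1)) :=
  (hf.adj_iff _ _).2 (Or.inl rfl)

theorem IsCycleMap.adj_pred (hf : IsCycleMap G k f) (i : ZMod k) : G.Adj (f i) (f (i - 1)) :=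
  (hf.adj_iff _ _).2 (Or.inr (by ring))

/-- A property that holds somewhere on the cycle but not everywhere is lost at some step. -/
theorem IsCycleMap.exists_step (hf : IsCycleMap G k f) {P : V → Prop} {a b : ZMod k}
    (ha : P (f a)) (hb : ¬ P (f b)) : ∃ i, P (f i) ∧ ¬ P (f (i + 1)) := by
  by_contra! h
  obtain ⟨j, -, hj⟩ := hf.exists_natCast (b - a)
  have : ∀ j : ℕ, P (f (a + j)) := by
    intro j
    induction j with
    | zero => simpa using ha
    | succ j ih =>
      have := h _ ih
      rwa [add_assoc, ← Nat.cast_succ] at this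
  have := this j
  rw [hj, add_sub_cancel] at this
  exact hb this

/-- The vertices of `C` have the same neighbours outside `C`. -/
def IsModule (G : SimpleGraph V) (C : Set V) : Prop :=
  ∀ p ∈ C, ∀ q ∈ C, ∀ w ∉ C, G.Adj p w → G.Adj q w

/-- Let the cycle leave `C` from `i` to `i + 1`. The vertex at `i + 1` is adjacent to every vertex
of the cycle in `C`, so these can only be at `i` and `i + 2`. If the predecessor of `i` is in `C`,
it is `i + 2` and the cycle is a triangle. If not, it is also adjacent to `f (i + 2)`, and the
length is 4. -/
theorem IsCycleMap.of_module (hf : IsCycleMap G k f) {C : Set V} (hC : IsModule G C)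
    {a b c : ZMod k} (ha : f a ∈ C) (hb : f b ∈ C) (hab : a ≠ b) (hc : f c ∉ C) :
    ∃ i, f i ∈ C ∧ f (i + 1) ∉ C ∧ f (i + 2) ∈ C ∧
      (∀ j, f j ∈ C → j = i ∨ j = i + 2) ∧ (k = 3 ∨ k = 4 ∧ f (i + 3) ∉ C) := by
  obtain ⟨i, hi, hi1⟩ := hf.exists_step (P := (· ∈ C)) ha hc
  have hall : ∀ j, f j ∈ C → j = i ∨ j = i + 2 := by
    intro j hj
    have := hC _ hi _ hj _ hi1 (hf.adj_succ i)
    rw [hf.adj_iff] at this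
    rcases this with h | h
    · left; exact (add_right_cancel h).symm
    · right; rw [h]; ring
  have hi2 : f (i + 2) ∈ C := by
    rcases hall a ha with h | h
    · rcases hall b hb with h' | h'
      · exact absurd (h.trans h'.symm) hab
      · rwa [h'] at hb
    · rwa [h] at ha
  refine ⟨i, hi, hi1, hi2, hall, ?_⟩
  by_cases hr : f (i - 1) ∈ C
  · left
    rcases hall _ hr with h | h
    · exact absurd (by linear_combination -h) hf.one_ne_zero
    · exact hf.eq_three (by linear_combination -h)
  · right
    have := hC _ hi _ hi2 _ hr (hf.adj_pred i)
    rw [hf.adj_iff] at this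
    have h4 : (4 : ZMod k) = 0 := by
      rcases this with h | h
      · linear_combination -h
      · exact absurd (by linear_combination h) hf.two_ne_zero
    refine ⟨hf.eq_four h4, ?_⟩
    rwa [show i + 3 = i - 1 by linear_combination h4]

theorem IsCycleMap.eq_of_module (hf : IsCycleMap G k f) (hk : 5 ≤ k) {C : Set V}
    (hC : IsModule G C) {a b c : ZMod k} (ha : f a ∈ C) (hb : f b ∈ C) (hc : f c ∉ C) : a = b := by
  by_contra hab
  obtain ⟨i, -, -, -, -, h⟩ := hf.of_module hC ha hb hab hc
  omega

theorem IsCycleMap.card_eq (hf : IsCycleMap G k f) {S : Finset V} (hr : Set.range f = S) :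
    S.card = k := by
  classical
  have : NeZero k := ⟨by have := hf.three_le; omega⟩
  have : S = univ.image f := by
    rw [← coe_inj, ← hr]; simp
  rw [this, card_image_of_injective _ hf.inj, card_univ, ZMod.card]

theorem IsCycleMap.exists_notMem (hf : IsCycleMap G k f) (C : Finset V) (hC : C.card < k) :
    ∃ c, f c ∉ C := by
  classical
  have : NeZero k := ⟨by have := hf.three_le; omega⟩
  by_contra! h
  have h1 : univ.image f ⊆ C := by
    intro x hx
    obtain ⟨i, -, rfl⟩ := mem_image.1 hx
    exact h i
  have := card_le_card h1
  rw [card_image_of_injective _ hf.inj, card_univ, ZMod.card] at this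
  omega

end Modules

/-! ### Cycles that cross a strip -/

section Crossing

open scoped Classical

variable {V : Type*} [Fintype V] [DecidableEq V] {G : SimpleGraph V} {L : ℕ} {B : ℕ → Finset V}

theorem IsStrip.notMem (hB : IsStrip G L B) {i j : ℕ} (hi : i < L) (hj : j < L) (hij : i ≠ j)
    {x : V} (hx : x ∈ B i) : x ∉ B j :=
  disjoint_left.1 (hB.disjoint i hi j hj hij) hx

theorem IsStrip.isModule (hB : IsStrip G L B) {j : ℕ} (hj : j + 2 < L) :
    IsModule G (B (j + 1) : Set V) := fun p hp q hq w hw h =>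
  (hB.adj_iff j hj q hq w hw).2 ((hB.adj_iff j hj p hp w hw).1 h)

variable {k : ℕ} {f : ZMod k → V}

theorem IsStrip.eq_of_mem (hB : IsStrip G L B) (hf : IsCycleMap G k f) (hk : 5 ≤ k) {j : ℕ}
    (hj : j + 2 < L) {a b : ZMod k} (ha : f a ∈ B (j + 1)) (hb : f b ∈ B (j + 1)) : a = b := by
  obtain ⟨c, hc⟩ := hf.exists_notMem (B (j + 1)) (by rw [hB.card_eq _ (by omega)]; omega)
  exact hf.eq_of_module hk (hB.isModule hj) ha hb hc

/-- Both neighbours lie in adjacent classes, and a cycle of length at least 5 meets each of these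
modules at most once, so they lie on different sides. -/
theorem IsStrip.neighbours (hB : IsStrip G L B) (hf : IsCycleMap G k f) (hk : 5 ≤ k) {j : ℕ}
    (hj : j + 4 < L) {i : ZMod k} (hi : f i ∈ B (j + 2)) :
    (f (i + 1) ∈ B (j + 3) ∧ f (i - 1) ∈ B (j + 1)) ∨
      (f (i + 1) ∈ B (j + 1) ∧ f (i - 1) ∈ B (j + 3)) := by
  have hn1 : f (i + 1) ∉ B (j + 2) := fun h => hf.one_ne_zero
    (by linear_combination -(hB.eq_of_mem hf hk (by omega) hi h))
  have hn2 : f (i - 1) ∉ B (j + 2) := fun h => hf.one_ne_zero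
    (by linear_combination (hB.eq_of_mem hf hk (by omega) hi h))
  have h1 := (hB.adj_iff (j + 1) (by omega) _ hi _ hn1).1 (hf.adj_succ i)
  have h2 := (hB.adj_iff (j + 1) (by omega) _ hi _ hn2).1 (hf.adj_pred i)
  have hne : i + 1 ≠ i - 1 := fun h => hf.two_ne_zero (by linear_combination h)
  rcases h1 with h1 | h1 <;> rcases h2 with h2 | h2
  · exact absurd (hB.eq_of_mem hf hk (j := j) (by omega) h1 h2) hne
  · exact Or.inr ⟨h1, h2⟩
  · exact Or.inl ⟨h1, h2⟩
  · exact absurd (hB.eq_of_mem hf hk (j := j + 2) (by omega) h1 h2) hne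

theorem IsStrip.meets (hB : IsStrip G L B) (hf : IsCycleMap G k f) (hk : 5 ≤ k) (j : ℕ)
    (hj : j + 4 < L) {i : ZMod k} (hi : f i ∈ B (j + 2)) : ∃ i', f i' ∈ B 2 := by
  induction j generalizing i with
  | zero => exact ⟨i, hi⟩
  | succ j ih =>
    rcases hB.neighbours hf hk hj hi with h | h
    · exact ih (by omega) h.2
    · exact ih (by omega) h.1

/-- The cycle meets each of `B 1`, `B 2`, `B 3` exactly once. Cut between `x` and `y`, it is a path
that leaves `y` away from `B 2` and ends on reaching `B 1`. -/
theorem IsStrip.exists_pathSet (hB : IsStrip G L B) (hL : 6 ≤ L) {S : Finset V}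
    (hf : IsCycleMap G k f) (hr : Set.range f = S) (hk : 5 ≤ k) {i : ZMod k} (hi : f i ∈ B 2) :
    ∃ x ∈ B 2, ∃ y ∈ B 3, ∃ P ∈ pathSets G (B 1) (univ \ (B 2 ∪ B 3)) y,
      insert x (insert y P) = S := by
  -- Rotation and, if necessary, reflection bring the cycle into the position `B 1`, `B 2`, `B 3` at
  -- the indices -1, 0, 1.
  obtain ⟨f, hf, hr, hx, hy, hz⟩ : ∃ f : ZMod k → V, IsCycleMap G k f ∧ Set.range f = S ∧
      f 0 ∈ B 2 ∧ f 1 ∈ B 3 ∧ f (-1) ∈ B 1 := by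
    rcases hB.neighbours hf hk (j := 0) (by omega) hi with h | h
    · exact ⟨_, hf.shift i, by rw [range_shift, hr], by simpa using hi, h.1,
        by simpa [sub_eq_add_neg] using h.2⟩
    · refine ⟨_, (hf.shift i).reflect,
        (range_reflect fun j => f (i + j)).trans (by rw [range_shift, hr]), by simpa using hi,
        ?_, by simpa using h.1⟩
      simpa [sub_eq_add_neg] using h.2
  have hcast : ((k - 1 : ℕ) : ZMod k) = -1 := by
    rw [Nat.cast_sub (by omega)]; simp
  have huniq : ∀ j a b : ℕ, j + 2 < L → a < k → b < k → f a ∈ B (j + 1) → f b ∈ B (j + 1) →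
      a = b := fun j a b hj ha hb h1 h2 =>
    (hf.natCast_inj ha hb).1 (congrArg f (hB.eq_of_mem hf hk hj h1 h2))
  have hx' : f ((0 : ℕ) : ZMod k) ∈ B 2 := by simpa using hx
  have hy' : f ((1 : ℕ) : ZMod k) ∈ B 3 := by simpa using hy
  have hz' : f ((k - 1 : ℕ) : ZMod k) ∈ B 1 := by rwa [hcast]
  refine ⟨_, hx', _, hy', (Icc 1 (k - 2)).image fun i => f ((i + 1 : ℕ) : ZMod k), ?_, ?_⟩
  · have := image_mem_pathSets (G := G) (E := B 1) (k - 2)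
      (fun i => f ((i + 1 : ℕ) : ZMod k)) (univ \ (B 2 ∪ B 3)) ?_ ?_ ?_ ?_ ?_
    · exact this
    · intro i h1 h2
      simp only [mem_sdiff, mem_univ, true_and, mem_union, not_or]
      constructor
      · intro h
        have := huniq 1 _ _ (by omega) (by omega) (by omega) hx' h
        omega
      · intro h
        have := huniq 2 _ _ (by omega) (by omega) (by omega) hy' h
        omega
    · intro i hi
      rw [hf.natCast_adj (by omega) (by omega)]; omega
    · intro i j h1 h2
      rw [hf.natCast_adj (by omega) (by omega)]; omega
    · rwa [show k - 2 + 1 = k - 1 by omega]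
    · intro i hi h
      have := huniq 0 _ _ (by omega) (by omega) (by omega) hz' h
      omega
  · ext w
    rw [mem_iff_of_range_eq hf hr]
    simp only [mem_insert, mem_image, mem_Icc]
    constructor
    · rintro (rfl | rfl | ⟨i, hi, rfl⟩)
      · exact ⟨0, by omega, rfl⟩
      · exact ⟨1, by omega, rfl⟩
      · exact ⟨i + 1, by omega, rfl⟩
    · rintro ⟨i, hi, rfl⟩
      by_cases hi0 : i = 0
      · left; rw [hi0]
      by_cases hi1 : i = 1
      · right; left; rw [hi1]
      · exact Or.inr (Or.inr ⟨i - 1, by omega, by congr 2; omega⟩)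

theorem card_filter_card_le_four :
    ((univ : Finset (Finset V)).filter fun S => S.card ≤ 4).card ≤
      5 * (Fintype.card V + 1) ^ 4 := by
  have hsub : (univ : Finset (Finset V)).filter (fun S => S.card ≤ 4) ⊆
      (range 5).biUnion fun i => powersetCard i univ := by
    intro S hS
    rw [mem_filter] at hS
    exact mem_biUnion.2 ⟨S.card, mem_range.2 (by omega), mem_powersetCard.2 ⟨subset_univ _, rfl⟩⟩
  refine (card_le_card hsub).trans (card_biUnion_le.trans ?_)
  refine (sum_le_card_nsmul _ _ ((Fintype.card V + 1) ^ 4) fun i hi => ?_).trans (by simp)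
  rw [mem_range] at hi
  rw [card_powersetCard, card_univ]
  calc (Fintype.card V).choose i ≤ Fintype.card V ^ i := Nat.choose_le_pow _ _
    _ ≤ (Fintype.card V + 1) ^ i := Nat.pow_le_pow_left (by omega) _
    _ ≤ _ := Nat.pow_le_pow_right (by omega) (by omega)

/-- The vertices outside the inner classes of the strip. -/
noncomputable def outside (L : ℕ) (B : ℕ → Finset V) : Finset V :=
  univ \ (range (L - 4)).biUnion fun j => B (j + 2)

theorem IsStrip.card_outside (hB : IsStrip G L B) :
    (outside L B).card + 3 * (L - 4) = Fintype.card V := by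
  have h1 : ((range (L - 4)).biUnion fun j => B (j + 2)).card = 3 * (L - 4) := by
    rw [card_biUnion, sum_congr rfl fun j hj => hB.card_eq (j + 2) (by rw [mem_range] at hj; omega)]
    · simp [mul_comm]
    · intro i hi j hj hij
      rw [mem_coe, mem_range] at hi hj
      exact hB.disjoint _ (by omega) _ (by omega) (by omega)
  rw [outside, ← h1, card_sdiff_add_card_eq_card (subset_univ _), card_univ]

theorem card_biUnion_pathSets_le (hB2 : (B 2).card = 3) (R : Finset V) :
    ((B 2).biUnion fun x => (B 3).biUnion fun y =>
      (pathSets G (B 1) R y).image fun P => insert x (insert y P)).card ≤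
      3 * ∑ y ∈ B 3, pathCount G (B 1) R y := by
  rw [← hB2, ← smul_eq_mul]
  refine card_biUnion_le.trans (sum_le_card_nsmul _ _ _ fun x _ => ?_)
  refine card_biUnion_le.trans (sum_le_sum fun y _ => ?_)
  exact card_image_le.trans (card_pathSets_le _ _ _ _)

/-- The terms account for the cycles of length at most 4, those that avoid the inner classes, and
those that cross. In the last term `x` is free in `B 2`, because the path count does not depend on
it. -/
theorem IsStrip.card_cyclesIn_le (hB : IsStrip G L B) (hL : 6 ≤ L) :
    (cyclesIn G univ).card ≤ 5 * (Fintype.card V + 1) ^ 4 + (cyclesIn G (outside L B)).card +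
      3 * ∑ y ∈ B 3, pathCount G (B 1) (univ \ (B 2 ∪ B 3)) y := by
  have h1 := card_biUnion_pathSets_le (G := G) (hB.card_eq 2 (by omega)) (univ \ (B 2 ∪ B 3))
  have h2 := card_filter_card_le_four (V := V)
  set X := (univ : Finset (Finset V)).filter fun S => S.card ≤ 4 with hX
  set Y := cyclesIn G (outside L B) with hY
  set Z := (B 2).biUnion fun x => (B 3).biUnion fun y =>
    (pathSets G (B 1) (univ \ (B 2 ∪ B 3)) y).image fun P => insert x (insert y P) with hZ
  have hsub : cyclesIn G univ ⊆ X ∪ Y ∪ Z := by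
    intro S hS
    have hS' := (mem_cyclesIn.1 hS).2
    obtain ⟨k, f, hf, hr⟩ := (isInducedCycle_iff G S).1 hS'
    rw [mem_union, mem_union]
    by_cases hk : S.card ≤ 4
    · exact Or.inl (Or.inl (mem_filter.2 ⟨mem_univ _, hk⟩))
    rw [hf.card_eq hr] at hk
    by_cases hout : S ⊆ outside L B
    · exact Or.inl (Or.inr (mem_cyclesIn.2 ⟨hout, hS'⟩))
    · right
      obtain ⟨x, hxS, hx⟩ := not_subset.1 hout
      simp only [outside, mem_sdiff, mem_univ, true_and, mem_biUnion, mem_range, not_not] at hx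
      obtain ⟨j, hj, hxj⟩ := hx
      rw [← mem_coe, ← hr] at hxS
      obtain ⟨i, rfl⟩ := hxS
      obtain ⟨i', hi'⟩ := hB.meets hf (by omega) j (by omega) hxj
      obtain ⟨x, hx, y, hy, P, hP, h⟩ := hB.exists_pathSet hL hf hr (by omega) hi'
      exact mem_biUnion.2 ⟨x, hx, mem_biUnion.2 ⟨y, hy, mem_image.2 ⟨P, hP, h⟩⟩⟩
  have h3 := card_le_card hsub
  have h4 := card_union_le (X ∪ Y) Z
  have h5 := card_union_le X Y
  omega

/-! ### Blow-ups of cycles from layered complements -/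

/-- `G` is a blow-up of a cycle of length `n`, possibly with edges inside the classes. -/
structure IsBlowup (G : SimpleGraph V) (n : ℕ) (lev : V → ZMod n) : Prop where
  surj : Function.Surjective lev
  adj_iff : ∀ x y, lev x ≠ lev y → (G.Adj x y ↔ lev y = lev x + 1 ∨ lev x = lev y + 1)

/-- The classes of a blow-up. -/
noncomputable def fiber {n : ℕ} (lev : V → ZMod n) (i : ZMod n) : Finset V :=
  univ.filter fun x => lev x = i

theorem mem_fiber {n : ℕ} {lev : V → ZMod n} {i : ZMod n} {x : V} :
    x ∈ fiber lev i ↔ lev x = i := by simp [fiber]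

theorem isBlowup_of_nat {m : ℕ} {lev : V → ℕ} (hlt : ∀ x, lev x < m + 1)
    (hne : ∀ i < m + 1, ∃ x, lev x = i)
    (hadj : ∀ x y, lev x < lev y →
      (G.Adj x y ↔ lev y = lev x + 1 ∨ lev x = 0 ∧ lev y = m)) :
    IsBlowup G (m + 1) (fun x => (lev x : ZMod (m + 1))) ∧
      ∏ i : ZMod (m + 1), (fiber (fun x => (lev x : ZMod (m + 1))) i).card =
        ∏ i ∈ range (m + 1), (univ.filter fun x => lev x = i).card := by
  have hcast : ∀ a b : ℕ, a < m + 1 → b < m + 1 → ((a : ZMod (m + 1)) = b ↔ a = b) := by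
    intro a b ha hb
    rw [ZMod.natCast_eq_natCast_iff, Nat.ModEq, Nat.mod_eq_of_lt ha, Nat.mod_eq_of_lt hb]
  have hsucc : ∀ a b : ℕ, a < m + 1 → b < m + 1 →
      ((b : ZMod (m + 1)) = a + 1 ↔ b = a + 1 ∨ b = 0 ∧ a = m) := by
    intro a b ha hb
    rw [← Nat.cast_succ, ZMod.natCast_eq_natCast_iff, Nat.ModEq, Nat.mod_eq_of_lt hb]
    rcases Nat.eq_or_lt_of_le (Nat.succ_le_of_lt ha) with h | h
    · rw [h, Nat.mod_self]; omega
    · rw [Nat.mod_eq_of_lt h]; omega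
  refine ⟨⟨?_, ?_⟩, ?_⟩
  · intro i
    obtain ⟨x, hx⟩ := hne i.val (ZMod.val_lt i)
    exact ⟨x, by simp only [hx]; exact ZMod.natCast_zmod_val i⟩
  · intro x y hxy
    rw [Ne, hcast _ _ (hlt x) (hlt y)] at hxy
    rw [hsucc _ _ (hlt x) (hlt y), hsucc _ _ (hlt y) (hlt x)]
    have hx := hlt x
    have hy := hlt y
    rcases lt_or_gt_of_ne hxy with h | h
    · rw [hadj x y h]; omega
    · rw [G.adj_comm, hadj y x h]; omega
  · rw [← Fin.prod_univ_eq_prod_range (fun i => (univ.filter fun x => lev x = i).card)]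
    refine prod_congr rfl fun i _ => ?_
    congr 1
    ext x
    simp only [mem_fiber, mem_filter, mem_univ, true_and]
    have h1 := hcast (lev x) (ZMod.val (n := m + 1) i) (hlt x) (ZMod.val_lt _)
    rw [ZMod.natCast_zmod_val] at h1
    exact h1

/-- The classes `B 3` and `B 2` become the levels `k` and `k + 1`. Level 0 is the part of the rest
in `B 1`, so `B 2` closes the levels to a cycle. Being on top passes from `y₀` to all of `B 3`,
since its vertices have the same outside neighbours. -/
theorem IsStrip.blowup_of_layered (hB : IsStrip G L B) (hL : 6 ≤ L) {y₀ : V} (hy₀ : y₀ ∈ B 3)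
    {k : ℕ} {lev : V → ℕ} (hlay : IsLayered G (B 1) (univ \ (B 2 ∪ B 3)) k lev)
    (htop : IsTop G (B 1) (univ \ (B 2 ∪ B 3)) k lev y₀) :
    ∃ lev' : V → ZMod (k + 2), IsBlowup G (k + 2) lev' ∧
      ∏ i, (fiber lev' i).card =
        (∏ i ∈ range k, (level (univ \ (B 2 ∪ B 3)) lev i).card) * 9 := by
  set R := univ \ (B 2 ∪ B 3) with hR
  have h23 : ∀ x, x ∈ B 2 → x ∉ B 3 := fun x hx => hB.notMem (by omega) (by omega) (by omega) hx
  have hmem : ∀ x, x ∉ B 2 → x ∉ B 3 → x ∈ R := fun x h2 h3 => by simp [hR, h2, h3]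
  have hRn : ∀ x ∈ R, x ∉ B 2 ∧ x ∉ B 3 := fun x hx => by simpa [hR] using hx
  set l : V → ℕ := fun x => if x ∈ B 2 then k + 1 else if x ∈ B 3 then k else lev x with hl
  have l2 : ∀ x, x ∈ B 2 → l x = k + 1 := fun x hx => by simp [hl, hx]
  have l3 : ∀ x, x ∈ B 3 → l x = k := fun x hx => by
    have : x ∉ B 2 := fun h => h23 x h hx
    simp [hl, hx, this]
  have lR : ∀ x, x ∈ R → l x = lev x := fun x hx => by simp [hl, hRn x hx]
  have hcases : ∀ x, x ∈ B 2 ∨ x ∈ B 3 ∨ x ∈ R := fun x => by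
    by_cases h2 : x ∈ B 2
    · exact Or.inl h2
    · by_cases h3 : x ∈ B 3
      · exact Or.inr (Or.inl h3)
      · exact Or.inr (Or.inr (hmem x h2 h3))
  have hne3 : ∃ x, x ∈ B 2 := card_pos.1 (by rw [hB.card_eq 2 (by omega)]; norm_num)
  obtain ⟨x₂, hx₂⟩ := hne3
  have key := isBlowup_of_nat (G := G) (m := k + 1) (lev := l) ?_ ?_ ?_
  · refine ⟨_, key.1, key.2.trans ?_⟩
    rw [prod_range_succ, prod_range_succ, mul_assoc]
    congr 1
    · refine prod_congr rfl fun i hi => ?_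
      rw [mem_range] at hi
      congr 1
      ext x
      rw [mem_filter, mem_level]
      constructor
      · rintro ⟨-, hx⟩
        rcases hcases x with h | h | h
        · rw [l2 x h] at hx; omega
        · rw [l3 x h] at hx; omega
        · exact ⟨h, by rw [← lR x h, hx]⟩
      · rintro ⟨h, hx⟩
        exact ⟨mem_univ _, by rw [lR x h, hx]⟩
    · have e3 : (univ.filter fun x => l x = k) = B 3 := by
        ext x
        simp only [mem_filter, mem_univ, true_and]
        rcases hcases x with h | h | h
        · simp [l2 x h, h23 x h]
        · simp [l3 x h, h]
        · have := hlay.lt x h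
          simp [lR x h, (hRn x h).2, this.ne]
      have e2 : (univ.filter fun x => l x = k + 1) = B 2 := by
        ext x
        simp only [mem_filter, mem_univ, true_and]
        rcases hcases x with h | h | h
        · simp [l2 x h, h]
        · have : x ∉ B 2 := fun h' => h23 x h' h
          simp [l3 x h, this]
        · have := hlay.lt x h
          simp only [lR x h, (hRn x h).1, iff_false]
          omega
      rw [e2, e3, hB.card_eq 2 (by omega), hB.card_eq 3 (by omega)]
      rfl
  · intro x
    rcases hcases x with h | h | h
    · rw [l2 x h]; omega
    · rw [l3 x h]; omega
    · have := hlay.lt x h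
      rw [lR x h]; omega
  · intro i hi
    by_cases h1 : i = k + 1
    · exact ⟨x₂, by rw [l2 _ hx₂, h1]⟩
    by_cases h2 : i = k
    · exact ⟨y₀, by rw [l3 _ hy₀, h2]⟩
    obtain ⟨x, hx, hxi⟩ := hlay.nonempty i (by omega)
    exact ⟨x, by rw [lR x hx, hxi]⟩
  · intro x y hxy
    rcases hcases y with hy | hy | hy
    · rw [l2 y hy] at hxy ⊢
      have hx2 : x ∉ B 2 := fun h => by rw [l2 x h] at hxy; omega
      have hadj : G.Adj y x ↔ x ∈ B 1 ∨ x ∈ B 3 := hB.adj_iff 1 (by omega) y hy x hx2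
      rw [G.adj_comm, hadj]
      rcases hcases x with hx | hx | hx
      · exact absurd hx hx2
      · simp [l3 x hx, hx]
      · have h1 := hlay.lt x hx
        have h2 := hlay.end_iff x hx
        simp only [lR x hx, (hRn x hx).2, h2, or_false, and_true]
        omega
    · rw [l3 y hy] at hxy ⊢
      have hxR : x ∈ R := by
        rcases hcases x with hx | hx | hx
        · rw [l2 x hx] at hxy; omega
        · rw [l3 x hx] at hxy; omega
        · exact hx
      have hx3 := (hRn x hxR).2
      have h1 := htop.2 x hxR
      have h2 : G.Adj y x ↔ G.Adj y₀ x := by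
        rw [hB.adj_iff 2 (by omega) y hy x hx3, hB.adj_iff 2 (by omega) y₀ hy₀ x hx3]
      rw [G.adj_comm, h2, h1, lR x hxR]
      omega
    · have hylt := hlay.lt y hy
      rw [lR y hy] at hxy ⊢
      have hxR : x ∈ R := by
        rcases hcases x with hx | hx | hx
        · rw [l2 x hx] at hxy; omega
        · rw [l3 x hx] at hxy; omega
        · exact hx
      rw [lR x hxR] at hxy ⊢
      constructor
      · intro h
        left
        by_contra hne
        exact hlay.not_adj x hxR y hy (by omega) h
      · rintro (h | h)
        · exact hlay.adj x hxR y hy h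
        · omega

/-- If one of the three starts in `B 3` falls under the gap, the crossing cycles number at most `3 *
(2 + 31/32)` times `maxProd R.card`, that is 95/96 of `maxProd (Fintype.card V)`. Otherwise the
complement of `B 2 ∪ B 3` is layered. -/
theorem IsStrip.dichotomy (hB : IsStrip G L B) (hL : 6 ≤ L) (hn : 8 ≤ Fintype.card V) :
    (∃ (n : ℕ) (lev : V → ZMod (n + 2)), IsBlowup G (n + 2) lev ∧
      maxProd (Fintype.card V) ≤ ∏ i, (fiber lev i).card) ∨
    96 * (cyclesIn G univ).card ≤ 96 * (5 * (Fintype.card V + 1) ^ 4) +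
      96 * (cyclesIn G (outside L B)).card + 95 * maxProd (Fintype.card V) := by
  set R := univ \ (B 2 ∪ B 3) with hR
  have hcard : R.card + 6 = Fintype.card V := by
    have h1 : (B 2 ∪ B 3).card = 6 := by
      rw [card_union_of_disjoint (hB.disjoint 2 (by omega) 3 (by omega) (by omega)),
        hB.card_eq 2 (by omega), hB.card_eq 3 (by omega)]
    rw [hR, ← h1, card_sdiff_add_card_eq_card (subset_univ _), card_univ]
  have hmax : maxProd (Fintype.card V) = 9 * maxProd R.card := by
    rw [← hcard, show R.card + 6 = R.card + 3 + 3 by ring, maxProd_add_three (by omega),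
      maxProd_add_three (by omega)]
    ring
  by_cases hall : ∀ y ∈ B 3, ¬ 32 * pathCount G (B 1) R y ≤ 31 * maxProd R.card
  · left
    have hne3 : ∃ x, x ∈ B 3 := card_pos.1 (by rw [hB.card_eq 3 (by omega)]; norm_num)
    obtain ⟨y, hy⟩ := hne3
    obtain ⟨⟨k, lev, hlay, htop⟩, hmaxR⟩ :=
      (pathCount_gap G (B 1) R y (by omega)).resolve_right (hall y hy)
    obtain ⟨lev', hlev', hprod⟩ := hB.blowup_of_layered hL hy hlay htop
    refine ⟨k, lev', hlev', ?_⟩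
    rw [hprod, hmax, ← hmaxR]
    have := hlay.pathCount_top_le htop
    rw [mul_comm]
    exact Nat.mul_le_mul_right _ this
  · right
    push Not at hall
    obtain ⟨y, hy, hlt⟩ := hall
    have h1 := hB.card_cyclesIn_le hL
    have h2 : ∑ z ∈ (B 3).erase y, pathCount G (B 1) R z ≤ 2 * maxProd R.card := by
      have : ((B 3).erase y).card = 2 := by
        rw [card_erase_of_mem hy, hB.card_eq 3 (by omega)]
      rw [← this]
      exact sum_le_card_nsmul _ _ _ fun c _ => pathCount_le_maxProd _ _ _ _
    rw [← hR, ← add_sum_erase (B 3) _ hy] at h1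
    rw [hmax]
    omega

end Crossing

end InducedCycles

namespace InducedCycles

open Finset

set_option linter.unusedSectionVars false

/-! ### Upper bound for the cycles of a blow-up -/

section BlowupCount

open scoped Classical

variable {V : Type*} [Fintype V] [DecidableEq V] {G : SimpleGraph V} {n : ℕ} [NeZero n]
  {lev : V → ZMod n}

theorem IsBlowup.isModule (hG : IsBlowup G n lev) (i : ZMod n) :
    IsModule G (fiber lev i : Set V) := by
  intro p hp q hq w hw h
  rw [mem_coe, mem_fiber] at hp hq hw
  have h1 := (hG.adj_iff p w (by rw [hp]; exact Ne.symm hw)).1 h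
  rw [hG.adj_iff q w (by rw [hq]; exact Ne.symm hw), hq]
  rwa [hp] at h1

variable (G lev) in
/-- The pairs of non-adjacent vertices in a class. -/
noncomputable def nonEdges (i : ZMod n) : Finset (Finset V) :=
  (powersetCard 2 (fiber lev i)).filter fun P => ∀ x ∈ P, ∀ y ∈ P, ¬ G.Adj x y

variable (G lev) in
/-- The pairs of adjacent vertices in a class. -/
noncomputable def innerEdges (i : ZMod n) : Finset (Finset V) :=
  (powersetCard 2 (fiber lev i)).filter fun P => ¬ ∀ x ∈ P, ∀ y ∈ P, ¬ G.Adj x y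

theorem card_nonEdges_add (i : ZMod n) :
    (nonEdges G lev i).card + (innerEdges G lev i).card = (fiber lev i).card.choose 2 := by
  rw [nonEdges, innerEdges, card_filter_add_card_filter_not, card_powersetCard]

theorem pair_mem_nonEdges {i : ZMod n} {x y : V} (hx : lev x = i) (hy : lev y = i) (hxy : x ≠ y)
    (h : ¬ G.Adj x y) : {x, y} ∈ nonEdges G lev i := by
  rw [nonEdges, mem_filter, mem_powersetCard]
  refine ⟨⟨?_, card_pair hxy⟩, ?_⟩
  · intro z hz
    rw [mem_insert, mem_singleton] at hz
    rcases hz with rfl | rfl <;> rwa [mem_fiber]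
  · intro a ha b hb
    rw [mem_insert, mem_singleton] at ha hb
    rcases ha with rfl | rfl <;> rcases hb with rfl | rfl
    · exact G.loopless.irrefl _
    · exact h
    · exact fun h' => h h'.symm
    · exact G.loopless.irrefl _

theorem pair_mem_innerEdges {i : ZMod n} {x y : V} (hx : lev x = i) (hy : lev y = i)
    (h : G.Adj x y) : {x, y} ∈ innerEdges G lev i := by
  rw [innerEdges, mem_filter, mem_powersetCard]
  refine ⟨⟨?_, card_pair h.ne⟩, fun hall => hall x (by simp) y (by simp) h⟩
  intro z hz
  rw [mem_insert, mem_singleton] at hz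
  rcases hz with rfl | rfl <;> rwa [mem_fiber]

variable (G lev) in
/-- A family that covers the induced cycles with two vertices in the class of `i`. -/
noncomputable def localSets (i : ZMod n) : Finset (Finset V) :=
  (nonEdges G lev i ×ˢ nonEdges G lev (i + 1)).image (fun p => p.1 ∪ p.2) ∪
  (nonEdges G lev i ×ˢ (fiber lev (i - 1) ×ˢ fiber lev (i + 1))).image
    (fun p => insert p.2.1 (insert p.2.2 p.1)) ∪
  ((innerEdges G lev i ×ˢ (fiber lev (i - 1) ∪ fiber lev (i + 1))).image
    (fun p => insert p.2 p.1) ∪ cyclesIn G (fiber lev i))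

theorem card_cyclesIn_fiber_le (i : ZMod n) :
    (cyclesIn G (fiber lev i)).card ≤
      (fiber lev i).card.choose 3 + (fiber lev i).card.choose 4 ∨ 5 ≤ (fiber lev i).card := by
  by_cases h5 : 5 ≤ (fiber lev i).card
  · exact Or.inr h5
  left
  have hsub : cyclesIn G (fiber lev i) ⊆
      powersetCard 3 (fiber lev i) ∪ powersetCard 4 (fiber lev i) := by
    intro S hS
    obtain ⟨hsub, hcyc⟩ := mem_cyclesIn.1 hS
    obtain ⟨k, f, hf, hr⟩ := (isInducedCycle_iff G S).1 hcyc
    have h1 := hf.card_eq hr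
    have h2 := hf.three_le
    have h3 := card_le_card hsub
    rw [mem_union, mem_powersetCard, mem_powersetCard]
    have : S.card = 3 ∨ S.card = 4 := by omega
    exact this.imp (fun h => ⟨hsub, h⟩) fun h => ⟨hsub, h⟩
  refine (card_le_card hsub).trans ((card_union_le _ _).trans ?_)
  rw [card_powersetCard, card_powersetCard]

theorem two_le_card_innerEdges (i : ZMod n) (h : (cyclesIn G (fiber lev i)).Nonempty) :
    2 ≤ (innerEdges G lev i).card := by
  obtain ⟨S, hS⟩ := h
  obtain ⟨hsub, hcyc⟩ := mem_cyclesIn.1 hS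
  obtain ⟨k, f, hf, hr⟩ := (isInducedCycle_iff G S).1 hcyc
  have hlev : ∀ j, lev (f j) = i := fun j => by
    have : f j ∈ S := by rw [← mem_coe, ← hr]; exact ⟨j, rfl⟩
    exact mem_fiber.1 (hsub this)
  have h0 := pair_mem_innerEdges (hlev 0) (hlev (0 + 1)) (hf.adj_succ 0)
  have h1 := pair_mem_innerEdges (hlev (0 + 1)) (hlev (0 + 1 + 1)) (hf.adj_succ (0 + 1))
  refine one_lt_card.2 ⟨_, h0, _, h1, fun heq => ?_⟩
  have hmem : f 0 ∈ ({f (0 + 1), f (0 + 1 + 1)} : Finset V) := by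
    rw [← heq]; exact mem_insert_self _ _
  rw [mem_insert, mem_singleton, hf.inj.eq_iff, hf.inj.eq_iff] at hmem
  rcases hmem with h | h
  · exact hf.one_ne_zero (by linear_combination -h)
  · exact hf.two_ne_zero (by linear_combination -h)

/-- The right side is the count for independent classes. An edge inside a class costs a non-edge,
and what it gains in triangles, `s0 + s1`, is at most the lost `s0 * s1`. The cycles inside the
class are absorbed by the lost pairs of non-edges. -/
theorem card_localSets_le (hs2 : ∀ i, 2 ≤ (fiber lev i).card) (hs4 : ∀ i, (fiber lev i).card ≤ 4)
    (h43 : ∀ i, (fiber lev i).card = 4 → (fiber lev (i + 1)).card = 3) (i : ZMod n) :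
    (localSets G lev i).card ≤
      (fiber lev i).card.choose 2 * (fiber lev (i + 1)).card.choose 2 +
      (fiber lev i).card.choose 2 * ((fiber lev (i - 1)).card * (fiber lev (i + 1)).card) := by
  have h1 : (localSets G lev i).card ≤
      (nonEdges G lev i).card * (nonEdges G lev (i + 1)).card +
      (nonEdges G lev i).card * ((fiber lev (i - 1)).card * (fiber lev (i + 1)).card) +
      ((innerEdges G lev i).card * ((fiber lev (i - 1)).card + (fiber lev (i + 1)).card) +
      (cyclesIn G (fiber lev i)).card) := by
    unfold localSets
    refine (card_union_le _ _).trans (add_le_add ((card_union_le _ _).trans (add_le_add ?_ ?_))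
      ((card_union_le _ _).trans (Nat.add_le_add_right ?_ _)))
    · exact card_image_le.trans (card_product _ _).le
    · exact card_image_le.trans (by rw [card_product, card_product])
    · refine card_image_le.trans ?_
      rw [card_product]
      exact Nat.mul_le_mul_left _ (card_union_le _ _)
  refine h1.trans ?_
  have e1 := card_nonEdges_add (G := G) (lev := lev) i
  have e2 := card_nonEdges_add (G := G) (lev := lev) (i + 1)
  have e3 := (card_cyclesIn_fiber_le (G := G) (lev := lev) i).resolve_right
    (by have := hs4 i; omega)
  have e4 := two_le_card_innerEdges (G := G) (lev := lev) i
  rw [← card_pos] at e4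
  have a1 := hs2 i
  have a2 := hs4 i
  have a3 := h43 i
  have b1 := hs2 (i + 1)
  have c1 := hs2 (i - 1)
  generalize (nonEdges G lev i).card = x at *
  generalize (nonEdges G lev (i + 1)).card = x' at *
  generalize (innerEdges G lev i).card = e at *
  generalize (innerEdges G lev (i + 1)).card = e' at *
  generalize (cyclesIn G (fiber lev i)).card = w at *
  generalize (fiber lev i).card = s at *
  generalize (fiber lev (i + 1)).card = s1 at *
  generalize (fiber lev (i - 1)).card = s0 at *
  have hss : s0 + s1 ≤ s0 * s1 := by nlinarith
  have hc1 : 1 ≤ s1.choose 2 := Nat.choose_pos b1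
  -- A class of size 3 contains at most one cycle. A class of size 4 contains at most 5; if any
  -- exists there are at least two edges, and the next class has size 3, so `e * 3` is at least 6.
  have hw : w ≤ e * s1.choose 2 := by
    rcases Nat.eq_zero_or_pos w with h0 | hpos
    · omega
    have he := e4 hpos
    have : s = 2 ∨ s = 3 ∨ s = 4 := by omega
    rcases this with rfl | rfl | rfl
    · have : w ≤ 0 := by simpa [Nat.choose] using e3
      omega
    · have : w ≤ 1 := by simpa [Nat.choose] using e3
      nlinarith
    · have h5 : w ≤ 5 := by simpa [Nat.choose] using e3
      rw [a3 rfl, show Nat.choose 3 2 = 3 from rfl]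
      omega
  rw [← e1]
  have hx' : x' ≤ s1.choose 2 := by omega
  have t1 := Nat.mul_le_mul_left x hx'
  have t2 := Nat.mul_le_mul_left e hss
  nlinarith

theorem mem_localSets_of_union {i : ZMod n} {P Q : Finset V} (hP : P ∈ nonEdges G lev i)
    (hQ : Q ∈ nonEdges G lev (i + 1)) : P ∪ Q ∈ localSets G lev i :=
  mem_union_left _ (mem_union_left _ (mem_image.2 ⟨(P, Q), mem_product.2 ⟨hP, hQ⟩, rfl⟩))

theorem IsBlowup.lev_of_adj (hG : IsBlowup G n lev) {x y : V} (h : G.Adj x y)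
    (hne : lev x ≠ lev y) : lev y = lev x + 1 ∨ lev y = lev x - 1 :=
  ((hG.adj_iff x y hne).1 h).imp id fun h => by rw [h]; ring

theorem insert_mem_localSets {i : ZMod n} {P : Finset V} {x : V} (hP : P ∈ innerEdges G lev i)
    (hx : lev x = i + 1 ∨ lev x = i - 1) : insert x P ∈ localSets G lev i := by
  rw [localSets, mem_union, mem_union, mem_union]
  refine Or.inr (Or.inl (mem_image.2 ⟨(P, x), mem_product.2 ⟨hP, ?_⟩, rfl⟩))
  rw [mem_union, mem_fiber, mem_fiber]
  exact hx.symm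

theorem insert_insert_mem_localSets {i : ZMod n} {P : Finset V} {x y : V}
    (hP : P ∈ nonEdges G lev i) (hx : lev x = i - 1) (hy : lev y = i + 1) :
    insert x (insert y P) ∈ localSets G lev i := by
  rw [localSets, mem_union, mem_union, mem_union]
  exact Or.inl (Or.inr (mem_image.2 ⟨(P, x, y), mem_product.2
    ⟨hP, mem_product.2 ⟨mem_fiber.2 hx, mem_fiber.2 hy⟩⟩, rfl⟩))

theorem mem_localSets_of_mem_cyclesIn {i : ZMod n} {S : Finset V}
    (hS : S ∈ cyclesIn G (fiber lev i)) : S ∈ localSets G lev i := by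
  rw [localSets, mem_union, mem_union, mem_union]
  exact Or.inr (Or.inr hS)

theorem IsCycleMap.eq_of_three {f : ZMod 3 → V} {S : Finset V}
    (hr : Set.range f = S) : S = {f 1, f 0, f 2} := by
  rw [← coe_inj, ← hr]
  ext x
  simp only [Set.mem_range, coe_insert, coe_singleton, Set.mem_insert_iff,
    Set.mem_singleton_iff]
  constructor
  · rintro ⟨j, rfl⟩
    fin_cases j
    · exact Or.inr (Or.inl rfl)
    · exact Or.inl rfl
    · exact Or.inr (Or.inr rfl)
  · rintro (rfl | rfl | rfl) <;> exact ⟨_, rfl⟩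

theorem IsCycleMap.mem_of_four {f : ZMod 4 → V} {S : Finset V}
    (hr : Set.range f = S) (x : V) : x ∈ S ↔ x = f 0 ∨ x = f 1 ∨ x = f 2 ∨ x = f 3 := by
  rw [← mem_coe, ← hr, Set.mem_range]
  constructor
  · rintro ⟨j, rfl⟩
    fin_cases j
    · exact Or.inl rfl
    · exact Or.inr (Or.inl rfl)
    · exact Or.inr (Or.inr (Or.inl rfl))
    · exact Or.inr (Or.inr (Or.inr rfl))
  · rintro (rfl | rfl | rfl | rfl) <;> exact ⟨_, rfl⟩

/-- The other two vertices lie in the same adjacent class, giving a union of two non-edges, or in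
different ones, giving a non-edge with one vertex on either side. -/
theorem IsBlowup.mem_localSets_of_four (hG : IsBlowup G n lev) {f : ZMod 4 → V}
    (hf : IsCycleMap G 4 f) {S : Finset V} (hr : Set.range f = S) {i : ZMod n}
    (hj : lev (f 0) = i) (hj2 : lev (f 2) = i) (hlev1 : lev (f 1) = i + 1 ∨ lev (f 1) = i - 1)
    (hj3 : lev (f 3) ≠ i) : ∃ i, S ∈ localSets G lev i := by
  have h02 : ({f 0, f 2} : Finset V) ∈ nonEdges G lev i :=
    pair_mem_nonEdges hj hj2 (fun h => absurd (hf.inj h) (by decide))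
      (fun h => absurd ((hf.adj_iff _ _).1 h) (by decide))
  have hne13 : f 1 ≠ f 3 := fun h => absurd (hf.inj h) (by decide)
  have hadj13 : ¬ G.Adj (f 1) (f 3) := fun h => absurd ((hf.adj_iff _ _).1 h) (by decide)
  have hlev3 : lev (f 3) = i + 1 ∨ lev (f 3) = i - 1 := by
    have := hG.lev_of_adj (x := f 0) (y := f 3) ((hf.adj_iff _ _).2 (by decide))
      (by rw [hj]; exact hj3.symm)
    rwa [hj] at this
  have hSeq := IsCycleMap.mem_of_four hr
  have e1 : S = {f 0, f 2} ∪ {f 1, f 3} := by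
    ext x
    rw [hSeq]
    simp only [mem_union, mem_insert, mem_singleton]
    tauto
  have e2 : S = insert (f 1) (insert (f 3) {f 0, f 2}) := by
    ext x
    rw [hSeq]
    simp only [mem_insert, mem_singleton]
    tauto
  have e3 : S = insert (f 3) (insert (f 1) {f 0, f 2}) := by
    rw [e2, Finset.insert_comm]
  by_cases h13 : lev (f 1) = lev (f 3)
  · rcases hlev1 with h1 | h1
    · exact ⟨i, e1 ▸ mem_localSets_of_union h02
        (pair_mem_nonEdges h1 (h13 ▸ h1) hne13 hadj13)⟩
    · refine ⟨i - 1, ?_⟩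
      rw [e1, union_comm]
      exact mem_localSets_of_union (pair_mem_nonEdges h1 (h13 ▸ h1) hne13 hadj13)
        (by rwa [sub_add_cancel])
  · refine ⟨i, ?_⟩
    rcases hlev1 with h1 | h1 <;> rcases hlev3 with h3 | h3
    · exact absurd (h1.trans h3.symm) h13
    · rw [e3]
      exact insert_insert_mem_localSets h02 h3 h1
    · rw [e2]
      exact insert_insert_mem_localSets h02 h1 h3
    · exact absurd (h1.trans h3.symm) h13

theorem IsBlowup.exists_mem_localSets (hG : IsBlowup G n lev) {k : ℕ} {f : ZMod k → V}
    (hf : IsCycleMap G k f) {S : Finset V} (hr : Set.range f = S)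
    (hni : ¬ Function.Injective fun j => lev (f j)) : ∃ i, S ∈ localSets G lev i := by
  have hcyc : G.IsInducedCycle (S : Set V) := (isInducedCycle_iff G S).2 ⟨k, f, hf, hr⟩
  simp only [Function.Injective] at hni
  push Not at hni
  obtain ⟨a, b, hab, hne⟩ := hni
  obtain ⟨i, hi⟩ : ∃ i, lev (f a) = i := ⟨_, rfl⟩
  by_cases hall : ∀ c, f c ∈ fiber lev i
  · refine ⟨i, mem_localSets_of_mem_cyclesIn (mem_cyclesIn.2 ⟨fun x hx => ?_, hcyc⟩)⟩
    rw [← mem_coe, ← hr] at hx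
    obtain ⟨j, rfl⟩ := hx
    exact hall j
  push Not at hall
  obtain ⟨c, hc⟩ := hall
  obtain ⟨j, hj, hj1, hj2, -, hk⟩ := hf.of_module (hG.isModule i) (a := a) (b := b) (c := c)
    (by rwa [mem_coe, mem_fiber]) (by rw [mem_coe, mem_fiber]; exact hab.symm.trans hi) hne hc
  rw [mem_coe, mem_fiber] at hj hj1 hj2
  obtain ⟨f, hf, hr, hj, hj1, hj2, hk⟩ : ∃ f : ZMod k → V, IsCycleMap G k f ∧
      Set.range f = S ∧ lev (f 0) = i ∧ lev (f 1) ≠ i ∧ lev (f 2) = i ∧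
      (k = 3 ∨ k = 4 ∧ lev (f 3) ≠ i) :=
    ⟨_, hf.shift j, by rw [range_shift, hr], by rwa [add_zero], hj1, hj2,
      hk.imp id fun h => ⟨h.1, fun h' => h.2 (mem_fiber.2 h')⟩⟩
  have hlev1 : lev (f 1) = i + 1 ∨ lev (f 1) = i - 1 := by
    have := hG.lev_of_adj (x := f 0) (y := f 1) (by simpa using hf.adj_succ 0)
      (by rw [hj]; exact hj1.symm)
    rwa [hj] at this
  rcases hk with rfl | ⟨rfl, hj3⟩
  · refine ⟨i, ?_⟩
    rw [IsCycleMap.eq_of_three hr]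
    exact insert_mem_localSets
      (pair_mem_innerEdges hj hj2 ((hf.adj_iff _ _).2 (by decide))) hlev1
  · exact hG.mem_localSets_of_four hf hr hj hj2 hlev1 hj3

/-- The two neighbours of a vertex on the cycle lie in different adjacent classes, so one of them is
one level higher. Hence every class is reached, and by injectivity only once. -/
theorem IsBlowup.exists_section (hG : IsBlowup G n lev) {k : ℕ} {f : ZMod k → V}
    (hf : IsCycleMap G k f) {S : Finset V} (hr : Set.range f = S)
    (hinj : Function.Injective fun j => lev (f j)) :
    ∃ c ∈ Fintype.piFinset (fiber lev), univ.image c = S := by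
  have hstep : ∀ j, ∃ j', lev (f j') = lev (f j) + 1 := by
    intro j
    have hne : ∀ j', j' ≠ j → lev (f j) ≠ lev (f j') := fun j' h h' => h (hinj h').symm
    rcases hG.lev_of_adj (hf.adj_succ j) (hne _ fun h => hf.one_ne_zero
      (by linear_combination h)) with h1 | h1
    · exact ⟨_, h1⟩
    rcases hG.lev_of_adj (hf.adj_pred j) (hne _ fun h => hf.one_ne_zero
      (by linear_combination -h)) with h2 | h2
    · exact ⟨_, h2⟩
    exact absurd (hinj (h1.trans h2.symm)) fun h => hf.two_ne_zero (by linear_combination h)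
  have hsurj : ∀ i : ZMod n, ∃ j, lev (f j) = i := by
    have : ∀ m : ℕ, ∃ j, lev (f j) = lev (f 0) + m := by
      intro m
      induction m with
      | zero => exact ⟨0, by simp⟩
      | succ m ih =>
        obtain ⟨j, hj⟩ := ih
        obtain ⟨j', hj'⟩ := hstep j
        exact ⟨j', by rw [hj', hj]; push_cast; ring⟩
    intro i
    obtain ⟨j, hj⟩ := this (i - lev (f 0)).val
    exact ⟨j, by rw [hj, ZMod.natCast_zmod_val]; ring⟩
  choose c hc using hsurj
  refine ⟨fun i => f (c i), Fintype.mem_piFinset.2 fun i => mem_fiber.2 (hc i), ?_⟩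
  rw [← coe_inj, ← hr]
  ext x
  simp only [coe_image, coe_univ, Set.image_univ, Set.mem_range]
  constructor
  · rintro ⟨i, rfl⟩
    exact ⟨_, rfl⟩
  · rintro ⟨j, rfl⟩
    exact ⟨lev (f j), congrArg f (hinj (hc _))⟩

theorem IsBlowup.card_cyclesIn_le (hG : IsBlowup G n lev) (hs2 : ∀ i, 2 ≤ (fiber lev i).card)
    (hs4 : ∀ i, (fiber lev i).card ≤ 4)
    (h43 : ∀ i, (fiber lev i).card = 4 → (fiber lev (i + 1)).card = 3) :
    (cyclesIn G univ).card ≤ ∏ i, (fiber lev i).card +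
      ∑ i, ((fiber lev i).card.choose 2 * (fiber lev (i + 1)).card.choose 2 +
      (fiber lev i).card.choose 2 * ((fiber lev (i - 1)).card * (fiber lev (i + 1)).card)) := by
  have hsub : cyclesIn G univ ⊆
      (Fintype.piFinset (fiber lev)).image (fun c => univ.image c) ∪
        univ.biUnion (localSets G lev) := by
    intro S hS
    obtain ⟨k, f, hf, hr⟩ := (isInducedCycle_iff G S).1 (mem_cyclesIn.1 hS).2
    rw [mem_union]
    by_cases hinj : Function.Injective fun j => lev (f j)
    · left
      obtain ⟨c, hc, h⟩ := hG.exists_section hf hr hinj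
      exact mem_image.2 ⟨c, hc, h⟩
    · right
      obtain ⟨i, hi⟩ := hG.exists_mem_localSets hf hr hinj
      exact mem_biUnion.2 ⟨i, mem_univ _, hi⟩
  refine (card_le_card hsub).trans ((card_union_le _ _).trans (add_le_add ?_ ?_))
  · exact card_image_le.trans (Fintype.card_piFinset _).le
  · exact card_biUnion_le.trans (sum_le_sum fun i _ => card_localSets_le hs2 hs4 h43 i)

end BlowupCount

/-! ### Evaluation of the local count -/

section Evaluation

variable {n : ℕ} [NeZero n] (s : ZMod n → ℕ)

/-- The number of induced cycles of length four in a blow-up with independent classes. -/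
def localCount : ℕ := ∑ i, ((s i).choose 2 * (s (i + 1)).choose 2 +
  (s i).choose 2 * (s (i - 1) * s (i + 1)))

theorem zmod_ne_of_lt {a : ℕ} (h0 : 0 < a) (ha : a < n) (i : ZMod n) : i + a ≠ i := fun h =>
  natCast_ne_zero_of_lt h0 ha (by linear_combination h)

theorem localCount_of_three (h : ∀ i, s i = 3) : localCount s = 36 * n ∧ ∑ i, s i = 3 * n := by
  simp [localCount, h, ZMod.card, mul_comm]

/-- Enlarging one class from 3 to 4 changes only the summands at `i₀`, `i₀ - 1` and `i₀ + 1`, by 36,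
18 and 9. -/
theorem localCount_of_four (hn : 4 ≤ n) {i₀ : ZMod n} (h4 : s i₀ = 4)
    (h : ∀ i, i ≠ i₀ → s i = 3) : localCount s = 36 * n + 63 ∧ ∑ i, s i = 3 * n + 1 := by
  have hs : ∀ i, s i = 3 + if i = i₀ then 1 else 0 := fun i => by
    split_ifs with hi
    · rw [hi, h4]
    · rw [h i hi]
  constructor
  · have : ∀ i, (s i).choose 2 * (s (i + 1)).choose 2 +
        (s i).choose 2 * (s (i - 1) * s (i + 1)) = 36 + (if i = i₀ then 36 else 0) +
          (if i = i₀ - 1 then 18 else 0) + (if i = i₀ + 1 then 9 else 0) := by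
      intro i
      have n1 : i₀ + 1 ≠ i₀ := by
        exact_mod_cast zmod_ne_of_lt (a := 1) (by norm_num) (by omega) i₀
      have n2 : i₀ + 2 ≠ i₀ := by
        exact_mod_cast zmod_ne_of_lt (a := 2) (by norm_num) (by omega) i₀
      by_cases h0 : i = i₀
      · subst h0
        rw [h (i + 1) n1, h (i - 1) fun h' => n1 (by linear_combination -h'), h4,
          if_pos rfl, if_neg fun h' => n1 (by linear_combination h'),
          if_neg fun h' => n1 (by linear_combination -h')]
        rfl
      by_cases h1 : i = i₀ - 1
      · subst h1
        rw [sub_add_cancel, h4, h _ h0, h (i₀ - 1 - 1) fun h' => n2 (by linear_combination -h'),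
          if_neg h0, if_pos rfl, if_neg fun h' => n2 (by linear_combination -h')]
        rfl
      by_cases h2 : i = i₀ + 1
      · subst h2
        rw [add_sub_cancel_right, h4, h _ h0, h (i₀ + 1 + 1) fun h' => n2 (by linear_combination h'),
          if_neg h0, if_neg h1, if_pos rfl]
        rfl
      · rw [h _ h0, h (i + 1) fun h' => h1 (by linear_combination h'),
          h (i - 1) fun h' => h2 (by linear_combination h'), if_neg h0, if_neg h1, if_neg h2]
        rfl
    rw [localCount, sum_congr rfl fun i _ => this i]
    simp [sum_add_distrib, ZMod.card, mul_comm]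
  · rw [sum_congr rfl fun i _ => hs i]
    simp [sum_add_distrib, ZMod.card, mul_comm]

/-- Reducing one class from 3 to 2 lowers the summands at `i₀`, `i₀ - 1` and `i₀ + 1` by 24, 15 and
9. -/
theorem localCount_of_two (hn : 4 ≤ n) {i₀ : ZMod n} (h2 : s i₀ = 2)
    (h : ∀ i, i ≠ i₀ → s i = 3) :
    localCount s + 48 = 36 * n ∧ ∑ i, s i + 1 = 3 * n := by
  have hs : ∀ i, s i + (if i = i₀ then 1 else 0) = 3 := fun i => by
    split_ifs with hi
    · rw [hi, h2]
    · rw [h i hi]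
  constructor
  · have : ∀ i, ((s i).choose 2 * (s (i + 1)).choose 2 +
        (s i).choose 2 * (s (i - 1) * s (i + 1))) + ((if i = i₀ then 24 else 0) +
          (if i = i₀ - 1 then 15 else 0) + (if i = i₀ + 1 then 9 else 0)) = 36 := by
      intro i
      have n1 : i₀ + 1 ≠ i₀ := by
        exact_mod_cast zmod_ne_of_lt (a := 1) (by norm_num) (by omega) i₀
      have n2 : i₀ + 2 ≠ i₀ := by
        exact_mod_cast zmod_ne_of_lt (a := 2) (by norm_num) (by omega) i₀
      by_cases h0 : i = i₀
      · subst h0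
        rw [h (i + 1) n1, h (i - 1) fun h' => n1 (by linear_combination -h'), h2,
          if_pos rfl, if_neg fun h' => n1 (by linear_combination h'),
          if_neg fun h' => n1 (by linear_combination -h')]
        rfl
      by_cases h1 : i = i₀ - 1
      · subst h1
        rw [sub_add_cancel, h2, h _ h0, h (i₀ - 1 - 1) fun h' => n2 (by linear_combination -h'),
          if_neg h0, if_pos rfl, if_neg fun h' => n2 (by linear_combination -h')]
        rfl
      by_cases h3 : i = i₀ + 1
      · subst h3
        rw [add_sub_cancel_right, h2, h _ h0, h (i₀ + 1 + 1) fun h' => n2 (by linear_combination h'),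
          if_neg h0, if_neg h1, if_pos rfl]
        rfl
      · rw [h _ h0, h (i + 1) fun h' => h1 (by linear_combination h'),
          h (i - 1) fun h' => h3 (by linear_combination h'), if_neg h0, if_neg h1, if_neg h3]
        rfl
    have hsum := sum_congr rfl fun i (_ : i ∈ (univ : Finset (ZMod n))) => this i
    rw [sum_add_distrib] at hsum
    simp only [sum_add_distrib, sum_ite_eq', mem_univ, if_true, sum_const, card_univ, ZMod.card,
      smul_eq_mul] at hsum
    rw [localCount, sum_add_distrib]
    omega
  · have hsum := sum_congr rfl fun i (_ : i ∈ (univ : Finset (ZMod n))) => hs i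
    rw [sum_add_distrib] at hsum
    simp only [sum_ite_eq', mem_univ, if_true, sum_const, card_univ, ZMod.card, smul_eq_mul] at hsum
    omega

theorem localCount_le (h : ∀ i, s i ≤ 3) : localCount s ≤ 36 * n := by
  have : ∀ i ∈ univ, (s i).choose 2 * (s (i + 1)).choose 2 +
      (s i).choose 2 * (s (i - 1) * s (i + 1)) ≤ 36 := by
    intro i _
    have c : ∀ i, (s i).choose 2 ≤ 3 := fun i => Nat.choose_le_choose 2 (h i)
    calc _ ≤ 3 * 3 + 3 * (3 * 3) := by
          gcongr <;> first | exact c _ | exact h _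
      _ = 36 := rfl
  refine (sum_le_card_nsmul _ _ _ this).trans ?_
  simp [ZMod.card, mul_comm]

/-- The number of induced cycles that do not wind around the extremal graph. -/
def localBound (n : ℕ) : ℕ :=
  if n % 3 = 0 then 12 * n else if n % 3 = 1 then 12 * n + 51 else 12 * n - 36

/-- Maximal products have all sizes 3 except for a single 4, a single 2, or two 2s. -/
theorem localCount_le_localBound (hn : 4 ≤ n) (hs : ∀ i, 1 ≤ s i)
    (h : maxProd (∑ i, s i) ≤ ∏ i, s i) :
    localCount s ≤ localBound (∑ i, s i) ∧ (∀ i, 2 ≤ s i) ∧ (∀ i, s i ≤ 4) ∧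
      ∀ i, s i = 4 → s (i + 1) = 3 := by
  have hs' : ∀ i ∈ univ, 1 ≤ s i := fun i _ => hs i
  have hsum : n ≤ ∑ i, s i := by
    have := sum_le_sum hs'
    simpa [ZMod.card] using this
  have h2 : ∀ i, 2 ≤ s i := fun i => two_le_size hs' h (by omega) (mem_univ i)
  have h4 : ∀ i, s i ≤ 4 := fun i => size_le_four hs' h (mem_univ i)
  have h43 : ∀ i j, i ≠ j → s i = 4 → s j = 3 := fun i j hij hi =>
    not_four_of_ne_three hs' h (mem_univ i) (mem_univ j) hij hi
  refine ⟨?_, h2, h4, fun i hi => h43 i _ ?_ hi⟩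
  swap
  · exact_mod_cast (zmod_ne_of_lt (a := 1) (by norm_num) (by omega) i).symm
  by_cases hfour : ∃ i, s i = 4
  · obtain ⟨i, hi⟩ := hfour
    obtain ⟨e1, e2⟩ := localCount_of_four s hn hi fun j hj => h43 i j (Ne.symm hj) hi
    rw [e1, e2, localBound, if_neg (by omega), if_pos (by omega)]
    omega
  push Not at hfour
  have h3 : ∀ i, s i ≤ 3 := fun i => by have := h4 i; have := hfour i; omega
  by_cases htwo : ∃ i, s i = 2
  · obtain ⟨i, hi⟩ := htwo
    by_cases htwo' : ∃ j, j ≠ i ∧ s j = 2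
    · obtain ⟨j, hji, hj⟩ := htwo'
      have hrest : ∀ l, s l + ((if l = i then 1 else 0) + (if l = j then 1 else 0)) = 3 := by
        intro l
        by_cases hli : l = i
        · rw [hli, if_pos rfl, if_neg hji.symm, hi]
        by_cases hlj : l = j
        · rw [hlj, if_neg hji, if_pos rfl, hj]
        have := eq_of_three_twos hs' h (mem_univ i) (mem_univ j) (mem_univ l) hji.symm
          (Ne.symm hli) (Ne.symm hlj) hi hj
        rw [if_neg hli, if_neg hlj]
        have := h2 l
        have := h3 l
        omega
      have hsum := sum_congr rfl fun i (_ : i ∈ (univ : Finset (ZMod n))) => hrest i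
      rw [sum_add_distrib] at hsum
      simp only [sum_add_distrib, sum_ite_eq', mem_univ, if_true, sum_const, card_univ, ZMod.card,
        smul_eq_mul] at hsum
      -- With total `N = 3 * n - 2` the crude bound `36 * n = 12 * N + 24` suffices, as a single
      -- class of size 4 yields `12 * N + 51` in the same residue class.
      have := localCount_le s h3
      rw [localBound, if_neg (by omega), if_pos (by omega)]
      omega
    · push Not at htwo'
      obtain ⟨e1, e2⟩ := localCount_of_two s hn hi fun j hj => by
        have := htwo' j hj
        have := h2 j
        have := h3 j
        omega
      rw [localBound, if_neg (by omega), if_neg (by omega)]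
      omega
  · push Not at htwo
    obtain ⟨e1, e2⟩ := localCount_of_three s fun i => by
      have := htwo i
      have := h2 i
      have := h3 i
      omega
    rw [e1, e2, localBound, if_pos (by omega)]
    omega

end Evaluation

/-! ### The bound for blow-ups with maximal product -/

section BlowupBound

open scoped Classical

variable {V : Type*} [Fintype V] [DecidableEq V] {G : SimpleGraph V} {n : ℕ} [NeZero n]
  {lev : V → ZMod n}

theorem sum_card_fiber (lev : V → ZMod n) : ∑ i, (fiber lev i).card = Fintype.card V := by
  rw [← card_univ]
  exact (card_eq_sum_card_fiberwise fun x _ => mem_univ (lev x)).symm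

theorem IsBlowup.card_le (hG : IsBlowup G n lev)
    (hmax : maxProd (Fintype.card V) ≤ ∏ i, (fiber lev i).card) (hV : 13 ≤ Fintype.card V) :
    (cyclesIn G univ).card ≤ maxProd (Fintype.card V) + localBound (Fintype.card V) := by
  have hs : ∀ i, 1 ≤ (fiber lev i).card := fun i => by
    obtain ⟨x, hx⟩ := hG.surj i
    exact card_pos.2 ⟨x, mem_fiber.2 hx⟩
  have hsum := sum_card_fiber lev
  have hmax' : maxProd (∑ i, (fiber lev i).card) ≤ ∏ i, (fiber lev i).card := by rwa [hsum]
  -- Classes have at most four vertices, so 13 vertices need at least four classes.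
  have hn : 4 ≤ n := by
    by_contra! hlt
    have : ∑ i, (fiber lev i).card ≤ n * 4 := by
      have := sum_le_card_nsmul univ (fun i => (fiber lev i).card) 4
        fun i _ => size_le_four (fun i _ => hs i) hmax' (mem_univ i)
      simpa [ZMod.card] using this
    omega
  obtain ⟨h1, h2, h3, h4⟩ := localCount_le_localBound (fun i => (fiber lev i).card) hn hs hmax'
  have h5 := hG.card_cyclesIn_le h2 h3 h4
  have h6 := prod_le_maxProd_sum univ (fun i => (fiber lev i).card) fun i _ => hs i
  beta_reduce at h6
  rw [hsum] at h6
  replace h1 : localCount (fun i => (fiber lev i).card) ≤ localBound (Fintype.card V) := by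
    have := h1
    beta_reduce at this
    rwa [hsum] at this
  exact h5.trans (add_le_add h6 h1)

end BlowupBound

end InducedCycles

namespace InducedCycles

open Finset

set_option linter.unusedSectionVars false

/-! ### Induced four-cycles -/

section FourCycles

variable {V : Type*} {G : SimpleGraph V}

theorem isCycleMap_four {a b c d : V} (hab : G.Adj a b) (hbc : G.Adj b c) (hcd : G.Adj c d)
    (hda : G.Adj d a) (hac : ¬ G.Adj a c) (hbd : ¬ G.Adj b d) (hac' : a ≠ c) (hbd' : b ≠ d) :
    IsCycleMap G 4 (![a, b, c, d] : Fin 4 → V) where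
  three_le := by norm_num
  inj := by
    change Function.Injective (![a, b, c, d] : Fin 4 → V)
    intro i j h
    fin_cases i <;> fin_cases j <;>
      simp [hab.ne, hab.ne', hbc.ne, hbc.ne', hcd.ne, hcd.ne', hda.ne, hda.ne', hac', hac'.symm,
        hbd', hbd'.symm] at h ⊢
  adj_iff := by
    have h0 : ∀ x : V, ¬ G.Adj x x := fun x => G.loopless.irrefl x
    have key : ∀ i j : Fin 4, G.Adj (![a, b, c, d] i) (![a, b, c, d] j) ↔
        j = i + 1 ∨ i = j + 1 := by
      simp only [Fin.forall_fin_succ]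
      refine ⟨⟨?_, ?_, ?_, ?_, ?_⟩, ⟨?_, ?_, ?_, ?_, ?_⟩, ⟨?_, ?_, ?_, ?_, ?_⟩,
        ⟨?_, ?_, ?_, ?_, ?_⟩, ?_⟩ <;>
      first
      | exact fun i => i.elim0
      | exact iff_of_true hab (by decide)
      | exact iff_of_true hab.symm (by decide)
      | exact iff_of_true hbc (by decide)
      | exact iff_of_true hbc.symm (by decide)
      | exact iff_of_true hcd (by decide)
      | exact iff_of_true hcd.symm (by decide)
      | exact iff_of_true hda (by decide)
      | exact iff_of_true hda.symm (by decide)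
      | exact iff_of_false (h0 _) (by decide)
      | exact iff_of_false hac (by decide)
      | exact iff_of_false hbd (by decide)
      | exact iff_of_false (fun h => hac h.symm) (by decide)
      | exact iff_of_false (fun h => hbd h.symm) (by decide)
    exact key

end FourCycles

/-! ### Lower bound for blow-ups with independent classes -/

section LowerBound

open scoped Classical

variable {V : Type*} [Fintype V] [DecidableEq V] {G : SimpleGraph V} {n : ℕ} [NeZero n]
  {lev : V → ZMod n}

theorem mem_cyclesIn_of_four {a b c d : V} (hab : G.Adj a b) (hbc : G.Adj b c) (hcd : G.Adj c d)
    (hda : G.Adj d a) (hac : ¬ G.Adj a c) (hbd : ¬ G.Adj b d) (hac' : a ≠ c) (hbd' : b ≠ d) :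
    ({a, b, c, d} : Finset V) ∈ cyclesIn G univ := by
  refine mem_cyclesIn.2 ⟨subset_univ _, (isInducedCycle_iff G _).2
    ⟨4, _, isCycleMap_four hab hbc hcd hda hac hbd hac' hbd', ?_⟩⟩
  change Set.range (![a, b, c, d] : Fin 4 → V) = _
  ext x
  simp only [Set.mem_range, Fin.exists_fin_succ, coe_insert, coe_singleton, Set.mem_insert_iff,
    Set.mem_singleton_iff]
  constructor
  · rintro (rfl | rfl | rfl | rfl | ⟨i, -⟩)
    · exact Or.inl rfl
    · exact Or.inr (Or.inl rfl)
    · exact Or.inr (Or.inr (Or.inl rfl))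
    · exact Or.inr (Or.inr (Or.inr rfl))
    · exact i.elim0
  · rintro (rfl | rfl | rfl | rfl)
    · exact Or.inl rfl
    · exact Or.inr (Or.inl rfl)
    · exact Or.inr (Or.inr (Or.inl rfl))
    · exact Or.inr (Or.inr (Or.inr (Or.inl rfl)))

/-- The classes that a set meets in at least two vertices. -/
noncomputable def heavyClasses (lev : V → ZMod n) (S : Finset V) : Finset (ZMod n) :=
  univ.filter fun j => 2 ≤ (S.filter fun x => lev x = j).card

theorem filter_eq_self_of_subset_fiber {P : Finset V} {i : ZMod n} (hP : P ⊆ fiber lev i) :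
    P.filter (fun x => lev x = i) = P :=
  filter_true_of_mem fun _ hx => mem_fiber.1 (hP hx)

theorem filter_eq_empty_of_subset_fiber {P : Finset V} {i j : ZMod n} (hP : P ⊆ fiber lev i)
    (hij : i ≠ j) : P.filter (fun x => lev x = j) = ∅ :=
  filter_false_of_mem fun _ hx h => hij ((mem_fiber.1 (hP hx)).symm.trans h)

/-- The transversals of the classes. -/
noncomputable def transversals (lev : V → ZMod n) : Finset (Finset V) :=
  (Fintype.piFinset (fiber lev)).image fun c => univ.image c

/-- The unions of a pair in the class of `i` and a pair in the next class. -/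
noncomputable def pairPairs (lev : V → ZMod n) (i : ZMod n) : Finset (Finset V) :=
  (powersetCard 2 (fiber lev i) ×ˢ powersetCard 2 (fiber lev (i + 1))).image fun p => p.1 ∪ p.2

/-- The unions of a pair in the class of `i` and a vertex in each of the two adjacent classes. -/
noncomputable def pairEnds (lev : V → ZMod n) (i : ZMod n) : Finset (Finset V) :=
  (powersetCard 2 (fiber lev i) ×ˢ (fiber lev (i - 1) ×ˢ fiber lev (i + 1))).image
    fun p => p.1 ∪ ({p.2.1} ∪ {p.2.2})

theorem filter_image_section {c : ZMod n → V} (hc : c ∈ Fintype.piFinset (fiber lev))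
    (j : ZMod n) : (univ.image c).filter (fun x => lev x = j) = {c j} := by
  have hc' : ∀ i, lev (c i) = i := fun i => mem_fiber.1 (Fintype.mem_piFinset.1 hc i)
  ext x
  simp only [mem_filter, mem_image, mem_univ, true_and, mem_singleton]
  constructor
  · rintro ⟨⟨i, rfl⟩, h⟩
    rw [hc'] at h
    rw [h]
  · rintro rfl
    exact ⟨⟨j, rfl⟩, hc' j⟩

theorem card_transversals : (transversals lev).card = ∏ i, (fiber lev i).card := by
  rw [transversals, card_image_of_injOn, Fintype.card_piFinset]
  intro c hc c' hc' h
  funext j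
  have h1 := filter_image_section (mem_coe.1 hc) j
  have h2 := filter_image_section (mem_coe.1 hc') j
  beta_reduce at h
  rw [h, h2] at h1
  exact (singleton_injective h1).symm

theorem card_pairPairs (h1 : (1 : ZMod n) ≠ 0) (i : ZMod n) : (pairPairs lev i).card =
    (fiber lev i).card.choose 2 * (fiber lev (i + 1)).card.choose 2 := by
  rw [pairPairs, card_image_of_injOn, card_product, card_powersetCard, card_powersetCard]
  have hne : i ≠ i + 1 := fun h => h1 (by linear_combination -h)
  have key : ∀ p ∈ powersetCard 2 (fiber lev i) ×ˢ powersetCard 2 (fiber lev (i + 1)),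
      (p.1 ∪ p.2).filter (fun x => lev x = i) = p.1 ∧
      (p.1 ∪ p.2).filter (fun x => lev x = i + 1) = p.2 := by
    intro p hp
    obtain ⟨hp1, hp2⟩ := mem_product.1 hp
    have s1 := (mem_powersetCard.1 hp1).1
    have s2 := (mem_powersetCard.1 hp2).1
    rw [filter_union, filter_union, filter_eq_self_of_subset_fiber s1,
      filter_eq_self_of_subset_fiber s2, filter_eq_empty_of_subset_fiber s1 hne,
      filter_eq_empty_of_subset_fiber s2 hne.symm, union_empty, empty_union]
    exact ⟨rfl, rfl⟩
  intro p hp q hq h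
  beta_reduce at h
  have kp := key p (mem_coe.1 hp)
  rw [h, (key q (mem_coe.1 hq)).1, (key q (mem_coe.1 hq)).2] at kp
  exact Prod.ext kp.1.symm kp.2.symm

theorem filter_pairEnds (h1 : (1 : ZMod n) ≠ 0) (h2 : (2 : ZMod n) ≠ 0) {i : ZMod n}
    {P : Finset V} {x y : V} (hP : P ⊆ fiber lev i) (hx : lev x = i - 1) (hy : lev y = i + 1) :
    (P ∪ ({x} ∪ {y})).filter (fun z => lev z = i) = P ∧
    (P ∪ ({x} ∪ {y})).filter (fun z => lev z = i - 1) = {x} ∧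
    (P ∪ ({x} ∪ {y})).filter (fun z => lev z = i + 1) = {y} := by
  have n1 : i ≠ i + 1 := fun h => h1 (by linear_combination -h)
  have n2 : i ≠ i - 1 := fun h => h1 (by linear_combination h)
  have n3 : i - 1 ≠ i + 1 := fun h => h2 (by linear_combination -h)
  have s1 : {x} ⊆ fiber lev (i - 1) := singleton_subset_iff.2 (mem_fiber.2 hx)
  have s2 : {y} ⊆ fiber lev (i + 1) := singleton_subset_iff.2 (mem_fiber.2 hy)
  simp only [filter_union]
  rw [filter_eq_self_of_subset_fiber hP, filter_eq_self_of_subset_fiber s1,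
    filter_eq_self_of_subset_fiber s2, filter_eq_empty_of_subset_fiber hP n1,
    filter_eq_empty_of_subset_fiber hP n2, filter_eq_empty_of_subset_fiber s1 n2.symm,
    filter_eq_empty_of_subset_fiber s1 n3, filter_eq_empty_of_subset_fiber s2 n1.symm,
    filter_eq_empty_of_subset_fiber s2 n3.symm]
  simp only [union_empty, empty_union, and_self]

theorem card_pairEnds (h1 : (1 : ZMod n) ≠ 0) (h2 : (2 : ZMod n) ≠ 0) (i : ZMod n) :
    (pairEnds lev i).card =
    (fiber lev i).card.choose 2 * ((fiber lev (i - 1)).card * (fiber lev (i + 1)).card) := by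
  rw [pairEnds, card_image_of_injOn, card_product, card_product, card_powersetCard]
  have key : ∀ p ∈ powersetCard 2 (fiber lev i) ×ˢ (fiber lev (i - 1) ×ˢ fiber lev (i + 1)), _ :=
    fun p hp => filter_pairEnds (P := p.1) (x := p.2.1) (y := p.2.2) h1 h2
      (mem_powersetCard.1 (mem_product.1 hp).1).1
      (mem_fiber.1 (mem_product.1 (mem_product.1 hp).2).1)
      (mem_fiber.1 (mem_product.1 (mem_product.1 hp).2).2)
  intro p hp q hq h
  beta_reduce at h
  have kp := key p (mem_coe.1 hp)
  have kq := key q (mem_coe.1 hq)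
  rw [h, kq.1, kq.2.1, kq.2.2] at kp
  exact Prod.ext kp.1.symm (Prod.ext (singleton_injective kp.2.1).symm
    (singleton_injective kp.2.2).symm)

theorem heavyClasses_of_mem_transversals {S : Finset V} (hS : S ∈ transversals lev) :
    heavyClasses lev S = ∅ := by
  obtain ⟨c, hc, rfl⟩ := mem_image.1 hS
  refine filter_false_of_mem fun j _ => ?_
  rw [filter_image_section hc, card_singleton]
  norm_num

theorem heavyClasses_of_mem_pairPairs {i : ZMod n} {S : Finset V} (hS : S ∈ pairPairs lev i) :
    heavyClasses lev S = {i, i + 1} := by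
  obtain ⟨⟨P, Q⟩, hp, rfl⟩ := mem_image.1 hS
  obtain ⟨hp1, hp2⟩ := mem_product.1 hp
  obtain ⟨s1, c1⟩ := mem_powersetCard.1 hp1
  obtain ⟨s2, c2⟩ := mem_powersetCard.1 hp2
  ext j
  simp only [heavyClasses, mem_filter, mem_univ, true_and, mem_insert, mem_singleton,
    filter_union]
  constructor
  · intro h
    by_contra! hj
    rw [filter_eq_empty_of_subset_fiber s1 hj.1.symm, filter_eq_empty_of_subset_fiber s2 hj.2.symm]
      at h
    simp at h
  · rintro (rfl | rfl)
    · rw [filter_eq_self_of_subset_fiber s1]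
      exact c1.ge.trans (card_le_card subset_union_left)
    · rw [filter_eq_self_of_subset_fiber s2]
      exact c2.ge.trans (card_le_card subset_union_right)

theorem heavyClasses_of_mem_pairEnds (h1 : (1 : ZMod n) ≠ 0) (h2 : (2 : ZMod n) ≠ 0) {i : ZMod n}
    {S : Finset V} (hS : S ∈ pairEnds lev i) : heavyClasses lev S = {i} := by
  obtain ⟨⟨P, x, y⟩, hp, rfl⟩ := mem_image.1 hS
  simp only [mem_product, mem_powersetCard, mem_fiber] at hp
  obtain ⟨⟨s1, c1⟩, hx, hy⟩ := hp
  obtain ⟨k1, k2, k3⟩ := filter_pairEnds h1 h2 s1 hx hy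
  ext j
  simp only [heavyClasses, mem_filter, mem_univ, true_and, mem_singleton]
  constructor
  · intro h
    by_contra hj
    by_cases hj1 : j = i - 1
    · rw [hj1, k2, card_singleton] at h
      omega
    by_cases hj2 : j = i + 1
    · rw [hj2, k3, card_singleton] at h
      omega
    · have s2 : {x} ⊆ fiber lev (i - 1) := singleton_subset_iff.2 (mem_fiber.2 hx)
      have s3 : {y} ⊆ fiber lev (i + 1) := singleton_subset_iff.2 (mem_fiber.2 hy)
      rw [filter_union, filter_union, filter_eq_empty_of_subset_fiber s1 (Ne.symm hj),
        filter_eq_empty_of_subset_fiber s2 (Ne.symm hj1),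
        filter_eq_empty_of_subset_fiber s3 (Ne.symm hj2)] at h
      simp at h
  · rintro rfl
    rw [k1, c1]

/-- The three families are disjoint, and so are the members of the last two for different `i`: the
set of classes met twice is empty, `{i, i + 1}` or `{i}`. -/
theorem IsBlowup.le_card_cyclesIn (hG : IsBlowup G n lev) (hn : 4 ≤ n)
    (hind : ∀ x y, lev x = lev y → ¬ G.Adj x y) :
    ∏ i, (fiber lev i).card + localCount (fun i => (fiber lev i).card) ≤
      (cyclesIn G univ).card := by
  have h1 : (1 : ZMod n) ≠ 0 := by
    exact_mod_cast natCast_ne_zero_of_lt (a := 1) (k := n) (by norm_num) (by omega)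
  have h2 : (2 : ZMod n) ≠ 0 := by
    exact_mod_cast natCast_ne_zero_of_lt (a := 2) (k := n) (by norm_num) (by omega)
  have hadj : ∀ {x y}, lev y = lev x + 1 → G.Adj x y := fun {x y} h =>
    (hG.adj_iff x y fun h' => h1 (by rw [h'] at h; linear_combination -h)).2 (Or.inl h)
  have hsub : transversals lev ∪
      ((univ : Finset (ZMod n)).biUnion (pairPairs lev) ∪
        (univ : Finset (ZMod n)).biUnion (pairEnds lev)) ⊆ cyclesIn G univ := by
    intro S hS
    simp only [mem_union, mem_biUnion, mem_univ, true_and] at hS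
    rcases hS with hS | ⟨i, hS⟩ | ⟨i, hS⟩
    · obtain ⟨c, hc, rfl⟩ := mem_image.1 hS
      have hc' : ∀ i, lev (c i) = i := fun i => mem_fiber.1 (Fintype.mem_piFinset.1 hc i)
      refine mem_cyclesIn.2 ⟨subset_univ _, (isInducedCycle_iff G _).2 ⟨n, c, ⟨by omega, ?_, ?_⟩,
        by simp⟩⟩
      · intro i j h
        rw [← hc' i, h, hc']
      · intro i j
        rcases eq_or_ne i j with rfl | hij
        · refine iff_of_false (hind _ _ rfl) fun h => ?_
          rcases h with h | h <;> exact h1 (by linear_combination -h)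
        · have := hG.adj_iff (c i) (c j) (by rwa [hc', hc'])
          rwa [hc', hc'] at this
    · obtain ⟨⟨P, Q⟩, hp, rfl⟩ := mem_image.1 hS
      simp only [mem_product, mem_powersetCard, card_eq_two] at hp
      obtain ⟨⟨sP, a, b, hab, rfl⟩, sQ, c, d, hcd, rfl⟩ := hp
      have ha : lev a = i := mem_fiber.1 (sP (by simp))
      have hb : lev b = i := mem_fiber.1 (sP (by simp))
      have hc : lev c = i + 1 := mem_fiber.1 (sQ (by simp))
      have hd : lev d = i + 1 := mem_fiber.1 (sQ (by simp))
      convert mem_cyclesIn_of_four (G := G) (a := a) (b := c) (c := b) (d := d)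
        (hadj (by rw [ha, hc])) (hadj (by rw [hb, hc])).symm (hadj (by rw [hb, hd]))
        (hadj (by rw [ha, hd])).symm (hind _ _ (ha.trans hb.symm)) (hind _ _ (hc.trans hd.symm))
        hab hcd using 1
      ext x
      simp only [mem_union, mem_insert, mem_singleton]
      tauto
    · obtain ⟨⟨P, c, d⟩, hp, rfl⟩ := mem_image.1 hS
      simp only [mem_product, mem_powersetCard, card_eq_two, mem_fiber] at hp
      obtain ⟨⟨sP, a, b, hab, rfl⟩, hc, hd⟩ := hp
      have ha : lev a = i := mem_fiber.1 (sP (by simp))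
      have hb : lev b = i := mem_fiber.1 (sP (by simp))
      have hcd : lev c ≠ lev d := fun h => h2 (by linear_combination hc - hd - h)
      -- The classes `i - 1` and `i + 1` are adjacent only if there are three classes.
      have hncd : ¬ G.Adj c d := fun h => by
        rcases (hG.adj_iff c d hcd).1 h with h | h
        · exact h1 (by linear_combination h - hd + hc)
        · exact natCast_ne_zero_of_lt (a := 3) (k := n) (by norm_num) (by omega)
            (by push_cast; linear_combination hc - hd - h)
      convert mem_cyclesIn_of_four (G := G) (a := a) (b := c) (c := b) (d := d)
        (hadj (by rw [ha, hc]; ring)).symm (hadj (by rw [hb, hc]; ring)) (hadj (by rw [hb, hd]))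
        (hadj (by rw [ha, hd])).symm (hind _ _ (ha.trans hb.symm)) hncd
        hab (fun h => hcd (h ▸ rfl)) using 1
      ext x
      simp only [mem_union, mem_insert, mem_singleton]
      tauto
  have hcard := card_le_card hsub
  have hne : ∀ i : ZMod n, i + 1 ≠ i := fun i h => h1 (by linear_combination h)
  rw [card_union_of_disjoint, card_union_of_disjoint, card_biUnion, card_biUnion,
    card_transversals] at hcard
  · simp only [card_pairPairs h1, card_pairEnds h1 h2] at hcard
    rwa [localCount, sum_add_distrib]
  · intro i _ j _ hij
    refine disjoint_left.2 fun S hS hS' => hij ?_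
    have := (heavyClasses_of_mem_pairEnds h1 h2 hS).symm.trans
      (heavyClasses_of_mem_pairEnds h1 h2 hS')
    exact singleton_injective this
  · intro i _ j _ hij
    refine disjoint_left.2 fun S hS hS' => hij ?_
    have := (heavyClasses_of_mem_pairPairs hS).symm.trans (heavyClasses_of_mem_pairPairs hS')
    have m1 : i ∈ ({j, j + 1} : Finset (ZMod n)) := this ▸ by simp
    have m2 : i + 1 ∈ ({j, j + 1} : Finset (ZMod n)) := this ▸ by simp
    simp only [mem_insert, mem_singleton] at m1 m2
    rcases m1 with m1 | m1
    · exact m1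
    rcases m2 with m2 | m2
    · exact absurd (by linear_combination m2 - m1) h2
    · linear_combination m2
  · refine disjoint_left.2 fun S hS hS' => ?_
    obtain ⟨i, -, hi⟩ := mem_biUnion.1 hS
    obtain ⟨j, -, hj⟩ := mem_biUnion.1 hS'
    have := (heavyClasses_of_mem_pairPairs hi).symm.trans (heavyClasses_of_mem_pairEnds h1 h2 hj)
    have m1 : i ∈ ({j} : Finset (ZMod n)) := this ▸ by simp
    have m2 : i + 1 ∈ ({j} : Finset (ZMod n)) := this ▸ by simp
    rw [mem_singleton] at m1 m2
    exact hne i (m2.trans m1.symm)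
  · refine disjoint_left.2 fun S hS hS' => ?_
    have h0 := heavyClasses_of_mem_transversals hS
    rw [mem_union, mem_biUnion, mem_biUnion] at hS'
    rcases hS' with ⟨i, -, hi⟩ | ⟨i, -, hi⟩
    · rw [heavyClasses_of_mem_pairPairs hi] at h0
      simp at h0
    · rw [heavyClasses_of_mem_pairEnds h1 h2 hi] at h0
      simp at h0

end LowerBound

/-! ### The extremal graphs -/

section Construction

open scoped Classical

variable {n : ℕ} [NeZero n]

theorem prod_add_localCount_le (hn : 4 ≤ n) (s : ZMod n → ℕ) (hs : ∀ i, 1 ≤ s i) :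
    ∏ i, s i + localCount s ≤ SimpleGraph.maxInducedCycles (∑ i, s i) := by
  obtain ⟨e⟩ : Nonempty (Fin (∑ i, s i) ≃ Σ i, Fin (s i)) :=
    ⟨(Fintype.equivFinOfCardEq (by simp)).symm⟩
  set lev : Fin (∑ i, s i) → ZMod n := fun x => (e x).1 with hlev
  have hcard : ∀ i, (fiber lev i).card = s i := by
    intro i
    have : fiber lev i = (univ : Finset (Fin (s i))).image fun a => e.symm ⟨i, a⟩ := by
      ext x
      rw [mem_fiber, mem_image]
      constructor
      · rintro rfl
        exact ⟨(e x).2, mem_univ _, e.symm_apply_apply x⟩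
      · rintro ⟨a, -, rfl⟩
        simp [hlev]
    rw [this, card_image_of_injective _ fun a b h => by simpa using h, card_univ, Fintype.card_fin]
  let G : SimpleGraph (Fin (∑ i, s i)) :=
    { Adj := fun x y => lev x ≠ lev y ∧ (lev y = lev x + 1 ∨ lev x = lev y + 1)
      symm := ⟨fun x y h => ⟨h.1.symm, h.2.symm⟩⟩
      loopless := ⟨fun x h => h.1 rfl⟩ }
  have hG : IsBlowup G n lev :=
    ⟨fun i => by
      obtain ⟨x, hx⟩ := card_pos.1 (by rw [hcard]; exact hs i : 0 < (fiber lev i).card)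
      exact ⟨x, mem_fiber.1 hx⟩,
    fun x y h => ⟨fun h' => h'.2, fun h' => ⟨h, h'⟩⟩⟩
  have key := hG.le_card_cyclesIn hn fun x y h h' => h'.1 h
  simp only [hcard] at key
  refine key.trans ?_
  rw [← numInducedCycles_eq]
  exact (SimpleGraph.isGreatest_maxInducedCycles _).2 ⟨G, rfl⟩

theorem maxProd_three_mul {k : ℕ} (hk : 1 ≤ k) : maxProd (3 * k) = 3 ^ k := by
  induction k, hk using Nat.le_induction with
  | base => rfl
  | succ k hk ih => rw [mul_add, mul_one, maxProd_add_three (by omega), ih, pow_succ, mul_comm]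

theorem maxProd_three_mul_add_four (k : ℕ) : maxProd (3 * k + 4) = 4 * 3 ^ k := by
  induction k with
  | zero => rfl
  | succ k ih =>
    rw [show 3 * (k + 1) + 4 = 3 * k + 4 + 3 by ring, maxProd_add_three (by omega), ih, pow_succ]
    ring

theorem maxProd_three_mul_add_two (k : ℕ) : maxProd (3 * k + 2) = 2 * 3 ^ k := by
  induction k with
  | zero => rfl
  | succ k ih =>
    rw [show 3 * (k + 1) + 2 = 3 * k + 2 + 3 by ring, maxProd_add_three (by omega), ih, pow_succ]
    ring

theorem prod_ite_three (t : ℕ) :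
    ∏ i : ZMod n, (if i = 0 then t else 3) = t * 3 ^ (n - 1) := by
  rw [← mul_prod_erase univ _ (mem_univ (0 : ZMod n)), if_pos rfl]
  congr 1
  rw [prod_congr rfl fun i hi => if_neg (ne_of_mem_erase hi), prod_const,
    card_erase_of_mem (mem_univ _), card_univ, ZMod.card]

theorem maxProd_add_localBound_le {N : ℕ} (hN : 12 ≤ N) :
    maxProd N + localBound N ≤ SimpleGraph.maxInducedCycles N := by
  have h3 : N % 3 = 0 ∨ N % 3 = 1 ∨ N % 3 = 2 := by omega
  rcases h3 with h | h | h
  · obtain ⟨k, rfl⟩ : ∃ k, N = 3 * k := ⟨N / 3, by omega⟩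
    have : NeZero k := ⟨by omega⟩
    have key := prod_add_localCount_le (n := k) (by omega) (fun _ => 3) (by norm_num)
    obtain ⟨e1, e2⟩ := localCount_of_three (n := k) (fun _ => 3) fun _ => rfl
    rw [e1, e2, prod_const, card_univ, ZMod.card] at key
    rw [maxProd_three_mul (by omega), localBound, if_pos h]
    omega
  · obtain ⟨k, rfl⟩ : ∃ k, N = 3 * k + 4 := ⟨N / 3 - 1, by omega⟩
    have key := prod_add_localCount_le (n := k + 1) (by omega)
      (fun i => if i = 0 then 4 else 3) (by intro i; split_ifs <;> norm_num)
    obtain ⟨e1, e2⟩ := localCount_of_four (n := k + 1) (by omega) (i₀ := 0)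
      (s := fun i => if i = 0 then 4 else 3) rfl fun i hi => if_neg hi
    rw [e1, e2, prod_ite_three, Nat.add_sub_cancel,
      show 3 * (k + 1) + 1 = 3 * k + 4 by ring] at key
    rw [maxProd_three_mul_add_four, localBound, if_neg (by omega), if_pos h]
    omega
  · obtain ⟨k, rfl⟩ : ∃ k, N = 3 * k + 2 := ⟨N / 3, by omega⟩
    have key := prod_add_localCount_le (n := k + 1) (by omega)
      (fun i => if i = 0 then 2 else 3) (by intro i; split_ifs <;> norm_num)
    obtain ⟨e1, e2⟩ := localCount_of_two (n := k + 1) (by omega) (i₀ := 0)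
      (s := fun i => if i = 0 then 2 else 3) rfl fun i hi => if_neg hi
    have e2 : ∑ i : ZMod (k + 1), (if i = 0 then 2 else 3) = 3 * k + 2 := by omega
    rw [e2, prod_ite_three, Nat.add_sub_cancel] at key
    rw [maxProd_three_mul_add_two, localBound, if_neg (by omega), if_neg (by omega)]
    omega

end Construction

end InducedCycles

namespace InducedCycles

open Finset

set_option linter.unusedSectionVars false

/-! ### Growth comparisons and the choice of the strip length -/

section Asymptotics

open Filter

theorem growth_eq_pow (n : ℕ) : growth n = growth 1 ^ n := by
  induction n with
  | zero => simp [growth]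
  | succ n ih => rw [growth_add, ih, pow_succ]

theorem growth_one_gt : 1.44 < growth 1 := by
  apply lt_of_pow_lt_pow_left₀ 3 (growth_pos 1).le
  rw [growth_pow_three]
  norm_num

theorem eventually_mul_pow_le_growth (C : ℝ) (k : ℕ) :
    ∀ᶠ n : ℕ in atTop, C * ((n : ℝ) + 1) ^ k ≤ growth n := by
  have h1 : 1 < growth 1 := by have := growth_one_gt; linarith
  have h := (isLittleO_pow_const_const_pow_of_one_lt (R := ℝ) k h1).bound
    (c := (2 ^ k * (|C| + 1))⁻¹) (by positivity)
  filter_upwards [h, eventually_ge_atTop 1] with n hn hn1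
  rw [Real.norm_of_nonneg (by positivity), Real.norm_of_nonneg (pow_nonneg (growth_pos 1).le _),
    ← growth_eq_pow, ← div_eq_inv_mul, le_div_iff₀ (by positivity)] at hn
  have hn1' : (1 : ℝ) ≤ n := by exact_mod_cast hn1
  calc C * ((n : ℝ) + 1) ^ k ≤ (|C| + 1) * (2 * n) ^ k := by
        gcongr
        · linarith [le_abs_self C]
        · linarith
    _ = (n : ℝ) ^ k * (2 ^ k * (|C| + 1)) := by rw [mul_pow]; ring
    _ ≤ growth n := hn

/-- A value of order `log n` works: it bounds the average defect, the room needed for a strip of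
length `c + 4` is of order `(log n) ^ 2`, and `3 ^ c` outweighs the cubic factor for the cycles that
avoid the strip. -/
theorem eventually_exists_parameter (D : ℕ) (hD : 1 ≤ D) : ∀ᶠ n : ℕ in atTop, ∃ c : ℕ,
    1000000 * ((D : ℝ) + 1) * (60 * Real.log (2 * D ^ 2 * n) + 1) ≤ c ∧
    3 * ((c + 4) * ((D + 1) * (D + 1 + c) + 1)) + c + (D + 1) ≤ n ∧ 200 * n ^ 3 ≤ 3 ^ c := by
  set A : ℝ := 1000000 * ((D : ℝ) + 1) * (60 * (Real.log (2 * D ^ 2) + 1) + 1) + 1 with hA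
  have hDr : (1 : ℝ) ≤ D := by exact_mod_cast hD
  have hlogD : 0 ≤ Real.log (2 * D ^ 2) := Real.log_nonneg (by nlinarith)
  have hA1 : 1 ≤ A := by
    rw [hA]
    have : 0 ≤ 1000000 * ((D : ℝ) + 1) * (60 * (Real.log (2 * D ^ 2) + 1) + 1) := by positivity
    linarith
  set K : ℝ := 3 * ((A + 4) * ((D + 1) * (D + 1 + A) + 1)) + A + (D + 1) with hK
  have hK0 : 0 < K := by positivity
  have hlog := ((Real.isLittleO_pow_log_id_atTop (n := 2)).comp_tendsto
    tendsto_natCast_atTop_atTop).bound (c := K⁻¹) (by positivity)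
  filter_upwards [hlog, eventually_ge_atTop 200] with n hn hn200
  have hnr : (200 : ℝ) ≤ n := by exact_mod_cast hn200
  set l := Real.log n with hl
  have hl1 : 1 ≤ l := by
    rw [hl, Real.le_log_iff_exp_le (by linarith)]
    have := Real.exp_one_lt_d9
    linarith
  simp only [Function.comp_apply, id] at hn
  rw [Real.norm_of_nonneg (by positivity), Real.norm_of_nonneg (by positivity), ← div_eq_inv_mul,
    le_div_iff₀ hK0] at hn
  set X := 1000000 * ((D : ℝ) + 1) * (60 * Real.log (2 * D ^ 2 * n) + 1) with hX
  have hlogmul : Real.log (2 * D ^ 2 * n) = Real.log (2 * D ^ 2) + l :=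
    Real.log_mul (by positivity) (by positivity)
  have hX0 : 0 ≤ X := by rw [hX, hlogmul]; positivity
  have hXl : 4 * l ≤ X := by
    rw [hX, hlogmul]
    have : 1000000 * 1 * (60 * (0 + l) + 0) ≤
        1000000 * ((D : ℝ) + 1) * (60 * (Real.log (2 * D ^ 2) + l) + 1) := by
      gcongr <;> linarith
    linarith
  have hXA : X + 1 ≤ A * l := by
    have e : Real.log (2 * D ^ 2) ≤ Real.log (2 * D ^ 2) * l := le_mul_of_one_le_right hlogD hl1
    have : X ≤ 1000000 * ((D : ℝ) + 1) * (60 * (Real.log (2 * D ^ 2) + 1) + 1) * l := by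
      rw [hX, hlogmul, mul_assoc _ _ l]
      gcongr
      linarith
    rw [hA, add_mul]
    linarith
  refine ⟨⌈X⌉₊, Nat.le_ceil X, ?_, ?_⟩
  · have hc : (⌈X⌉₊ : ℝ) ≤ A * l := (Nat.ceil_lt_add_one hX0).le.trans hXA
    have : (3 * ((⌈X⌉₊ + 4) * ((D + 1) * (D + 1 + ⌈X⌉₊) + 1)) + ⌈X⌉₊ + (D + 1) : ℝ) ≤ n := by
      calc (3 * ((⌈X⌉₊ + 4) * ((D + 1) * (D + 1 + ⌈X⌉₊) + 1)) + ⌈X⌉₊ + (D + 1) : ℝ)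
          ≤ 3 * ((A * l + 4) * ((D + 1) * (D + 1 + A * l) + 1)) + A * l + (D + 1) := by gcongr
        _ ≤ 3 * ((A * l + 4 * l) * ((D + 1) * ((D + 1) * l + A * l) + 1 * l)) + A * (l * l) +
              (D + 1) * (l * l) := by
            have hll : 1 ≤ l * l := by nlinarith
            gcongr
            · linarith
            · nlinarith
            · linarith
            · nlinarith
            · nlinarith
        _ = l ^ 2 * K := by rw [hK]; ring
        _ ≤ n := hn
    exact_mod_cast this
  · have h1 : (200 * n ^ 3 : ℝ) ≤ 3 ^ ⌈X⌉₊ := by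
      calc (200 * n ^ 3 : ℝ) ≤ n ^ 4 := by
            rw [pow_succ (n : ℝ) 3, mul_comm]
            gcongr
        _ = Real.exp (4 * l) := by
            rw [mul_comm, Real.exp_mul, hl, Real.exp_log (by linarith)]
            norm_cast
        _ ≤ Real.exp ⌈X⌉₊ := Real.exp_le_exp.2 (hXl.trans (Nat.le_ceil X))
        _ = Real.exp 1 ^ ⌈X⌉₊ := by rw [← Real.exp_nat_mul, mul_one]
        _ ≤ 3 ^ ⌈X⌉₊ := by
            gcongr
            have := Real.exp_one_lt_d9
            linarith
    exact_mod_cast h1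

end Asymptotics

/-! ### The theorem for bounded degree -/

section BoundedDegree

open scoped Classical

/-- The path count is at least `growth n / (2 * D ^ 2 * n)`, so the entropy deficit per path is at
most `log (2 * D ^ 2 * n)`. -/
theorem totalDefect_clean_le_mul {V : Type*} [Fintype V] [DecidableEq V] {G : SimpleGraph V}
    {E R : Finset V} {s : V} {D : ℕ} (hD1 : 1 ≤ D) (hD : ∀ x, (nb G univ x).card ≤ D)
    (hV : 0 < Fintype.card V) (h : 9 / 10 * growth (Fintype.card V) ≤
      Fintype.card V * D ^ 2 * pathCount G E R s) :
    totalDefect G E (Clean G) R s ≤ 1000000 * ((D : ℝ) + 1) *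
      (60 * Real.log (2 * D ^ 2 * Fintype.card V) + 1) * pathCount G E R s := by
  have hV' : (0 : ℝ) < Fintype.card V := by exact_mod_cast hV
  have hD' : (0 : ℝ) < D := by exact_mod_cast hD1
  have hg := growth_pos (Fintype.card V)
  have hP : (0 : ℝ) < pathCount G E R s := by
    by_contra! hle
    have := mul_nonpos_of_nonneg_of_nonpos (a := (Fintype.card V : ℝ) * D ^ 2) (by positivity) hle
    linarith
  have h1 := totalDefect_clean_le_of_card_nb_le (G := G) (E := E) (R := R) (D := D)
    (fun x _ => (card_le_card (filter_subset_filter _ (subset_univ _))).trans (hD x)) s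
  refine h1.trans ?_
  have h2 : Fintype.card V * (Real.log 3 / 3) ≤ Real.log (2 * D ^ 2 * Fintype.card V) +
      Real.log (pathCount G E R s) := by
    rw [← log_growth, ← Real.log_mul (by positivity) hP.ne']
    refine Real.log_le_log hg ?_
    nlinarith
  have h3 : (R.card : ℝ) * (Real.log 3 / 3) ≤ Fintype.card V * (Real.log 3 / 3) := by
    have : (R.card : ℝ) ≤ Fintype.card V := by exact_mod_cast card_le_univ R
    have := Real.log_nonneg (show (1 : ℝ) ≤ 3 by norm_num)
    gcongr
  rw [Real.negMulLog, mul_assoc (1000000 * ((D : ℝ) + 1))]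
  refine mul_le_mul_of_nonneg_left ?_ (by positivity)
  have h4 := mul_le_mul_of_nonneg_left (h3.trans h2) hP.le
  nlinarith

theorem exists_bound_of_card_nb_le (D : ℕ) (hD1 : 1 ≤ D) : ∃ n₀ : ℕ, ∀ (V : Type)
    [Fintype V] [DecidableEq V] (G : SimpleGraph V), (∀ x, (nb G univ x).card ≤ D) →
    n₀ ≤ Fintype.card V → 9 / 10 * growth (Fintype.card V) ≤ (cyclesIn G univ).card →
    (cyclesIn G univ).card ≤ maxProd (Fintype.card V) + localBound (Fintype.card V) := by
  obtain ⟨n₀, hn₀⟩ := Filter.eventually_atTop.1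
    ((eventually_exists_parameter D hD1).and (eventually_mul_pow_le_growth 1500 4))
  refine ⟨n₀ + 13, fun V _ _ G hD hV hN => ?_⟩
  obtain ⟨⟨c, hc1, hc2, hc3⟩, hpoly⟩ := hn₀ (Fintype.card V) (by omega)
  set n := Fintype.card V with hn
  have hg := growth_pos n
  obtain ⟨v, a, b, hP⟩ := exists_large_pathCount hD (by positivity) hN
  set R := univ \ insert v (nb G univ v) with hR
  set P := pathCount G (nb G univ b) R a with hPdef
  have hRn : R.card + ((nb G univ v).card + 1) = n := card_sdiff_insert_nb (mem_univ v)
  have hRc : (univ \ R).card ≤ D + 1 := by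
    have := card_sdiff_add_card_eq_card (subset_univ R)
    have := hD v
    rw [card_univ] at *
    omega
  have hdef := totalDefect_clean_le_mul hD1 hD (by omega) hP
  have hP0 : 0 < P := by
    by_contra! h0
    rw [Nat.le_zero.1 h0] at hP
    simp at hP
    linarith
  have hsize : 3 * ((c + 4) * ((D + 1) * ((univ \ R).card + c) + 1)) + c ≤ R.card := by
    have : 3 * ((c + 4) * ((D + 1) * ((univ \ R).card + c) + 1)) ≤
      3 * ((c + 4) * ((D + 1) * (D + 1 + c) + 1)) := by gcongr
    have := hD v
    omega
  obtain ⟨B, hB⟩ := exists_strip hD hP0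
    (hdef.trans (mul_le_mul_of_nonneg_right hc1 (Nat.cast_nonneg _))) hsize
  have hc2' : 2 ≤ c := by
    by_contra! hlt
    have : 3 ^ c ≤ 3 ^ 1 := Nat.pow_le_pow_right (by norm_num) (by omega)
    have : 1 ≤ n ^ 3 := Nat.one_le_pow _ _ (by omega)
    omega
  rcases hB.dichotomy (by omega) (by omega) with ⟨m, lev, hG, hmax⟩ | h
  · exact hG.card_le hmax (by omega)
  -- The short cycles and those that avoid the strip together contribute at most `(480 / 1500 + 96 /
  -- 200) * growth n = 0.8 * growth n` to `96` times the count. This is less than the missing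
  -- `maxProd n ≥ 0.9 * growth n`.
  · refine le_trans ?_ (Nat.le_add_right _ _)
    have hout := hB.card_outside
    rw [Nat.add_sub_cancel] at hout
    have h1 := card_cyclesIn_le (G := G) (outside (c + 4) B)
    have h2 : growth (outside (c + 4) B).card * 3 ^ c = growth n := by
      rw [← growth_three_mul, ← growth_add, hout]
    have h3 : ((outside (c + 4) B).card : ℝ) ≤ n := by
      have : (outside (c + 4) B).card ≤ n := by omega
      exact_mod_cast this
    have h4 : (200 * n ^ 3 : ℝ) ≤ 3 ^ c := by exact_mod_cast hc3
    have h5 : 200 * ((cyclesIn G (outside (c + 4) B)).card : ℝ) ≤ growth n := by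
      have hgo := growth_pos (outside (c + 4) B).card
      calc 200 * ((cyclesIn G (outside (c + 4) B)).card : ℝ)
          ≤ 200 * (n ^ 3 * growth (outside (c + 4) B).card) := by
            refine mul_le_mul_of_nonneg_left (h1.trans ?_) (by norm_num)
            gcongr
        _ = (200 * n ^ 3) * growth (outside (c + 4) B).card := by ring
        _ ≤ 3 ^ c * growth (outside (c + 4) B).card := by gcongr
        _ = growth n := by rw [mul_comm, h2]
    have h6 := growth_le_maxProd (n := n) (by omega)
    have h7 : (96 * (cyclesIn G univ).card : ℝ) ≤ 96 * (5 * (n + 1) ^ 4) +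
        96 * (cyclesIn G (outside (c + 4) B)).card + 95 * maxProd n := by exact_mod_cast h
    have h8 : ((cyclesIn G univ).card : ℝ) ≤ maxProd n := by linarith
    exact_mod_cast h8

end BoundedDegree

end InducedCycles

namespace InducedCycles

open Finset

set_option linter.unusedSectionVars false

/-! ### Reduction to bounded degree -/

section DegreeReduction

open scoped Classical

variable {V : Type} [Fintype V] [DecidableEq V] {G : SimpleGraph V}

theorem pow_six_mul_lt {d : ℕ} (hd : 31 ≤ d) : 1000 * d ^ 6 < 3 ^ (d + 1) := by
  induction d, hd using Nat.le_induction with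
  | base => norm_num
  | succ d hd ih =>
    have h : (d + 1) ^ 6 ≤ 3 * d ^ 6 := by
      have h1 : 31 ^ 6 * (d + 1) ^ 6 ≤ 32 ^ 6 * d ^ 6 := by
        rw [← mul_pow, ← mul_pow]
        exact Nat.pow_le_pow_left (by omega) 6
      omega
    rw [pow_succ 3 (d + 1)]
    omega

theorem sq_lt_growth {d : ℕ} (hd : 31 ≤ d) : (d : ℝ) ^ 2 < 18 / 100 * growth (d + 1) := by
  apply lt_of_pow_lt_pow_left₀ 3 (by have := growth_pos (d + 1); positivity)
  rw [mul_pow, growth_pow_three]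
  have : (1000 * d ^ 6 : ℝ) < 3 ^ (d + 1) := by exact_mod_cast pow_six_mul_lt hd
  rw [← pow_mul]
  have : (0 : ℝ) ≤ d ^ 6 := by positivity
  linarith

theorem card_cyclesIn_induce (S : Finset V) :
    (cyclesIn (G.induce (S : Set V)) univ).card = (cyclesIn G S).card := by
  rw [← card_map (mapEmbedding (Function.Embedding.subtype (· ∈ (S : Set V)))).toEmbedding]
  congr 1
  ext T
  simp only [mem_map, mem_cyclesIn, subset_univ, true_and, RelEmbedding.coe_toEmbedding,
    mapEmbedding_apply]
  constructor
  · rintro ⟨A, hA, rfl⟩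
    refine ⟨fun x hx => ?_, ?_⟩
    · obtain ⟨y, -, rfl⟩ := mem_map.1 hx
      exact y.2
    · obtain ⟨k, f, hf, hr⟩ := (isInducedCycle_iff _ _).1 hA
      refine (isInducedCycle_iff _ _).2 ⟨k, fun i => f i, ⟨hf.three_le,
        Subtype.val_injective.comp hf.inj, fun i j => hf.adj_iff i j⟩, ?_⟩
      rw [coe_map, ← hr, ← Set.range_comp]
      rfl
  · rintro ⟨hT, hcyc⟩
    obtain ⟨k, f, hf, hr⟩ := (isInducedCycle_iff _ _).1 hcyc
    have hfS : ∀ i, f i ∈ (S : Set V) := fun i => hT (by rw [← mem_coe, ← hr]; exact ⟨i, rfl⟩)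
    have e : T = (T.subtype (· ∈ (S : Set V))).map (Function.Embedding.subtype _) :=
      (subtype_map_of_mem fun x hx => hT hx).symm
    refine ⟨T.subtype (· ∈ (S : Set V)), (isInducedCycle_iff _ _).2 ⟨k, fun i => ⟨f i, hfS i⟩,
      ⟨hf.three_le, fun i j h => hf.inj (congrArg Subtype.val h), fun i j => hf.adj_iff i j⟩, ?_⟩,
      e.symm⟩
    ext x
    rw [mem_coe, mem_subtype, ← mem_coe, ← hr, Set.mem_range, Set.mem_range]
    exact exists_congr fun i => Subtype.ext_iff

theorem card_nb_induce (S : Finset V) (v : (S : Set V)) :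
    (nb (G.induce (S : Set V)) univ v).card = (nb G S v).card := by
  rw [← card_map (Function.Embedding.subtype (· ∈ (S : Set V)))]
  congr 1
  ext x
  simp only [mem_map, mem_nb, mem_univ, true_and, SimpleGraph.comap_adj,
    Function.Embedding.coe_subtype, Subtype.exists, exists_and_right, exists_eq_right, mem_coe]
  constructor
  · rintro ⟨h, h'⟩
    exact ⟨h, h'⟩
  · rintro ⟨h, h'⟩
    exact ⟨h, h'⟩

theorem card_cyclesIn_erase_add (S : Finset V) (x : V) :
    (cyclesIn G (S.erase x)).card + ((cyclesIn G S).filter (x ∈ ·)).card = (cyclesIn G S).card := by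
  rw [← card_filter_add_card_filter_not (s := cyclesIn G S) (p := (x ∈ ·)), add_comm]
  congr 2
  ext T
  simp only [mem_filter, mem_cyclesIn, subset_erase]
  tauto

/-- `S` maximises the number of cycles weighted by `(4 / 5) ^ S.card`. Deleting a vertex of `S` then
destroys at least a fifth of the cycles, which `card_cyclesIn_through_mul_le` forbids for degrees
above 30. Since `growth 1 * (4 / 5) > 1`, each vertex outside `S` improves the density of `S`
relative to `growth`. -/
theorem exists_dense_subset (hN : 9 / 10 * growth (Fintype.card V) ≤ (cyclesIn G univ).card) :
    ∃ S : Finset V, (∀ v ∈ S, (nb G S v).card ≤ 30) ∧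
      9 / 10 * growth (Fintype.card V) * (4 / 5) ^ Fintype.card V ≤
        (cyclesIn G S).card * (4 / 5) ^ S.card ∧
      9 / 10 * growth S.card ≤ (cyclesIn G S).card ∧
      (S ≠ univ → 103 / 100 * growth S.card ≤ (cyclesIn G S).card) := by
  obtain ⟨S, -, hS⟩ := exists_max_image (univ : Finset (Finset V))
    (fun S => ((cyclesIn G S).card : ℝ) * (4 / 5) ^ S.card) ⟨∅, mem_univ _⟩
  have huniv := hS univ (mem_univ _)
  rw [card_univ] at huniv
  have hweight : 9 / 10 * growth (Fintype.card V) * (4 / 5) ^ Fintype.card V ≤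
      (cyclesIn G S).card * (4 / 5 : ℝ) ^ S.card :=
    (mul_le_mul_of_nonneg_right hN (by positivity)).trans huniv
  obtain ⟨r, hr⟩ : ∃ r, Fintype.card V = S.card + r :=
    Nat.exists_eq_add_of_le (card_le_univ S)
  have hgap : 9 / 10 * growth S.card * (growth 1 * (4 / 5)) ^ r ≤ (cyclesIn G S).card := by
    have h45 : (0 : ℝ) < (4 / 5) ^ S.card := by positivity
    refine le_of_mul_le_mul_right (le_trans (le_of_eq ?_) hweight) h45
    rw [hr, growth_add, growth_eq_pow r, pow_add, mul_pow]
    ring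
  have h1 := growth_one_gt
  have hgS := growth_pos S.card
  have hdense : 9 / 10 * growth S.card ≤ (cyclesIn G S).card := by
    refine le_trans ?_ hgap
    have : 1 ≤ (growth 1 * (4 / 5)) ^ r := one_le_pow₀ (by linarith)
    nlinarith
  refine ⟨S, fun v hv => ?_, hweight, hdense, fun hne => ?_⟩
  · by_contra! hlt
    have h2 := hS (S.erase v) (mem_univ _)
    have h3 := card_cyclesIn_erase_add (G := G) S v
    have h4 := card_cyclesIn_through_mul_le (G := G) hv
    have h5 := sq_lt_growth (d := (nb G S v).card) (by omega)
    have h6 : (S.erase v).card + 1 = S.card := card_erase_add_one hv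
    rw [← h6, pow_succ, ← h3] at h2
    have h7 : (0 : ℝ) < (4 / 5) ^ (S.erase v).card := by positivity
    have h8 : ((cyclesIn G (S.erase v)).card : ℝ) ≤ ((cyclesIn G (S.erase v)).card +
        ((cyclesIn G S).filter (v ∈ ·)).card : ℕ) * (4 / 5) :=
      le_of_mul_le_mul_right (h2.trans_eq (by ring)) h7
    have h9 : ((cyclesIn G S).card : ℝ) = (cyclesIn G (S.erase v)).card +
        ((cyclesIn G S).filter (v ∈ ·)).card := by exact_mod_cast h3.symm
    push_cast at h8
    have h10 : 18 / 100 * growth S.card ≤ ((cyclesIn G S).filter (v ∈ ·)).card := by linarith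
    have hgd := growth_pos ((nb G S v).card + 1)
    nlinarith
  · have hr1 : 1 ≤ r := by
      have := card_lt_univ_of_notMem (s := S) (x := _)
        (Classical.choose_spec (not_forall.1 fun h => hne (eq_univ_iff_forall.2 h)))
      omega
    refine le_trans ?_ hgap
    -- One missing vertex already suffices: `1.44 * 0.8 > 1.15` and `0.9 * 1.15 > 1.03`.
    have : 1.15 ≤ (growth 1 * (4 / 5)) ^ r :=
      le_trans (by linarith) (le_self_pow₀ (by linarith) (by omega))
    nlinarith

theorem localBound_le (n : ℕ) : localBound n ≤ 12 * n + 51 := by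
  unfold localBound
  split_ifs <;> omega

/-- If the dense subset were proper, it would have at least `1.03 * growth` cycles, whereas the
bounded degree case allows only `maxProd` plus a linear term. -/
theorem exists_bound : ∃ n₀ : ℕ, ∀ (V : Type) [Fintype V] [DecidableEq V] (G : SimpleGraph V),
    n₀ ≤ Fintype.card V → 9 / 10 * growth (Fintype.card V) ≤ (cyclesIn G univ).card →
    (cyclesIn G univ).card ≤ maxProd (Fintype.card V) + localBound (Fintype.card V) := by
  obtain ⟨n₁, hn₁⟩ := exists_bound_of_card_nb_le 30 (by norm_num)
  obtain ⟨n₂, hn₂⟩ := Filter.eventually_atTop.1 (eventually_mul_pow_le_growth 3000 1)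
  have hr : 1 < growth 1 * (4 / 5) := by have := growth_one_gt; linarith
  obtain ⟨n₃, hn₃⟩ := pow_unbounded_of_one_lt (2 ^ (n₁ + n₂ + 1)) hr
  refine ⟨n₁ + n₃, fun V _ _ G hV hN => ?_⟩
  obtain ⟨S, hdeg, hweight, hdense, hproper⟩ := exists_dense_subset hN
  by_cases hS : S = univ
  · subst hS
    exact hn₁ V G (fun x => hdeg x (mem_univ x)) (by omega) hN
  exfalso
  -- A small `S` has at most `2 ^ S.card` cycles, too few for its weight to reach the exponentially
  -- large weight of the whole vertex set.
  have hlarge : n₁ + n₂ ≤ S.card := by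
    by_contra! hlt
    have h1 : ((cyclesIn G S).card : ℝ) ≤ 2 ^ (n₁ + n₂) := by
      refine le_trans ?_ (pow_le_pow_right₀ (by norm_num) hlt.le)
      exact_mod_cast card_cyclesIn_le_two_pow (G := G) S
    have h2 : (4 / 5 : ℝ) ^ S.card ≤ 1 := pow_le_one₀ (by norm_num) (by norm_num)
    have h3 : (growth 1 * (4 / 5)) ^ n₃ ≤ (growth 1 * (4 / 5)) ^ Fintype.card V :=
      pow_le_pow_right₀ hr.le (by omega)
    have h4 : ((cyclesIn G S).card : ℝ) * (4 / 5) ^ S.card ≤ (cyclesIn G S).card :=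
      mul_le_of_le_one_right (Nat.cast_nonneg _) h2
    rw [growth_eq_pow, mul_assoc, ← mul_pow] at hweight
    rw [pow_succ] at hn₃
    have h5 : (0 : ℝ) < 2 ^ (n₁ + n₂) := by positivity
    linarith
  have hcard : Fintype.card (S : Set V) = S.card := by simp
  have h1 := hn₁ (S : Set V) (G.induce (S : Set V))
    (fun v => by rw [card_nb_induce]; exact hdeg v v.2) (by omega)
    (by rwa [hcard, card_cyclesIn_induce])
  rw [hcard, card_cyclesIn_induce] at h1
  have h2 := hproper hS
  have h3 := hn₂ S.card (by omega)
  have h4 := maxProd_le_growth S.card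
  have h5 : ((cyclesIn G S).card : ℝ) ≤ maxProd S.card + (12 * S.card + 51) := by
    exact_mod_cast h1.trans (Nat.add_le_add_left (localBound_le _) _)
  rw [pow_one] at h3
  have : (0 : ℝ) ≤ S.card := Nat.cast_nonneg _
  linarith

end DegreeReduction

end InducedCycles

namespace InducedCycles

/-! ### The exact value and its order of magnitude -/

open Finset

/-- The density hypothesis of `exists_bound` holds for an extremal graph by the lower bound. -/
theorem exists_maxInducedCycles_eq : ∃ n₀ : ℕ, ∀ n, n₀ ≤ n →
    SimpleGraph.maxInducedCycles n = maxProd n + localBound n := by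
  obtain ⟨n₀, h⟩ := exists_bound
  refine ⟨n₀ + 12, fun n hn => ?_⟩
  have hlow := maxProd_add_localBound_le (N := n) (by omega)
  refine le_antisymm ?_ hlow
  obtain ⟨G, hG⟩ := (SimpleGraph.isGreatest_maxInducedCycles n).1
  simp only [numInducedCycles_eq] at hG
  have key := h (Fin n) G
  rw [Fintype.card_fin, hG] at key
  refine key (by omega) ((growth_le_maxProd (by omega)).trans ?_)
  exact_mod_cast (Nat.le_add_right _ _).trans hlow

theorem isTheta_maxInducedCycles : Asymptotics.IsTheta Filter.atTop
    (fun n : ℕ => (SimpleGraph.maxInducedCycles n : ℝ)) (fun n : ℕ => (3 : ℝ) ^ ((n : ℝ) / 3)) := by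
  obtain ⟨n₀, h⟩ := exists_maxInducedCycles_eq
  constructor
  · refine Asymptotics.IsBigO.of_bound 2 ?_
    filter_upwards [Filter.eventually_ge_atTop n₀, eventually_mul_pow_le_growth 51 1] with n hn hg
    change _ ≤ 2 * ‖growth n‖
    rw [h n hn, Real.norm_of_nonneg (Nat.cast_nonneg _), Real.norm_of_nonneg (growth_pos n).le]
    have h1 := maxProd_le_growth n
    have h2 : (localBound n : ℝ) ≤ 12 * n + 51 := by exact_mod_cast localBound_le n
    push_cast
    have : (0 : ℝ) ≤ n := Nat.cast_nonneg _
    linarith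
  · refine Asymptotics.IsBigO.of_bound 2 ?_
    filter_upwards [Filter.eventually_ge_atTop n₀, Filter.eventually_ge_atTop 2] with n hn hn2
    change ‖growth n‖ ≤ _
    rw [h n hn, Real.norm_of_nonneg (Nat.cast_nonneg _), Real.norm_of_nonneg (growth_pos n).le]
    have h1 := growth_le_maxProd hn2
    have h2 := growth_pos n
    push_cast
    have : (0 : ℝ) ≤ localBound n := Nat.cast_nonneg _
    linarith

end InducedCycles

theorem corollary1p2 :
    (∃ n₀ : ℕ, ∀ n : ℕ, n₀ ≤ n →
      (n ≡ 0 [MOD 3] →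
        (SimpleGraph.maxInducedCycles n : ℝ) = 3 ^ ((n : ℝ) / 3) + 12 * (n : ℝ)) ∧
      (n ≡ 1 [MOD 3] →
        (SimpleGraph.maxInducedCycles n : ℝ) =
          4 * 3 ^ (((n : ℝ) - 4) / 3) + 12 * (n : ℝ) + 51) ∧
      (n ≡ 2 [MOD 3] →
        (SimpleGraph.maxInducedCycles n : ℝ) =
          2 * 3 ^ (((n : ℝ) - 2) / 3) + 12 * (n : ℝ) - 36)) ∧
    Asymptotics.IsTheta Filter.atTop
      (fun n : ℕ => (SimpleGraph.maxInducedCycles n : ℝ))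
      (fun n : ℕ => (3 : ℝ) ^ ((n : ℝ) / 3)) := by
  refine ⟨?_, InducedCycles.isTheta_maxInducedCycles⟩
  obtain ⟨n₀, h⟩ := InducedCycles.exists_maxInducedCycles_eq
  have hpow : ∀ k : ℕ, (3 : ℝ) ^ ((3 * k : ℝ) / 3) = 3 ^ k := fun k => by
    rw [mul_div_cancel_left₀ _ (by norm_num), Real.rpow_natCast]
  refine ⟨n₀ + 4, fun n hn => ⟨fun hmod => ?_, fun hmod => ?_, fun hmod => ?_⟩⟩ <;>
    rw [h n (by omega)] <;> rw [Nat.ModEq] at hmod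
  · obtain ⟨k, rfl⟩ : ∃ k, n = 3 * k := ⟨n / 3, by omega⟩
    rw [InducedCycles.maxProd_three_mul (by omega), InducedCycles.localBound, if_pos hmod]
    push_cast
    rw [hpow]
  · obtain ⟨k, rfl⟩ : ∃ k, n = 3 * k + 4 := ⟨n / 3 - 1, by omega⟩
    rw [InducedCycles.maxProd_three_mul_add_four, InducedCycles.localBound, if_neg (by omega),
      if_pos hmod]
    push_cast
    rw [add_sub_cancel_right, hpow]
    ring
  · obtain ⟨k, rfl⟩ : ∃ k, n = 3 * k + 2 := ⟨n / 3, by omega⟩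
    rw [InducedCycles.maxProd_three_mul_add_two, InducedCycles.localBound, if_neg (by omega),
      if_neg (by omega), Nat.cast_add, Nat.cast_sub (by omega)]
    push_cast
    rw [add_sub_cancel_right, hpow]
    ring
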